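/- Let $M$ be a smooth ($C^\infty$, Hausdorff) manifold of dimension $m$ with a smooth Riemannian metric $g=\langle\ ,\ \rangle$ and a smooth linear connection $\nabla$ with $\nabla g=0$; let $T^\nabla(X,Y)=\nabla_XY-\nabla_YX-[X,Y]$ be its torsion and $R^\nabla$ its curvature ($\nabla$ is flat if $R^\nabla=0$). Let $\varphi_1,\varphi_2\in C^\infty(M)$, $f_1=e^{2\varphi_1}$, $f_2=e^{2\varphi_2}$, $\psi=\varphi_2-\varphi_1$, $\overline\psi=\varphi_2+\varphi_1$ (functions on $M$ are also viewed as functions on $TM$ through the projection $\pi:TM\to M$). On $TM$ let $\xi$ be the tautological section of $\pi^*TM$, $\xi_u=u$; let $V=\ker d\pi$ and $H=\{X:\ (\pi^*\nabla)_X\xi=0\}$, so that $T(TM)=H\oplus V$, where $d\pi:H\to\pi^*TM$ and $X\mapsto(\pi^*\nabla)_X\xi$, $V\to\pi^*TM$, are isomorphisms. Let $\theta$ be the endomorphism of $T(TM)$ that maps $H$ to $V$ through these isomorphisms and vanishes on $V$, and $\theta^t$ the one that maps $V$ to $H$ by the inverse isomorphism and vanishes on $H$. Put $$I^G=e^{\psi}\theta^t-e^{-\psi}\theta,\qquad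 G=f_1\,\pi^*g\oplus f_2\,\pi^*g\ \text{ on } H\oplus V,\qquad \omega^G(X,Y)=G(I^GX,Y).$$ For a function $\chi$ on $M$ write $(d\chi\wedge 1)(X,Y)=X(\chi)Y-Y(\chi)X$. (i) The almost complex structure $I^G$ is integrable (that is, induced by a complex manifold structure on $TM$: around each point there are smooth coordinates with values in $\mathbb C^m$ whose differential carries $I^G$ to multiplication by $\sqrt{-1}$) if and only if $\nabla$ is flat and $T^\nabla=d\psi\wedge 1$. In particular, if $m\ge 2$ and $T^\nabla=0$, then $I^G$ is integrable if and only if $M$ is Riemannian flat (the Levi-Civita connection $\nabla$ is flat) and $f_2/f_1$ is constant on each connected component of $M$. (ii) $(TM,\omega^G)$ is a symplectic manifold if and only if $T^\nabla=-\,d\overline\psi\wedge 1$. In particular, if $m\ge 2$ and $\nabla$ is the Levi-Civita connection, then $d\omega^G=0$ if and only if $f_1f_2$ is constant on each connected component of $M$. -/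

import Mathlib

open Bundle Set
open scoped Manifold ContDiff

noncomputable section

/-! ### Tensors on a manifold -/

section Tensors

variable {E : Type*} [NormedAddCommGroup E] [NormedSpace ℝ E]
  {H : Type*} [TopologicalSpace H] (I : ModelWithCorners ℝ E H)
  {N : Type*} [TopologicalSpace N] [ChartedSpace H N]

/-- An almost complex structure `J` on a real manifold `N` is *integrable* if it is induced by the
structure of a complex manifold: around every point there is a smooth coordinate system
`Φ : N ⊇ source → ℂⁿ` with `dΦ (J X) = i dΦ (X)`. (The changes of coordinates between such charts
are then automatically holomorphic.) -/
def IsIntegrableACS (n : ℕ) (J : ∀ p : N, TangentSpace I p →ₗ[ℝ] TangentSpace I p) : Prop :=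
  ∀ p : N, ∃ Φ : OpenPartialHomeomorph N (Fin n → ℂ), p ∈ Φ.source ∧
    ContMDiffOn I 𝓘(ℝ, Fin n → ℂ) ∞ Φ Φ.source ∧
    ContMDiffOn 𝓘(ℝ, Fin n → ℂ) I ∞ Φ.symm Φ.target ∧
    ∀ q ∈ Φ.source, ∀ X : TangentSpace I q,
      mvfderiv I Φ q (J q X) = Complex.I • mvfderiv I Φ q X

variable [IsManifold I 1 N]

variable {I} in
/-- `X` is a smooth vector field. -/
def IsSmoothVF (X : ∀ p : N, TangentSpace I p) : Prop :=
  ContMDiff I I.tangent ∞ (fun p ↦ (⟨p, X p⟩ : TangentBundle I N))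

/-- The exterior derivative of the 2-form `α`, evaluated on vector fields:
`dα(X,Y,Z) = X α(Y,Z) - Y α(X,Z) + Z α(X,Y) - α([X,Y],Z) + α([X,Z],Y) - α([Y,Z],X)`. -/
def extDerivTwoForm (α : ∀ p : N, TangentSpace I p →ₗ[ℝ] TangentSpace I p →ₗ[ℝ] ℝ)
    (X Y Z : ∀ p : N, TangentSpace I p) (p : N) : ℝ :=
  mvfderiv I (fun q ↦ α q (Y q) (Z q)) p (X p)
    - mvfderiv I (fun q ↦ α q (X q) (Z q)) p (Y p)
    + mvfderiv I (fun q ↦ α q (X q) (Y q)) p (Z p)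
    - α p (VectorField.mlieBracket I X Y p) (Z p)
    + α p (VectorField.mlieBracket I X Z p) (Y p)
    - α p (VectorField.mlieBracket I Y Z p) (X p)

/-- `dα = 0`. -/
def IsClosedTwoForm (α : ∀ p : N, TangentSpace I p →ₗ[ℝ] TangentSpace I p →ₗ[ℝ] ℝ) : Prop :=
  ∀ X Y Z : ∀ p : N, TangentSpace I p, IsSmoothVF X → IsSmoothVF Y → IsSmoothVF Z →
    ∀ p, extDerivTwoForm I α X Y Z p = 0

/-- `α` is a symplectic form: a smooth nondegenerate closed 2-form. -/
structure IsSymplecticForm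
    (α : ∀ p : N, TangentSpace I p →ₗ[ℝ] TangentSpace I p →ₗ[ℝ] ℝ) : Prop where
  smooth : ∀ X Y : ∀ p : N, TangentSpace I p, IsSmoothVF X → IsSmoothVF Y →
    ContMDiff I 𝓘(ℝ) ∞ (fun p ↦ α p (X p) (Y p))
  alternating : ∀ (p : N) (X : TangentSpace I p), α p X X = 0
  nondegenerate : ∀ (p : N) (X : TangentSpace I p), (∀ Y, α p X Y = 0) → X = 0
  closed : IsClosedTwoForm I α

end Tensors

/-- `f` is constant on each connected component (so it is constant if `N` is connected). -/
def IsConstOnComponents {N : Type*} [TopologicalSpace N] (f : N → ℝ) : Prop :=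
  ∀ x : N, ∀ y ∈ connectedComponent x, f y = f x

/-! ### The geometry of the tangent bundle -/

section Sasaki

variable {m : ℕ} {M : Type*} [TopologicalSpace M] [ChartedSpace (EuclideanSpace ℝ (Fin m)) M]
  [IsManifold (𝓡 m) ∞ M]

/-- The curvature `R(X,Y)Z = ∇_X ∇_Y Z - ∇_Y ∇_X Z - ∇_[X,Y] Z` vanishes. -/
def IsFlatConnection
    (cov : CovariantDerivative (𝓡 m) (EuclideanSpace ℝ (Fin m))
      (TangentSpace (𝓡 m) : M → Type _)) : Prop :=
  ∀ X Y Z : ∀ x : M, TangentSpace (𝓡 m) x, IsSmoothVF X → IsSmoothVF Y → IsSmoothVF Z →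
    ∀ x : M, cov (fun y ↦ cov Z y (Y y)) x (X x) - cov (fun y ↦ cov Z y (X y)) x (Y x)
      - cov Z x (VectorField.mlieBracket (𝓡 m) X Y x) = 0

/-- The differential `dπ : T_u TM → T_{π u} M` of the projection. Its kernel is the vertical
space `V_u`. -/
def dProj (u : TangentBundle (𝓡 m) M) :
    TangentSpace (𝓡 m).tangent u →L[ℝ] TangentSpace (𝓡 m) u.proj :=
  mfderiv (𝓡 m).tangent (𝓡 m) (fun p : TangentBundle (𝓡 m) M ↦ p.proj) u

/-- The derivatives `dv = (dv¹, …, dvᵐ)` at `u` of the fibre coordinates `v` on `TM`, with respect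
to the coordinate frame `∂₁, …, ∂ₘ` of the chart of `M` at `π u`. -/
def dFibreCoord (u : TangentBundle (𝓡 m) M) :
    TangentSpace (𝓡 m).tangent u →L[ℝ] EuclideanSpace ℝ (Fin m) :=
  mvfderiv (𝓡 m).tangent (fun p : TangentBundle (𝓡 m) M ↦
    (trivializationAt (EuclideanSpace ℝ (Fin m)) (TangentSpace (𝓡 m)) u.proj p).2) u

/-- The local vector field `∑ vⁱ(u) ∂ᵢ` on `M` with constant coefficients with respect to the
coordinate frame `∂₁, …, ∂ₘ` of the chart of `M` at `π u`; its value at `π u` is `u`. -/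
def constCoeffField (u : TangentBundle (𝓡 m) M) (y : M) : TangentSpace (𝓡 m) y :=
  (trivializationAt (EuclideanSpace ℝ (Fin m)) (TangentSpace (𝓡 m)) u.proj).symm y
    (trivializationAt (EuclideanSpace ℝ (Fin m)) (TangentSpace (𝓡 m)) u.proj u).2

variable (cov : CovariantDerivative (𝓡 m) (EuclideanSpace ℝ (Fin m))
      (TangentSpace (𝓡 m) : M → Type _))

/-- The vertical projection `X ↦ π^*∇_X ξ ∈ T_{π u} M`, where `ξ_u = u` is the tautological section
of `π^*TM`. In a chart, with `ξ = ∑ vⁱ ∂ᵢ`, this is `∑ dvⁱ(X) ∂ᵢ + ∑ vⁱ ∇_{dπ X} ∂ᵢ`. The kernel of this map is the horizontal space `H_u`. -/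
def vertProj (u : TangentBundle (𝓡 m) M) :
    TangentSpace (𝓡 m).tangent u →L[ℝ] TangentSpace (𝓡 m) u.proj :=
  ((trivializationAt (EuclideanSpace ℝ (Fin m)) (TangentSpace (𝓡 m)) u.proj).symmL ℝ u.proj).comp
      (dFibreCoord u)
    + (cov (constCoeffField u) u.proj).comp (dProj u)

theorem bijective_dProj_vertProj (u : TangentBundle (𝓡 m) M) :
    Function.Bijective ((dProj u).prod (vertProj cov u)) := by
  set e := trivializationAt (EuclideanSpace ℝ (Fin m)) (TangentSpace (𝓡 m) : M → Type _) u.proj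
    with he
  have hu : u ∈ e.source := FiberBundle.mem_trivializationAt_proj_source
  have hx : u.proj ∈ e.baseSet := FiberBundle.mem_baseSet_trivializationAt' u.proj
  have hmd := Bundle.Trivialization.mdifferentiable (I := 𝓡 m)
    (TangentSpace (𝓡 m) : M → Type _) e
  have hbij := hmd.mfderiv_injective hu
  have hsnd : MDifferentiableAt (𝓡 m).tangent 𝓘(ℝ, EuclideanSpace ℝ (Fin m))
      (fun p : TangentBundle (𝓡 m) M ↦ (e p).2) u :=
    (mdifferentiableAt_snd).comp u (hmd.mdifferentiableAt hu)
  have hproj : MDifferentiableAt (𝓡 m).tangent (𝓡 m)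
      (fun p : TangentBundle (𝓡 m) M ↦ p.proj) u := mdifferentiableAt_proj _
  have hev : (fun p : TangentBundle (𝓡 m) M ↦ e p) =ᶠ[nhds u] fun p ↦ (p.proj, (e p).2) := by
    filter_upwards [e.open_source.mem_nhds hu] with p hp
    exact Prod.ext (e.coe_fst hp) rfl
  have hinj : Function.Injective ((dProj u).prod (vertProj cov u)) := by
    rw [injective_iff_map_eq_zero]
    intro X hX
    have h1 : dProj u X = 0 := congrArg Prod.fst hX
    have h2 : vertProj cov u X = 0 := congrArg Prod.snd hX
    have h3 : e.symmL ℝ u.proj (dFibreCoord u X) = 0 := by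
      simpa [vertProj, h1] using h2
    have h4 : dFibreCoord u X = 0 := by
      have := e.continuousLinearMapAt_symmL (R := ℝ) hx (dFibreCoord u X)
      rw [h3, map_zero] at this
      exact this.symm
    apply hbij
    have h5 : mfderiv (𝓡 m).tangent ((𝓡 m).prod 𝓘(ℝ, EuclideanSpace ℝ (Fin m))) e u
        = (dProj u).prod (mfderiv (𝓡 m).tangent 𝓘(ℝ, EuclideanSpace ℝ (Fin m))
            (fun p : TangentBundle (𝓡 m) M ↦ (e p).2) u) := by
      rw [Filter.EventuallyEq.mfderiv_eq hev]
      exact mfderiv_prodMk hproj hsnd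
    have h6 : mfderiv (𝓡 m).tangent ((𝓡 m).prod 𝓘(ℝ, EuclideanSpace ℝ (Fin m))) e u X = 0 := by
      rw [h5]
      exact Prod.ext h1 h4
    exact h6.trans (map_zero _).symm
  have hfin : Module.finrank ℝ (TangentSpace (𝓡 m).tangent u)
      = Module.finrank ℝ (TangentSpace (𝓡 m) u.proj × TangentSpace (𝓡 m) u.proj) := rfl
  have : FiniteDimensional ℝ (TangentSpace (𝓡 m).tangent u) :=
    inferInstanceAs
      (FiniteDimensional ℝ (EuclideanSpace ℝ (Fin m) × EuclideanSpace ℝ (Fin m)))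
  have : FiniteDimensional ℝ
      (TangentSpace (𝓡 m) u.proj × TangentSpace (𝓡 m) u.proj) :=
    inferInstanceAs
      (FiniteDimensional ℝ (EuclideanSpace ℝ (Fin m) × EuclideanSpace ℝ (Fin m)))
  exact ⟨hinj, (LinearMap.injective_iff_surjective_of_finrank_eq_finrank
    (f := ((dProj u).prod (vertProj cov u)).toLinearMap) hfin).1 hinj⟩

/-- The splitting `T_u TM = H_u ⊕ V_u ≅ T_{π u} M × T_{π u} M`, `X ↦ (dπ X, π^*∇_X ξ)`. -/
def splitting (u : TangentBundle (𝓡 m) M) :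
    TangentSpace (𝓡 m).tangent u ≃ₗ[ℝ] TangentSpace (𝓡 m) u.proj × TangentSpace (𝓡 m) u.proj :=
  LinearEquiv.ofBijective ((dProj u).prod (vertProj cov u)).toLinearMap
    (bijective_dProj_vertProj cov u)

/-- The endomorphism `θ` of `TTM`: it maps a horizontal vector to its mirror image in `V`, and
kills `V`. -/
def theta (u : TangentBundle (𝓡 m) M) :
    TangentSpace (𝓡 m).tangent u →ₗ[ℝ] TangentSpace (𝓡 m).tangent u :=
  (splitting cov u).symm.toLinearMap ∘ₗ
    LinearMap.inr ℝ (TangentSpace (𝓡 m) u.proj) (TangentSpace (𝓡 m) u.proj) ∘ₗ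
      (dProj u).toLinearMap

/-- The endomorphism `θᵗ` of `TTM`: it maps a vertical vector to its mirror image in `H`, and
kills `H`. -/
def thetaT (u : TangentBundle (𝓡 m) M) :
    TangentSpace (𝓡 m).tangent u →ₗ[ℝ] TangentSpace (𝓡 m).tangent u :=
  (splitting cov u).symm.toLinearMap ∘ₗ
    LinearMap.inl ℝ (TangentSpace (𝓡 m) u.proj) (TangentSpace (𝓡 m) u.proj) ∘ₗ
      (vertProj cov u).toLinearMap

/-- `I^G = e^ψ θᵗ - e^{-ψ} θ`, where `ψ = φ₂ - φ₁`. -/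
def acsG (φ₁ φ₂ : M → ℝ) (u : TangentBundle (𝓡 m) M) :
    TangentSpace (𝓡 m).tangent u →ₗ[ℝ] TangentSpace (𝓡 m).tangent u :=
  Real.exp (φ₂ u.proj - φ₁ u.proj) • thetaT cov u
    - Real.exp (-(φ₂ u.proj - φ₁ u.proj)) • theta cov u

variable [RiemannianBundle (fun x : M ↦ TangentSpace (𝓡 m) x)]

/-- The weighted metric `G = f₁ π^*g ⊕ f₂ π^*g` on `TTM = H ⊕ V`. -/
def metricG (f₁ f₂ : M → ℝ) (u : TangentBundle (𝓡 m) M) :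
    TangentSpace (𝓡 m).tangent u →ₗ[ℝ] TangentSpace (𝓡 m).tangent u →ₗ[ℝ] ℝ :=
  f₁ u.proj • (innerₗ (TangentSpace (𝓡 m) u.proj)).compl₁₂
      (dProj u).toLinearMap (dProj u).toLinearMap
    + f₂ u.proj • (innerₗ (TangentSpace (𝓡 m) u.proj)).compl₁₂
      (vertProj cov u).toLinearMap (vertProj cov u).toLinearMap

/-- `ω^G(X,Y) = G(I^G X, Y)`, where `G = f₁ π^*g ⊕ f₂ π^*g` and `fᵢ = e^{2φᵢ}`. -/
def omegaG (f₁ f₂ φ₁ φ₂ : M → ℝ) (u : TangentBundle (𝓡 m) M) :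
    TangentSpace (𝓡 m).tangent u →ₗ[ℝ] TangentSpace (𝓡 m).tangent u →ₗ[ℝ] ℝ :=
  metricG cov f₁ f₂ u ∘ₗ acsG cov φ₁ φ₂ u

end Sasaki

end

/-! The statement is local on M. In the coordinates (z, v) of TM given by a chart, with ∇ = d + Γ, a
tangent vector (a, b) has vertical part b + Γ(a)v, and `chartDiff_acsG` and `omegaG_eq_localOmega`
make I^G and ω^G explicit. Flatness, the torsion condition and ∇g = 0 become identities for Γ and
the coordinate metric.

(i) Necessity: a holomorphic chart F satisfies dF(w, -Γ(w)v) = i e^{-ψ} dF(0, w) for every w.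
Differentiating this and cancelling all second derivatives by their symmetry gives dF(0, R(a,b)v) =
i e^{-ψ} dF(0, S) with S = (dψ ∧ 1 - T)(a,b). The first relation turns the right side into dF(S,
-Γ(S)v), so injectivity of dF forces S = 0 and then R(a,b)v = 0
(`localCurvature_eq_zero_of_holomorphic`). Sufficiency: flatness gives a local parallel coframe Q,
dQ = QΓ (`exists_hasFDerivAt_mul_of_flat`). The torsion condition makes e^{-ψ}Q closed, so e^{-ψ}Q =
dX locally, and Qv + iX are holomorphic coordinates (`exists_holomorphic_coordinates`). Thus neither
direction uses the Newlander-Nirenberg theorem.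

(ii) Put χ = φ₁ + φ₂. Since f₁e^ψ = f₂e^{-ψ} = e^χ, the form ω^G pairs H with V through e^χ g; it is
always smooth, alternating and nondegenerate, so only closedness matters. Let η = e^χ g(v, dπ ·) and
S = T + dχ ∧ 1. From ∇g = 0 one gets dη - ω^G = e^χ g(v, S(dπ ·, dπ ·)). If S = 0 then ω^G = dη is
closed. Conversely, dω^G on a vertical vector c and coordinate vectors a, b equals -e^χ g(c,
S(a,b)), and c = S(a,b) gives S = 0.

In the special cases T = 0, and for m ≥ 2 the condition dχ ∧ 1 = 0 forces dχ = 0, that is, χ is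
constant on components; likewise for ψ. -/

open Filter Topology
open scoped NNReal

/-! ### Parallel frames of flat connections by radial transport. -/

section FlatFrames

set_option synthInstance.maxHeartbeats 200000

variable {E : Type*} [NormedAddCommGroup E] [NormedSpace ℝ E]
  {𝔸 : Type*} [NormedRing 𝔸] [NormedAlgebra ℝ 𝔸]

theorem gronwallBound_zero_left_eq_mul (K ε x : ℝ) :
    gronwallBound 0 K ε x = ε * gronwallBound 0 K 1 x := by
  unfold gronwallBound
  split <;> ring

/-- A pointwise estimate comparing the radial transport of `A` along two neighbouring rays, using
that `A` is flat. -/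
theorem norm_flat_defect_le {A : E → E →L[ℝ] 𝔸} {A' : E → E →L[ℝ] E →L[ℝ] 𝔸} {s : Set E}
    (hs : Convex ℝ s) {M₀ M₁ L : ℝ}
    (hA : ∀ z ∈ s, HasFDerivAt A (A' z) z) (hM₀ : ∀ z ∈ s, ‖A z‖ ≤ M₀) (hM₁ : ∀ z ∈ s, ‖A' z‖ ≤ M₁)
    (hL : ∀ z ∈ s, ∀ w ∈ s, ‖A' z - A' w‖ ≤ L * ‖z - w‖) (hLn : 0 ≤ L)
    (hflat : ∀ z ∈ s, ∀ a b, A' z a b + A z a * A z b = A' z b a + A z b * A z a)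
    {x y : E} {t : ℝ} (ht : t ∈ Icc (0 : ℝ) 1) (hx : t • x ∈ s) (hy : t • y ∈ s)
    (hx1 : ‖x‖ ≤ 1) (hy1 : ‖y‖ ≤ 1) :
    ‖A (t • x) x + A (t • x) (y - x) + t • (A (t • x) x * A (t • x) (y - x))
        + t • A' (t • x) x (y - x) - (A (t • y) y + t • (A (t • x) (y - x) * A (t • y) y))‖
      ≤ (L + M₁ + M₀ * (M₁ + M₀)) * ‖y - x‖ ^ 2 := by
  set h := y - x with hh
  have hM₀n : 0 ≤ M₀ := (norm_nonneg _).trans (hM₀ _ hx)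
  have hM₁n : 0 ≤ M₁ := le_trans (norm_nonneg (A' (t • x))) (hM₁ _ hx)
  have hth : t • y - t • x = t • h := by rw [hh, smul_sub]
  have htn : ‖t • h‖ ≤ ‖h‖ := by
    rw [norm_smul, Real.norm_of_nonneg ht.1]
    exact mul_le_of_le_one_left (norm_nonneg _) ht.2
  have e1 : ‖A (t • y) - A (t • x)‖ ≤ M₁ * ‖h‖ := by
    refine (hs.norm_image_sub_le_of_norm_hasFDerivWithin_le
      (fun z hz ↦ (hA z hz).hasFDerivWithinAt) hM₁ hx hy).trans ?_
    rw [hth]; gcongr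
  have e2 : ‖A (t • y) - A (t • x) - A' (t • x) (t • h)‖ ≤ L * ‖h‖ * ‖h‖ := by
    have hseg : segment ℝ (t • x) (t • y) ⊆ s := hs.segment_subset hx hy
    have := (convex_segment (t • x) (t • y)).norm_image_sub_le_of_norm_hasFDerivWithin_le'
      (f := A) (f' := A') (φ := A' (t • x)) (C := L * ‖h‖)
      (fun z hz ↦ (hA z (hseg hz)).hasFDerivWithinAt) (fun z hz ↦ ?_)
      (left_mem_segment _ _ _) (right_mem_segment _ _ _)
    · rw [hth] at this
      refine this.trans ?_
      gcongr
    · refine (hL z (hseg hz) _ hx).trans ?_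
      have : ‖z - t • x‖ ≤ ‖t • y - t • x‖ := by
        exact norm_sub_le_of_mem_segment hz
      rw [hth] at this
      gcongr
      exact this.trans htn
  -- Flatness exchanges x and h in A'(tx) x h + A(tx)x A(tx)h. Substituting y = x + h, all terms of
  -- order at most one in h then cancel, leaving the Taylor remainder of A and terms with two
  -- factors of size h.
  have key : A (t • x) x + A (t • x) h + t • (A (t • x) x * A (t • x) h)
        + t • A' (t • x) x h - (A (t • y) y + t • (A (t • x) h * A (t • y) y))
      = -((A (t • y) - A (t • x) - A' (t • x) (t • h)) y) - t • A' (t • x) h h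
        - t • (A (t • x) h * ((A (t • y) - A (t • x)) x + A (t • y) h)) := by
    have hfl := hflat _ hx x h
    have hyx : y = x + h := by rw [hh]; abel
    have h1 : t • A' (t • x) x h + t • (A (t • x) x * A (t • x) h)
        = t • A' (t • x) h x + t • (A (t • x) h * A (t • x) x) := by
      rw [← smul_add, ← smul_add, hfl]
    have h2 : A (t • x) x + A (t • x) h + t • (A (t • x) x * A (t • x) h) + t • A' (t • x) x h
        = A (t • x) x + A (t • x) h
          + (t • A' (t • x) h x + t • (A (t • x) h * A (t • x) x)) := by
      rw [← h1]; abel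
    rw [h2]
    have hAy : A (t • y) y = A (t • y) x + A (t • y) h := by
      conv_lhs => rw [show A (t • y) y = A (t • y) (x + h) by rw [← hyx]]
      rw [map_add]
    have hBy : ∀ B : E →L[ℝ] 𝔸, B y = B x + B h := fun B ↦ by
      rw [← map_add, ← hyx]
    rw [hBy (A (t • y) - A (t • x) - A' (t • x) (t • h)), hAy]
    simp only [neg_add, neg_sub, sub_apply, map_smul,
      smul_apply, mul_add, mul_sub, smul_add, smul_sub]
    abel
  rw [key]
  have ht1 : ∀ a : 𝔸, ‖t • a‖ ≤ ‖a‖ := fun a ↦ by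
    rw [norm_smul, Real.norm_of_nonneg ht.1]
    exact mul_le_of_le_one_left (norm_nonneg _) ht.2
  have n1 : ‖-((A (t • y) - A (t • x) - A' (t • x) (t • h)) y)‖ ≤ L * ‖h‖ * ‖h‖ := by
    rw [norm_neg]
    refine (ContinuousLinearMap.le_opNorm _ _).trans ?_
    calc _ ≤ (L * ‖h‖ * ‖h‖) * 1 := by gcongr
      _ = _ := mul_one _
  have n2 : ‖t • A' (t • x) h h‖ ≤ M₁ * ‖h‖ * ‖h‖ := by
    refine (ht1 _).trans ((ContinuousLinearMap.le_opNorm₂ _ _ _).trans ?_)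
    gcongr
    exact hM₁ _ hx
  have n3 : ‖t • (A (t • x) h * ((A (t • y) - A (t • x)) x + A (t • y) h))‖
      ≤ (M₀ * ‖h‖) * (M₁ * ‖h‖ * 1 + M₀ * ‖h‖) := by
    refine (ht1 _).trans ((norm_mul_le _ _).trans ?_)
    gcongr
    · exact (ContinuousLinearMap.le_opNorm _ _).trans (by gcongr; exact hM₀ _ hx)
    · refine (norm_add_le _ _).trans ?_
      gcongr
      · exact (ContinuousLinearMap.le_opNorm _ _).trans (by gcongr)
      · exact (ContinuousLinearMap.le_opNorm _ _).trans (by gcongr; exact hM₀ _ hy)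
  refine (norm_sub_le _ _).trans ((add_le_add (norm_sub_le _ _) le_rfl).trans ?_)
  refine (add_le_add (add_le_add n1 n2) n3).trans (le_of_eq ?_)
  ring

/-- Existence of solutions of the linear equation `q' = q B(t)` with `B` small. -/
theorem exists_hasDerivWithinAt_mul_right [CompleteSpace 𝔸] {B : ℝ → 𝔸}
    (hB : ContinuousOn B (Icc 0 1)) (hn : ∀ t ∈ Icc (0 : ℝ) 1, (‖(1 : 𝔸)‖ + 1) * ‖B t‖ ≤ 1) :
    ∃ q : ℝ → 𝔸, q 0 = 1 ∧ ∀ t ∈ Icc (0 : ℝ) 1, HasDerivWithinAt q (q t * B t) (Icc 0 1) t := by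
  -- On the ball of radius 1 about 1 one has ‖q‖ ≤ ‖1‖ + 1 (the norm of 1 is not assumed to be 1),
  -- so the field is bounded by 1 there and the solution cannot leave the ball before time 1.
  have hpl : IsPicardLindelof (fun t (q : 𝔸) ↦ q * B t) (tmin := 0) (tmax := 1)
      ⟨0, by simp⟩ (1 : 𝔸) 1 0 1 1 := by
    refine ⟨fun t ht ↦ ?_, fun x _ ↦ continuousOn_const.mul hB, fun t ht x hx ↦ ?_, by simp⟩
    · refine LipschitzOnWith.of_dist_le_mul fun x _ y _ ↦ ?_
      rw [dist_eq_norm, dist_eq_norm, ← sub_mul]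
      refine (norm_mul_le _ _).trans ?_
      rw [NNReal.coe_one, one_mul]
      refine mul_le_of_le_one_right (norm_nonneg _) ?_
      refine le_trans ?_ (hn t ht)
      exact le_mul_of_one_le_left (norm_nonneg _) (by linarith [norm_nonneg (1 : 𝔸)])
    · refine (norm_mul_le _ _).trans ?_
      have hx' : ‖x‖ ≤ ‖(1 : 𝔸)‖ + 1 := by
        have h1 : ‖x - 1‖ ≤ 1 := by simpa [dist_eq_norm] using hx
        calc ‖x‖ = ‖1 + (x - 1)‖ := by congr 1; abel
          _ ≤ _ := (norm_add_le _ _).trans (by gcongr)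
      exact (mul_le_mul_of_nonneg_right hx' (norm_nonneg _)).trans (hn t ht)
  exact hpl.exists_eq_forall_mem_Icc_hasDerivWithinAt₀

set_option maxHeartbeats 1000000 in
-- Q(x) is the value at time 1 of the transport q' = q A(tx)x along the ray to x, with q(0) = 1.
-- Differentiability in x comes without parameter dependence of ODEs: for y = x + h the curve
-- q_x(t)(1 + t A(tx)h) solves the equation of the ray to y up to O(‖h‖²), thanks to flatness.
-- Grönwall's inequality then gives Q(y) = Q(x) + Q(x)A(x)h + O(‖h‖²).
theorem exists_hasFDerivAt_mul_of_flat_zero [CompleteSpace 𝔸] {A : E → E →L[ℝ] 𝔸}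
    (hA : ContDiffAt ℝ 2 A 0)
    (hflat : ∀ᶠ z in 𝓝 (0 : E), ∀ a b,
      fderiv ℝ A z a b + A z a * A z b = fderiv ℝ A z b a + A z b * A z a) :
    ∃ Q : E → 𝔸, Q 0 = 1 ∧
      ∀ᶠ x in 𝓝 (0 : E), HasFDerivAt Q ((ContinuousLinearMap.mul ℝ 𝔸 (Q x)).comp (A x)) x := by
  have hA' : ContDiffAt ℝ 1 (fderiv ℝ A) 0 := hA.fderiv_right (by norm_num)
  obtain ⟨K, u, hu, hK⟩ := hA'.exists_lipschitzOnWith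
  set M₀ : ℝ := ‖A 0‖ + 1 with hM₀
  set M₁ : ℝ := ‖fderiv ℝ A 0‖ + 1 with hM₁
  have hM₀pos : 0 < M₀ := by positivity
  have ev : ∀ᶠ z in 𝓝 (0 : E), z ∈ u ∧ DifferentiableAt ℝ A z ∧ ‖A z‖ < M₀ ∧ ‖fderiv ℝ A z‖ < M₁ ∧
      (∀ a b, fderiv ℝ A z a b + A z a * A z b = fderiv ℝ A z b a + A z b * A z a) ∧
      (‖(1 : 𝔸)‖ + 1) * (M₀ * ‖z‖) < 1 ∧ ‖z‖ < 1 := by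
    have h1 : ∀ᶠ z in 𝓝 (0 : E), DifferentiableAt ℝ A z := by
      filter_upwards [hA.eventually (by simp)] with z hz
      exact hz.differentiableAt (by norm_num)
    have h2 : ∀ᶠ z in 𝓝 (0 : E), ‖A z‖ < M₀ :=
      hA.continuousAt.norm.eventually_lt continuousAt_const (by simp [hM₀])
    have h3 : ∀ᶠ z in 𝓝 (0 : E), ‖fderiv ℝ A z‖ < M₁ := by
      have hn : ContinuousAt (fun z ↦ ‖fderiv ℝ A z‖) 0 :=
        (continuous_norm (E := E →L[ℝ] E →L[ℝ] 𝔸)).continuousAt.comp hA'.continuousAt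
      exact hn.eventually_lt continuousAt_const (lt_add_one _)
    have h4 : ∀ᶠ z in 𝓝 (0 : E), (‖(1 : 𝔸)‖ + 1) * (M₀ * ‖z‖) < 1 := by
      refine ContinuousAt.eventually_lt (by fun_prop) continuousAt_const (by simp)
    have h5 : ∀ᶠ z in 𝓝 (0 : E), ‖z‖ < 1 :=
      ContinuousAt.eventually_lt (by fun_prop) continuousAt_const (by simp)
    filter_upwards [hu, h1, h2, h3, hflat, h4, h5] with z g0 g1 g2 g3 g4 g5 g6
    exact ⟨g0, g1, g2, g3, g4, g5, g6⟩
  obtain ⟨r, hr, hball⟩ := Metric.eventually_nhds_iff_ball.1 ev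
  set s := Metric.ball (0 : E) r
  have hs : Convex ℝ s := convex_ball _ _
  have h0s : (0 : E) ∈ s := Metric.mem_ball_self hr
  have hstar : ∀ x ∈ s, ∀ t ∈ Icc (0 : ℝ) 1, t • x ∈ s := fun x hx t ht ↦
    hs.smul_mem_of_zero_mem h0s hx ht
  have hB : ∀ x ∈ s, ContinuousOn (fun t : ℝ ↦ A (t • x) x) (Icc 0 1) := fun x hx t ht ↦ by
    have : ContinuousAt A (t • x) := (hball _ (hstar x hx t ht)).2.1.continuousAt
    have h2 : ContinuousAt (fun t : ℝ ↦ A (t • x)) t :=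
      ContinuousAt.comp (f := fun t : ℝ ↦ t • x) this (by fun_prop)
    exact (h2.clm_apply continuousAt_const).continuousWithinAt
  have hex : ∀ x ∈ s, ∃ q : ℝ → 𝔸, q 0 = 1 ∧
      ∀ t ∈ Icc (0 : ℝ) 1, HasDerivWithinAt q (q t * A (t • x) x) (Icc 0 1) t := fun x hx ↦ by
    refine exists_hasDerivWithinAt_mul_right (hB x hx) fun t ht ↦ ?_
    refine le_trans ?_ (hball x hx).2.2.2.2.2.1.le
    gcongr
    refine (ContinuousLinearMap.le_opNorm _ _).trans ?_
    gcongr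
    exact (hball _ (hstar x hx t ht)).2.2.1.le
  choose! q hq0 hq using hex
  refine ⟨fun x ↦ q x 1, ?_, ?_⟩
  -- The ray to 0 is constant, and A(0)0 = 0, so the transport along it does not move.
  · change q 0 1 = 1
    obtain ⟨c, hc⟩ : ∃ c, ∀ t ∈ Icc (0 : ℝ) 1, q 0 t = c := ⟨q 0 0, fun t ht ↦ by
      refine constant_of_derivWithin_zero (a := 0) (b := 1) (fun t ht ↦
        (hq 0 h0s t ht).differentiableWithinAt) (fun t ht ↦ ?_) t ht
      rw [(hq 0 h0s t (Ico_subset_Icc_self ht)).derivWithin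
        (uniqueDiffOn_Icc zero_lt_one _ (Ico_subset_Icc_self ht))]
      simp⟩
    rw [hc 1 (by simp), ← hc 0 (by simp), hq0 0 h0s]
  filter_upwards [Metric.isOpen_ball.mem_nhds h0s] with x hx
  have hcont : ∀ y ∈ s, ContinuousOn (q y) (Icc 0 1) := fun y hy t ht ↦
    (hq y hy t ht).continuousWithinAt
  obtain ⟨C, hC⟩ := isCompact_Icc.exists_bound_of_continuousOn (hcont x hx)
  have hC0 : 0 ≤ C := (norm_nonneg _).trans (hC 0 (by simp))
  set D : ℝ := K + M₁ + M₀ * (M₁ + M₀) with hD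
  have hIci : ∀ {f : ℝ → 𝔸} {f' : 𝔸} {t : ℝ}, t ∈ Ico (0 : ℝ) 1 →
      HasDerivWithinAt f f' (Icc 0 1) t → HasDerivWithinAt f f' (Ici t) t := fun ht h ↦
    h.mono_of_mem_nhdsWithin (Icc_mem_nhdsGE_of_mem ht)
  have hmain : ∀ y ∈ s, ‖q y 1 - q x 1 - q x 1 * A x (y - x)‖
      ≤ (C * D * gronwallBound 0 M₀ 1 1) * ‖y - x‖ ^ 2 := fun y hy ↦ by
    set h := y - x with hh
    have hAd : ∀ t ∈ Icc (0 : ℝ) 1,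
        HasDerivAt (fun t : ℝ ↦ A (t • x) h) (fderiv ℝ A (t • x) x h) t := fun t ht ↦ by
      have h1 := (hball _ (hstar x hx t ht)).2.1.hasFDerivAt
      have h2 : HasDerivAt (fun t : ℝ ↦ t • x) x t := by
        simpa using (hasDerivAt_id t).smul_const x
      have h3 := h1.comp_hasDerivAt t h2
      exact ((ContinuousLinearMap.apply ℝ 𝔸 h).hasFDerivAt.comp_hasDerivAt t h3)
    -- The approximate solution for the ray to y; at t = 1 it is the first-order expansion of Q at
    -- x.
    have hp : ∀ t ∈ Icc (0 : ℝ) 1, HasDerivWithinAt (fun t ↦ q x t + t • (q x t * A (t • x) h))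
        (q x t * A (t • x) x + (t • (q x t * A (t • x) x * A (t • x) h
          + q x t * fderiv ℝ A (t • x) x h) + (1 : ℝ) • (q x t * A (t • x) h))) (Icc 0 1) t :=
      fun t ht ↦ (hq x hx t ht).add
        ((hasDerivWithinAt_id t _).smul ((hq x hx t ht).mul (hAd t ht).hasDerivWithinAt))
    -- The clamp `min 1 (max 0 t)` makes the field Lipschitz at every real time, as the Grönwall
    -- estimate requires; on [0, 1] it changes nothing.
    have hgr := dist_le_of_approx_trajectories_ODE (a := 0) (b := 1) (K := M₀.toNNReal)
      (δ := 0) (εf := 0) (εg := C * (D * ‖h‖ ^ 2)) (v := fun t p ↦ p * A (min 1 (max 0 t) • y) y)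
      (f := q y) (g := fun t ↦ q x t + t • (q x t * A (t • x) h))
      (f' := fun t ↦ q y t * A (t • y) y)
      (fun t ↦ ?_) (hcont y hy) (fun t ht ↦ hIci ht (hq y hy t (Ico_subset_Icc_self ht)))
      (fun t ht ↦ ?_) (fun t ht ↦ (hp t ht).continuousWithinAt)
      (fun t ht ↦ hIci ht (hp t (Ico_subset_Icc_self ht))) (fun t ht ↦ ?_) ?_ 1 (by simp)
    · rw [dist_eq_norm, gronwallBound_zero_left_eq_mul] at hgr
      simp only [one_smul, zero_add, sub_zero, Real.coe_toNNReal _ hM₀pos.le] at hgr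
      rw [← sub_sub] at hgr
      refine hgr.trans (le_of_eq ?_)
      ring
    · refine LipschitzWith.of_dist_le_mul fun a b ↦ ?_
      rw [dist_eq_norm, dist_eq_norm, ← sub_mul, mul_comm (M₀.toNNReal : ℝ),
        Real.coe_toNNReal _ hM₀pos.le]
      refine (norm_mul_le _ _).trans ?_
      gcongr
      have hm : min 1 (max 0 t) ∈ Icc (0 : ℝ) 1 := ⟨by simp, by simp⟩
      refine (ContinuousLinearMap.le_opNorm _ _).trans ?_
      exact (mul_le_mul (hball _ (hstar y hy _ hm)).2.2.1.le (hball y hy).2.2.2.2.2.2.le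
        (norm_nonneg _) hM₀pos.le).trans_eq (mul_one _)
    · rw [max_eq_right ht.1, min_eq_right ht.2.le, dist_self]
    · have ht' := Ico_subset_Icc_self ht
      rw [max_eq_right ht.1, min_eq_right ht.2.le, dist_eq_norm]
      have hdef := norm_flat_defect_le (A := A) (A' := fderiv ℝ A) hs
        (fun z hz ↦ (hball z hz).2.1.hasFDerivAt) (fun z hz ↦ (hball z hz).2.2.1.le)
        (fun z hz ↦ (hball z hz).2.2.2.1.le)
        (fun z hz w hw ↦ hK.norm_sub_le (hball z hz).1 (hball w hw).1) K.2
        (fun z hz ↦ (hball z hz).2.2.2.2.1) ht' (hstar x hx t ht') (hstar y hy t ht')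
        (hball x hx).2.2.2.2.2.2.le (hball y hy).2.2.2.2.2.2.le
      -- The error of the approximate solution factors as q_x(t) times the expression bounded in
      -- `norm_flat_defect_le`.
      refine le_trans (le_of_eq ?_) ((norm_mul_le (q x t) _).trans
        (mul_le_mul (hC t ht') hdef (norm_nonneg _) hC0))
      congr 1
      simp only [mul_add, mul_sub, add_mul, smul_add, one_smul, mul_smul_comm, smul_mul_assoc,
        mul_assoc, hh]
      abel
    · simp [hq0 y hy, hq0 x hx]
  rw [hasFDerivAt_iff_isLittleO_nhds_zero]
  have hO : (fun h ↦ q (x + h) 1 - q x 1 - ((ContinuousLinearMap.mul ℝ 𝔸 (q x 1)).comp (A x)) h)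
      =O[𝓝 0] fun h ↦ ‖h‖ ^ 2 := by
    refine Asymptotics.IsBigO.of_bound (C * D * gronwallBound 0 M₀ 1 1) ?_
    have hc : ContinuousAt (fun h : E ↦ x + h) 0 := by fun_prop
    have : ∀ᶠ h in 𝓝 (0 : E), x + h ∈ s :=
      hc.eventually_mem (Metric.isOpen_ball.mem_nhds (by simpa using hx))
    filter_upwards [this] with h hh
    simpa using hmain _ hh
  exact hO.trans_isLittleO (Asymptotics.isLittleO_norm_pow_id one_lt_two)

/-- **Local existence of parallel frames for flat connections.** If the connection form `A`, with
values in a Banach algebra, is flat near `x₀`, then `dQ = Q A` has a local solution with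
`Q x₀ = 1`. -/
theorem exists_hasFDerivAt_mul_of_flat [CompleteSpace 𝔸] {A : E → E →L[ℝ] 𝔸} {x₀ : E}
    (hA : ContDiffAt ℝ 2 A x₀)
    (hflat : ∀ᶠ z in 𝓝 x₀, ∀ a b,
      fderiv ℝ A z a b + A z a * A z b = fderiv ℝ A z b a + A z b * A z a) :
    ∃ Q : E → 𝔸, Q x₀ = 1 ∧
      ∀ᶠ x in 𝓝 x₀, HasFDerivAt Q ((ContinuousLinearMap.mul ℝ 𝔸 (Q x)).comp (A x)) x := by
  have hc : Tendsto (fun x : E ↦ x + x₀) (𝓝 0) (𝓝 x₀) := by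
    simpa using (continuous_add_const x₀).tendsto (0 : E)
  have hc' : Tendsto (fun x : E ↦ x - x₀) (𝓝 x₀) (𝓝 0) := by
    simpa using (continuous_sub_right x₀).tendsto x₀
  obtain ⟨Q, hQ0, hQ⟩ := exists_hasFDerivAt_mul_of_flat_zero (A := fun x ↦ A (x + x₀))
    (ContDiffAt.comp (g := A) (f := fun x ↦ x + x₀) 0 (by simpa using hA) (by fun_prop)) (by
      filter_upwards [hc.eventually hflat] with z hz a b
      rw [fderiv_comp_add_right]
      exact hz a b)
  refine ⟨fun x ↦ Q (x - x₀), by simpa using hQ0, ?_⟩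
  filter_upwards [hc'.eventually hQ] with x hx
  simp only [sub_add_cancel] at hx
  rw [sub_eq_add_neg] at hx
  simpa only [sub_eq_add_neg] using (hasFDerivAt_comp_add_right (-x₀)).2 hx

end FlatFrames

/-! ### The almost complex structure in coordinates: integrability forces flatness and the torsion
condition. -/

noncomputable section LocalModel

set_option synthInstance.maxHeartbeats 200000

variable {E : Type*} [NormedAddCommGroup E] [NormedSpace ℝ E]

theorem DifferentiableAt.hasFDerivAt_clm_apply_const {F G H : Type*} [NormedAddCommGroup F]
    [NormedSpace ℝ F] [NormedAddCommGroup G] [NormedSpace ℝ G] [NormedAddCommGroup H]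
    [NormedSpace ℝ H] {A : H → G →L[ℝ] F} {x : H} (hA : DifferentiableAt ℝ A x) (w : G) :
    HasFDerivAt (fun z ↦ A z w) ((fderiv ℝ A x).flip w) x := by
  simpa using hA.hasFDerivAt.clm_apply (hasFDerivAt_const w x)

/-- The curvature of the connection `d + Γ` on the trivial bundle `E × E → E`. -/
def localCurvature (Γ : E → E →L[ℝ] E →L[ℝ] E) (z a b v : E) : E :=
  fderiv ℝ Γ z a b v - fderiv ℝ Γ z b a v + Γ z a (Γ z b v) - Γ z b (Γ z a v)

/-- The almost complex structure `I^G` in the coordinates `(z, v)`. -/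
def localACS (Γ : E → E →L[ℝ] E →L[ℝ] E) (ψ : E → ℝ) (p X : E × E) : E × E :=
  (Real.exp (ψ p.1) • (X.2 + Γ p.1 X.1 p.2),
    -(Γ p.1 (Real.exp (ψ p.1) • (X.2 + Γ p.1 X.1 p.2)) p.2) - Real.exp (-ψ p.1) • X.1)

variable {W : Type*} [NormedAddCommGroup W] [NormedSpace ℝ W] [NormedSpace ℂ W]
  [IsScalarTower ℝ ℂ W]

set_option maxHeartbeats 1000000 in
-- The defining relation of a holomorphic map, tested on vertical vectors, compares dF on horizontal
-- and vertical lifts. Its derivatives in two horizontal and two vertical directions combine so that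
-- every second derivative of F cancels. What remains relates curvature and torsion through the
-- injective map dF.
theorem localCurvature_eq_zero_of_holomorphic {Γ : E → E →L[ℝ] E →L[ℝ] E} {ψ : E → ℝ}
    {F : E × E → W} {p : E × E} (hΓ : DifferentiableAt ℝ Γ p.1) (hψ : DifferentiableAt ℝ ψ p.1)
    (hF : ContDiffAt ℝ 2 F p)
    (hJ : ∀ᶠ q in 𝓝 p, ∀ X, fderiv ℝ F q (localACS Γ ψ q X) = Complex.I • fderiv ℝ F q X)
    (hinj : Function.Injective (fderiv ℝ F p)) (a b : E) :
    localCurvature Γ p.1 a b p.2 = 0 ∧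
      Γ p.1 a b - Γ p.1 b a = fderiv ℝ ψ p.1 a • b - fderiv ℝ ψ p.1 b • a := by
  set F' := fderiv ℝ F with hF'def
  have hF' : DifferentiableAt ℝ F' p :=
    (hF.fderiv_right (m := 1) (by norm_num)).differentiableAt (by norm_num)
  set F₂ := fderiv ℝ F' p with hF₂
  have hsymm : ∀ X Y, F₂ X Y = F₂ Y X := fun X Y ↦
    (hF.isSymmSndFDerivAt (by simp)).eq X Y
  have hH : ∀ w : E, ∀ᶠ q in 𝓝 p, F' q (w, -(Γ q.1 w q.2))
      = Complex.I • (Real.exp (-ψ q.1) • F' q (0, w)) := fun w ↦ by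
    filter_upwards [hJ] with q hq
    -- This vertical vector is scaled so that its image under the structure is exactly the
    -- horizontal lift of w.
    have h := hq (0, Real.exp (-ψ q.1) • w)
    have h2 : localACS Γ ψ q (0, Real.exp (-ψ q.1) • w) = (w, -(Γ q.1 w q.2)) := by
      simp [localACS, smul_smul, ← Real.exp_add]
    rw [h2] at h
    rw [h, ← ContinuousLinearMap.map_smul, Prod.smul_mk, smul_zero]
  set c := Real.exp (-ψ p.1) with hc
  have hfst : HasFDerivAt (Prod.fst : E × E → E) (ContinuousLinearMap.fst ℝ E E) p :=
    hasFDerivAt_fst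
  have hsnd : HasFDerivAt (Prod.snd : E × E → E) (ContinuousLinearMap.snd ℝ E E) p :=
    hasFDerivAt_snd
  -- The relation `hH` differentiated at p in the direction X.
  have hD : ∀ (w : E) (X : E × E), F₂ X (w, -(Γ p.1 w p.2))
      + F' p (0, -(fderiv ℝ Γ p.1 X.1 w p.2 + Γ p.1 w X.2))
      = Complex.I • (c • F₂ X (0, w) - (fderiv ℝ ψ p.1 X.1 * c) • F' p (0, w)) := fun w X ↦ by
    have hΓw : HasFDerivAt (fun q : E × E ↦ Γ q.1 w)
        (((fderiv ℝ Γ p.1).flip w).comp (ContinuousLinearMap.fst ℝ E E)) p :=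
      (hΓ.hasFDerivAt_clm_apply_const w).comp p hfst
    have hv := (hasFDerivAt_const w p).prodMk (hΓw.clm_apply hsnd).neg
    have h1 := hF'.hasFDerivAt.clm_apply hv
    have he : HasFDerivAt (fun q : E × E ↦ Real.exp (-ψ q.1))
        (c • -((fderiv ℝ ψ p.1).comp (ContinuousLinearMap.fst ℝ E E))) p :=
      ((hψ.hasFDerivAt.comp p hfst).neg).exp
    have h2 := (he.smul (hF'.hasFDerivAt.clm_apply (hasFDerivAt_const ((0 : E), w) p))).const_smul
      Complex.I
    have h3 := h1.congr_of_eventuallyEq ((hH w).mono fun q hq ↦ hq.symm)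
    have h4 := DFunLike.congr_fun (h3.unique h2) X
    simp [← hF₂] at h4
    rw [neg_add]
    refine (add_comm _ _).trans (h4.trans ?_)
    rw [← hc, mul_comm c]
    simp only [sub_eq_add_neg, smul_add, smul_neg]
  set v := p.2
  have e1 := hD b (a, -(Γ p.1 a v))
  have e2 := hD a (b, -(Γ p.1 b v))
  have e3 := hD a (0, b)
  have e4 := hD b (0, a)
  simp only [map_zero, zero_apply, zero_add, zero_mul, zero_smul, sub_zero] at e3 e4
  set k : E →L[ℝ] W := (F' p).comp (ContinuousLinearMap.inr ℝ E E) with hk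
  have hkx : ∀ x, F' p (0, x) = k x := fun x ↦ rfl
  rw [hsymm (0, b) (a, _)] at e3
  rw [hsymm (0, a) (b, _), hsymm (0, a)] at e4
  rw [hsymm (b, _) (a, _)] at e2
  simp only [hkx, map_neg, map_add] at e1 e2 e3 e4
  -- The horizontal derivatives `e1`, `e2` contribute the curvature; multiplying the vertical ones
  -- `e3`, `e4` by i e^{-ψ} removes the mixed second derivatives and contributes the torsion.
  have hkey : k (localCurvature Γ p.1 a b v) = Complex.I • (c •
      k (fderiv ℝ ψ p.1 a • b - fderiv ℝ ψ p.1 b • a - (Γ p.1 a b - Γ p.1 b a))) := by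
    simp only [localCurvature, map_sub, map_add, map_smul]
    have hIc : ∀ (r : ℝ) (x : W), Complex.I • (r • x) = (Complex.I * (r : ℂ)) • x := fun r x ↦ by
      rw [mul_smul]
      exact congrArg _ (algebraMap_smul ℂ r x).symm
    simp only [smul_sub, smul_smul, hIc] at e1 e2 e3 e4 ⊢
    push_cast at e1 e2 e3 e4 ⊢
    linear_combination (norm := module)
      e2 - e1 - (Complex.I * (c : ℂ)) • e3 + (Complex.I * (c : ℂ)) • e4
  -- With w = S, the difference of dψ ∧ 1 and the torsion, the right side of `hH` is the right side
  -- of `hkey`. Hence (S, -Γ(S)v) and (0, R(a,b)v) have the same image under dF.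
  have hS := (hH (fderiv ℝ ψ p.1 a • b - fderiv ℝ ψ p.1 b • a
    - (Γ p.1 a b - Γ p.1 b a))).self_of_nhds
  rw [hkx, ← hkey, ← hkx] at hS
  have h0 := hinj hS
  rw [Prod.mk.injEq] at h0
  refine ⟨?_, (sub_eq_zero.1 h0.1).symm⟩
  rw [← h0.2, h0.1]
  simp

end LocalModel

/-! ### Parallel coframes and their potentials. -/

noncomputable section FlatCoordinates

set_option synthInstance.maxHeartbeats 200000

section

variable {E F : Type*} [NormedAddCommGroup E] [NormedSpace ℝ E] [NormedAddCommGroup F]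
  [NormedSpace ℝ F]

/-- A solution of a total differential equation `dQ = G(x, Q)` with smooth right-hand side is
smooth. -/
theorem contDiffOn_infty_of_hasFDerivAt_comp {Q : E → F} {G : E × F → E →L[ℝ] F} {V : Set E}
    (hV : IsOpen V) (hG : ContDiffOn ℝ ∞ G (V ×ˢ univ))
    (hQ : ∀ x ∈ V, HasFDerivAt Q (G (x, Q x)) x) : ContDiffOn ℝ ∞ Q V := by
  rw [contDiffOn_infty]
  intro n
  induction n with
  | zero => exact contDiffOn_zero.2 fun x hx ↦ (hQ x hx).continuousAt.continuousWithinAt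
  | succ n ih =>
    rw [Nat.cast_succ, contDiffOn_succ_iff_fderiv_of_isOpen hV]
    refine ⟨fun x hx ↦ (hQ x hx).differentiableAt.differentiableWithinAt, by simp, ?_⟩
    -- Bootstrapping: if Q is of class Cⁿ then so is its derivative G(x, Q).
    refine ContDiffOn.congr (f := fun x ↦ G (x, Q x)) ?_ fun x hx ↦ (hQ x hx).fderiv
    exact (hG.of_le (by exact_mod_cast le_top)).comp (contDiffOn_id.prodMk ih)
      fun x hx ↦ ⟨hx, mem_univ _⟩

theorem contDiff_mul_left_clm (𝔸 : Type*) [NormedRing 𝔸] [NormedAlgebra ℝ 𝔸] {n : ℕ∞ω} :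
    ContDiff ℝ n (fun a : 𝔸 ↦ ContinuousLinearMap.mul ℝ 𝔸 a) :=
  IsBoundedLinearMap.contDiff (ContinuousLinearMap.isBoundedLinearMap (E := 𝔸) (F := 𝔸 →L[ℝ] 𝔸)
    (ContinuousLinearMap.mul ℝ 𝔸))

end

variable {E : Type*} [NormedAddCommGroup E] [NormedSpace ℝ E] [CompleteSpace E]

/-- Flat coordinates: a parallel coframe `Q` and functions `X` with `dX = e^{-ψ} Q`. -/
theorem exists_flat_coordinates {Γ : E → E →L[ℝ] E →L[ℝ] E} {ψ : E → ℝ} {U : Set E} {z₀ : E}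
    (hU : IsOpen U) (hz₀ : z₀ ∈ U) (hΓ : ContDiffOn ℝ ∞ Γ U) (hψ : ContDiffOn ℝ ∞ ψ U)
    (hR : ∀ z ∈ U, ∀ a b v, localCurvature Γ z a b v = 0)
    (hT : ∀ z ∈ U, ∀ a b, Γ z a b - Γ z b a = fderiv ℝ ψ z a • b - fderiv ℝ ψ z b • a) :
    ∃ (V : Set E) (Q : E → E →L[ℝ] E) (X : E → E), IsOpen V ∧ z₀ ∈ V ∧ V ⊆ U ∧
      ContDiffOn ℝ ∞ Q V ∧ ContDiffOn ℝ ∞ X V ∧ (∀ z ∈ V, Function.Injective (Q z)) ∧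
      (∀ z ∈ V, ∀ v, HasFDerivAt (fun z ↦ Q z v) ((Q z).comp ((Γ z).flip v)) z) ∧
      ∀ z ∈ V, HasFDerivAt X (Real.exp (-ψ z) • Q z) z := by
  have hΓ2 : ContDiffAt ℝ 2 Γ z₀ :=
    (hΓ.contDiffAt (hU.mem_nhds hz₀)).of_le ENat.LEInfty.out
  -- In the algebra of endomorphisms of E the flatness equation is the vanishing of the curvature,
  -- and dQ = QΓ says that the components of Q are parallel 1-forms.
  obtain ⟨Q, hQ1, hQ⟩ := exists_hasFDerivAt_mul_of_flat (A := Γ) (x₀ := z₀) hΓ2 (by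
    filter_upwards [hU.mem_nhds hz₀] with z hz a b
    ext v
    have := hR z hz a b v
    simp only [localCurvature] at this
    change fderiv ℝ Γ z a b v + Γ z a (Γ z b v) = fderiv ℝ Γ z b a v + Γ z b (Γ z a v)
    rw [← sub_eq_zero, ← this]
    abel)
  have hunit : ∀ᶠ z in 𝓝 z₀, IsUnit (Q z) := by
    have hc : ContinuousAt Q z₀ := hQ.self_of_nhds.continuousAt
    refine hc.eventually_mem (Units.isOpen.mem_nhds ?_)
    rw [hQ1]
    exact isUnit_one
  obtain ⟨r, hr, hball⟩ := Metric.eventually_nhds_iff_ball.1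
    ((hQ.and hunit).and (hU.mem_nhds hz₀))
  set V := Metric.ball z₀ r
  have hV : IsOpen V := Metric.isOpen_ball
  have hVU : V ⊆ U := fun z hz ↦ (hball z hz).2
  have hQsm : ContDiffOn ℝ ∞ Q V := by
    refine contDiffOn_infty_of_hasFDerivAt_comp
      (G := fun p : E × (E →L[ℝ] E) ↦ (ContinuousLinearMap.mul ℝ (E →L[ℝ] E) p.2).comp (Γ p.1)) hV
      ?_ fun x hx ↦ (hball x hx).1.1
    refine ContDiffOn.clm_comp ?_ ?_
    · exact ((contDiff_mul_left_clm (E →L[ℝ] E)).comp contDiff_snd).contDiffOn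
    · exact (hΓ.mono hVU).comp contDiffOn_fst fun p hp ↦ hp.1
  have hQv : ∀ z ∈ V, ∀ v, HasFDerivAt (fun z ↦ Q z v) ((Q z).comp ((Γ z).flip v)) z :=
    fun z hz v ↦ by
      have h := (hball z hz).1.1
      have h2 := h.differentiableAt.hasFDerivAt_clm_apply_const v
      rw [h.fderiv] at h2
      convert! h2 using 1
  set η : E → E →L[ℝ] E := fun z ↦ Real.exp (-ψ z) • Q z with hη
  have hηsm : ContDiffOn ℝ ∞ η V := ((hψ.mono hVU).neg.exp).smul hQsm
  have hηd : DifferentiableOn ℝ η V := hηsm.differentiableOn (by simp)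
  -- The exterior derivative of η on (a, b) is e^{-ψ}Q applied to T(a,b) - (dψ ∧ 1)(a,b), which is
  -- zero; the Poincaré lemma on a convex ball provides X.
  obtain ⟨X, hX⟩ := (convex_ball z₀ r).exists_forall_hasFDerivAt_of_fderiv_symmetric
    Metric.isOpen_ball hηd (fun z hz a b ↦ by
      have key : ∀ a b, fderiv ℝ η z a b
          = Real.exp (-ψ z) • (Q z (Γ z a b) - fderiv ℝ ψ z a • Q z b) := fun a b ↦ by
        have h1 := ((hηd z hz).differentiableAt
          (hV.mem_nhds hz)).hasFDerivAt_clm_apply_const b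
        have hψz : HasFDerivAt ψ (fderiv ℝ ψ z) z :=
          ((hψ.contDiffAt (hU.mem_nhds (hVU hz))).differentiableAt (by simp)).hasFDerivAt
        have h2 := hψz.neg.exp.smul (hQv z hz b)
        have h3 := DFunLike.congr_fun (h1.unique h2) a
        simp only [ContinuousLinearMap.flip_apply] at h3
        rw [h3]
        simp [smul_smul, sub_eq_add_neg]
      rw [key, key]
      congr 1
      have h := congrArg (Q z) (hT z (hVU hz) a b)
      simp only [map_sub, map_smul] at h
      rw [sub_eq_sub_iff_add_eq_add] at h ⊢
      rw [h]
      abel)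
  refine ⟨V, Q, X, hV, Metric.mem_ball_self hr, hVU, hQsm, ?_, fun z hz ↦ ?_, hQv, hX⟩
  · refine contDiffOn_infty_of_hasFDerivAt_comp (G := fun p : E × E ↦ η p.1) hV ?_ hX
    exact hηsm.comp contDiffOn_fst fun p hp ↦ hp.1
  · obtain ⟨u, hu⟩ := (hball z hz).1.2
    refine Function.LeftInverse.injective (g := (↑u⁻¹ : E →L[ℝ] E)) fun x ↦ ?_
    rw [← hu]
    exact DFunLike.congr_fun u.inv_mul x

end FlatCoordinates

/-! ### Holomorphic coordinates built from flat ones. -/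

noncomputable section ComplexCoordinates

set_option synthInstance.maxHeartbeats 200000

/-- A smooth map whose derivative is everywhere injective, between spaces of the same finite
dimension, restricts to a smooth chart near each point. -/
theorem exists_openPartialHomeomorph_of_injective_fderiv {E F : Type*} [NormedAddCommGroup E]
    [NormedSpace ℝ E] [FiniteDimensional ℝ E] [NormedAddCommGroup F] [NormedSpace ℝ F]
    [FiniteDimensional ℝ F] (hdim : Module.finrank ℝ E = Module.finrank ℝ F) {f : E → F} {s : Set E}
    (hs : IsOpen s) (hf : ContDiffOn ℝ ∞ f s)
    (hinj : ∀ x ∈ s, Function.Injective (fderiv ℝ f x)) {p : E} (hp : p ∈ s) :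
    ∃ Φ : OpenPartialHomeomorph E F, p ∈ Φ.source ∧ Φ.source ⊆ s ∧ (Φ : E → F) = f ∧
      ContDiffOn ℝ ∞ Φ.symm Φ.target := by
  have : CompleteSpace E := FiniteDimensional.complete ℝ E
  have hat : ∀ x ∈ s, ContDiffAt ℝ ∞ f x := fun x hx ↦ hf.contDiffAt (hs.mem_nhds hx)
  have heq : ∀ x ∈ s, ∃ L : E ≃L[ℝ] F, HasFDerivAt f (L : E →L[ℝ] F) x := fun x hx ↦ by
    refine ⟨(LinearEquiv.ofInjectiveOfFinrankEq (fderiv ℝ f x).toLinearMap (hinj x hx)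
      hdim).toContinuousLinearEquiv, ?_⟩
    convert! ((hat x hx).differentiableAt (by simp)).hasFDerivAt
  obtain ⟨L, hL⟩ := heq p hp
  set Φ₀ := (hat p hp).toOpenPartialHomeomorph f hL (by simp) with hΦ₀
  -- Inside s the derivative is invertible at every point of the source, so the inverse is smooth on
  -- the whole target and not only at the image of p.
  refine ⟨Φ₀.restrOpen s hs, ?_, ?_, rfl, ?_⟩
  · rw [OpenPartialHomeomorph.restrOpen_source]
    exact ⟨(hat p hp).mem_toOpenPartialHomeomorph_source hL (by simp), hp⟩
  · rw [OpenPartialHomeomorph.restrOpen_source]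
    exact inter_subset_right
  · intro y hy
    have hy' := (Φ₀.restrOpen s hs).map_target hy
    rw [OpenPartialHomeomorph.restrOpen_source] at hy'
    obtain ⟨L', hL'⟩ := heq _ hy'.2
    exact ((Φ₀.restrOpen s hs).contDiffAt_symm hy hL' (hat _ hy'.2)).contDiffWithinAt

variable {m : ℕ}

local notation "𝔼" => EuclideanSpace ℝ (Fin m)

/-- The map `v + i x` from pairs of real vectors to complex vectors. -/
def complexCombine (m : ℕ) :
    EuclideanSpace ℝ (Fin m) × EuclideanSpace ℝ (Fin m) →L[ℝ] (Fin m → ℂ) :=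
  ContinuousLinearMap.pi fun i ↦
    (Complex.ofRealCLM.comp ((EuclideanSpace.proj i).comp (ContinuousLinearMap.fst ℝ _ _)))
    + Complex.I • (Complex.ofRealCLM.comp
      ((EuclideanSpace.proj i).comp (ContinuousLinearMap.snd ℝ _ _)))

theorem complexCombine_apply (p : 𝔼 × 𝔼) (i : Fin m) :
    complexCombine m p i = (p.1 i : ℂ) + Complex.I * (p.2 i : ℂ) := by
  simp [complexCombine]

theorem I_smul_complexCombine (p : 𝔼 × 𝔼) :
    Complex.I • complexCombine m p = complexCombine m (-p.2, p.1) := by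
  ext i
  rw [Pi.smul_apply, complexCombine_apply, complexCombine_apply, smul_eq_mul, mul_add, ← mul_assoc,
    Complex.I_mul_I]
  simp only [PiLp.neg_apply, Complex.ofReal_neg]
  ring

theorem complexCombine_injective : Function.Injective (complexCombine m) := by
  intro p q h
  have h' : ∀ i, p.1 i = q.1 i ∧ p.2 i = q.2 i := fun i ↦ by
    have := congrFun h i
    rw [complexCombine_apply, complexCombine_apply] at this
    have hre := congrArg Complex.re this
    have him := congrArg Complex.im this
    simp at hre him
    exact ⟨hre, him⟩
  exact Prod.ext (PiLp.ext fun i ↦ (h' i).1) (PiLp.ext fun i ↦ (h' i).2)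

/-- The coordinates are Qv + iX. Since dQ = QΓ, the differential of Qv is Q applied to the vertical
part, while dX is e^{-ψ}Q applied to the base part. The structure sends vertical part V and base
part a to -e^{-ψ}a and e^ψ V, which replaces the pair (Qv, X) of differentials by (-dX, d(Qv)), that
is, multiplies by i. -/
theorem exists_holomorphic_coordinates {Γ : 𝔼 → 𝔼 →L[ℝ] 𝔼 →L[ℝ] 𝔼} {ψ : 𝔼 → ℝ} {U : Set 𝔼}
    (hU : IsOpen U) (hΓ : ContDiffOn ℝ ∞ Γ U) (hψ : ContDiffOn ℝ ∞ ψ U)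
    (hR : ∀ z ∈ U, ∀ a b v, localCurvature Γ z a b v = 0)
    (hT : ∀ z ∈ U, ∀ a b, Γ z a b - Γ z b a = fderiv ℝ ψ z a • b - fderiv ℝ ψ z b • a)
    {p : 𝔼 × 𝔼} (hp : p.1 ∈ U) :
    ∃ Φ : OpenPartialHomeomorph (𝔼 × 𝔼) (Fin m → ℂ), p ∈ Φ.source ∧ Φ.source ⊆ U ×ˢ univ ∧
      ContDiffOn ℝ ∞ Φ Φ.source ∧ ContDiffOn ℝ ∞ Φ.symm Φ.target ∧
      ∀ q ∈ Φ.source, ∀ X, fderiv ℝ Φ q (localACS Γ ψ q X) = Complex.I • fderiv ℝ Φ q X := by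
  obtain ⟨V, Q, X, hV, hpV, hVU, hQs, hXs, hQi, hQ, hX⟩ :=
    exists_flat_coordinates hU hp hΓ hψ hR hT
  set F : 𝔼 × 𝔼 → (Fin m → ℂ) := fun q ↦ complexCombine m (Q q.1 q.2, X q.1) with hF
  have hFs : ContDiffOn ℝ ∞ F (V ×ˢ univ) := by
    refine (complexCombine m).contDiff.comp_contDiffOn (ContDiffOn.prodMk ?_ ?_)
    · exact ContDiffOn.clm_apply (hQs.comp contDiffOn_fst fun q hq ↦ hq.1) contDiffOn_snd
    · exact hXs.comp contDiffOn_fst fun q hq ↦ hq.1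
  have hFd : ∀ q ∈ V ×ˢ univ, ∀ Y : 𝔼 × 𝔼, fderiv ℝ F q Y = complexCombine m
      (Q q.1 (Y.2 + Γ q.1 Y.1 q.2), Real.exp (-ψ q.1) • Q q.1 Y.1) := fun q hq Y ↦ by
    have hQd : DifferentiableAt ℝ Q q.1 :=
      (hQs.contDiffAt (hV.mem_nhds hq.1)).differentiableAt (by simp)
    have h1 := (hQd.hasFDerivAt.comp q (hasFDerivAt_fst (𝕜 := ℝ) (p := q))).clm_apply
      (hasFDerivAt_snd (𝕜 := ℝ) (p := q))
    have h2 := (hX q.1 hq.1).comp q (hasFDerivAt_fst (𝕜 := ℝ) (p := q))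
    have h3 := (complexCombine m).hasFDerivAt.comp q (h1.prodMk h2)
    have h4 : HasFDerivAt F _ q := h3
    rw [h4.fderiv]
    have h5 := DFunLike.congr_fun
      ((hQd.hasFDerivAt_clm_apply_const q.2).unique (hQ q.1 hq.1 q.2)) Y.1
    simp only [ContinuousLinearMap.flip_apply, ContinuousLinearMap.comp_apply] at h5
    simp [h5]
  have hVo : IsOpen (V ×ˢ (univ : Set 𝔼)) := hV.prod isOpen_univ
  obtain ⟨Φ, h1, h2, h3, h4⟩ := exists_openPartialHomeomorph_of_injective_fderiv (f := F)
    (s := V ×ˢ univ) (p := p) (by simp [Module.finrank_pi_fintype]; ring) hVo hFs (fun q hq ↦ by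
      rw [injective_iff_map_eq_zero]
      intro Y hY
      rw [hFd q hq, ← map_zero (complexCombine m)] at hY
      have h := complexCombine_injective hY
      rw [Prod.ext_iff] at h
      have ha : Y.1 = 0 := by
        have := (smul_eq_zero.1 h.2).resolve_left (Real.exp_pos _).ne'
        exact hQi q.1 hq.1 (this.trans (map_zero _).symm)
      have hb : Y.2 = 0 := by
        have := hQi q.1 hq.1 (h.1.trans (map_zero (Q q.1)).symm)
        simpa [ha] using this
      exact Prod.ext ha hb) ⟨hpV, mem_univ _⟩
  refine ⟨Φ, h1, h2.trans (prod_mono hVU subset_rfl), ?_, h4, fun q hq Y ↦ ?_⟩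
  · rw [h3]
    exact hFs.mono h2
  · rw [h3, hFd q (h2 hq), hFd q (h2 hq), I_smul_complexCombine]
    simp only [localACS, map_smul, smul_apply]
    congr 1
    refine Prod.ext ?_ ?_
    · simp
      abel
    · simp only [smul_smul, ← Real.exp_add]
      simp

end ComplexCoordinates

/-! ### The 2-form in coordinates and its exterior derivative. -/

noncomputable section LocalSymplectic

set_option synthInstance.maxHeartbeats 200000

section

variable {E : Type*} [NormedAddCommGroup E] [NormedSpace ℝ E]

/-- The exterior derivative of a 2-form on a vector space, evaluated on constant vector fields. -/
def localExtDeriv (α : E → E →L[ℝ] E →L[ℝ] ℝ) (p X Y Z : E) : ℝ :=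
  fderiv ℝ α p X Y Z - fderiv ℝ α p Y X Z + fderiv ℝ α p Z X Y

theorem DifferentiableAt.hasFDerivAt_comp_fst {F G : Type*} [NormedAddCommGroup F] [NormedSpace ℝ F]
    [NormedAddCommGroup G] [NormedSpace ℝ G] {A : E → F} {p : E × G}
    (hA : DifferentiableAt ℝ A p.1) : HasFDerivAt (fun q : E × G ↦ A q.1)
      ((fderiv ℝ A p.1).comp (ContinuousLinearMap.fst ℝ E G)) p :=
  hA.hasFDerivAt.comp p hasFDerivAt_fst

theorem fderiv_clm_apply_apply {F G₁ G₂ : Type*} [NormedAddCommGroup F] [NormedSpace ℝ F]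
    [NormedAddCommGroup G₁] [NormedSpace ℝ G₁] [NormedAddCommGroup G₂] [NormedSpace ℝ G₂]
    {α : E → G₁ →L[ℝ] G₂ →L[ℝ] F} {p : E} (hα : DifferentiableAt ℝ α p) (X : E) (Y : G₁) (Z : G₂) :
    fderiv ℝ α p X Y Z = fderiv ℝ (fun q ↦ α q Y Z) p X := by
  have h1 := hα.hasFDerivAt_clm_apply_const Y
  have h2 := h1.differentiableAt.hasFDerivAt_clm_apply_const Z
  rw [h1.fderiv] at h2
  rw [h2.fderiv]
  rfl

/-- This is d(dη) = 0: the second derivatives of η cancel in pairs by symmetry. -/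
theorem localExtDeriv_eq_zero_of_eventuallyEq {α : E → E →L[ℝ] E →L[ℝ] ℝ} {η : E → E →L[ℝ] ℝ}
    {p : E} (hη : ContDiffAt ℝ 2 η p) (hα : DifferentiableAt ℝ α p)
    (h : ∀ᶠ q in 𝓝 p, ∀ X Y, α q X Y = fderiv ℝ η q X Y - fderiv ℝ η q Y X) (X Y Z : E) :
    localExtDeriv α p X Y Z = 0 := by
  have hd : DifferentiableAt ℝ (fderiv ℝ η) p :=
    (hη.fderiv_right (m := 1) (by norm_num)).differentiableAt (by norm_num)
  have hs : ∀ A B C, fderiv ℝ (fderiv ℝ η) p A B C = fderiv ℝ (fderiv ℝ η) p B A C := fun A B C ↦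
    DFunLike.congr_fun ((hη.isSymmSndFDerivAt (by simp)).eq A B) C
  have hd1 : ∀ B C, DifferentiableAt ℝ (fun q ↦ fderiv ℝ η q B C) p := fun B C ↦
    (hd.clm_apply (differentiableAt_const B)).clm_apply (differentiableAt_const C)
  have key : ∀ A B C, fderiv ℝ α p A B C
      = fderiv ℝ (fderiv ℝ η) p A B C - fderiv ℝ (fderiv ℝ η) p A C B := fun A B C ↦ by
    rw [fderiv_clm_apply_apply hα, fderiv_clm_apply_apply hd, fderiv_clm_apply_apply hd]
    have : (fun q ↦ α q B C) =ᶠ[𝓝 p] fun q ↦ fderiv ℝ η q B C - fderiv ℝ η q C B :=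
      h.mono fun q hq ↦ hq B C
    rw [this.fderiv_eq, fderiv_fun_sub (hd1 _ _) (hd1 _ _)]
    rfl
  rw [localExtDeriv, key, key, key, hs X Z Y, hs X Y Z, hs Y Z X]
  ring

/-- The vertical projection in coordinates. -/
def localVert (Γ : E → E →L[ℝ] E →L[ℝ] E) (p : E × E) : E × E →L[ℝ] E :=
  ContinuousLinearMap.snd ℝ E E + ((Γ p.1).flip p.2).comp (ContinuousLinearMap.fst ℝ E E)

theorem localVert_apply (Γ : E → E →L[ℝ] E →L[ℝ] E) (p X : E × E) :
    localVert Γ p X = X.2 + Γ p.1 X.1 p.2 := rfl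

/-- The form `ω^G` in coordinates. -/
def localOmega (Γ : E → E →L[ℝ] E →L[ℝ] E) (χ : E → ℝ) (g : E → E →L[ℝ] E →L[ℝ] ℝ)
    (p : E × E) : E × E →L[ℝ] E × E →L[ℝ] ℝ :=
  Real.exp (χ p.1) • ((g p.1).bilinearComp (localVert Γ p) (ContinuousLinearMap.fst ℝ E E)
    - (g p.1).bilinearComp (ContinuousLinearMap.fst ℝ E E) (localVert Γ p))

theorem localOmega_apply (Γ : E → E →L[ℝ] E →L[ℝ] E) (χ : E → ℝ) (g : E → E →L[ℝ] E →L[ℝ] ℝ)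
    (p X Y : E × E) : localOmega Γ χ g p X Y = Real.exp (χ p.1) *
      (g p.1 (X.2 + Γ p.1 X.1 p.2) Y.1 - g p.1 X.1 (Y.2 + Γ p.1 Y.1 p.2)) := rfl

variable [FiniteDimensional ℝ E] {Γ : E → E →L[ℝ] E →L[ℝ] E} {χ : E → ℝ}
  {g : E → E →L[ℝ] E →L[ℝ] ℝ} {U : Set E}

theorem contDiffOn_localOmega (hΓ : ContDiffOn ℝ ∞ Γ U) (hχ : ContDiffOn ℝ ∞ χ U)
    (hg : ContDiffOn ℝ ∞ g U) : ContDiffOn ℝ ∞ (localOmega Γ χ g) (U ×ˢ univ) := by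
  rw [contDiffOn_clm_apply]
  intro X
  rw [contDiffOn_clm_apply]
  intro Y
  have hm : MapsTo (Prod.fst : E × E → E) (U ×ˢ univ) U := fun p hp ↦ hp.1
  have hΓ' : ∀ a, ContDiffOn ℝ ∞ (fun p : E × E ↦ Γ p.1 a p.2) (U ×ˢ univ) := fun a ↦
    ((hΓ.comp contDiffOn_fst hm).clm_apply contDiffOn_const).clm_apply contDiffOn_snd
  have hg' := hg.comp contDiffOn_fst hm
  refine ((hχ.comp contDiffOn_fst hm).exp).mul (ContDiffOn.sub ?_ ?_)
  · exact (hg'.clm_apply (contDiffOn_const.add (hΓ' _))).clm_apply contDiffOn_const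
  · exact (hg'.clm_apply contDiffOn_const).clm_apply (contDiffOn_const.add (hΓ' _))

/-- The tensor `T + dχ ∧ 1`. -/
def localDefect (Γ : E → E →L[ℝ] E →L[ℝ] E) (χ : E → ℝ) (z a b : E) : E :=
  Γ z a b - Γ z b a + (fderiv ℝ χ z a • b - fderiv ℝ χ z b • a)

/-- The form has the primitive η = e^χ g(v, dz), the tautological 1-form of the metric rescaled by
e^χ. By metric compatibility dη differs from the form by e^χ g(v, S), where S is `localDefect`. -/
theorem localExtDeriv_localOmega_eq_zero (hU : IsOpen U) (hΓ : ContDiffOn ℝ ∞ Γ U)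
    (hχ : ContDiffOn ℝ ∞ χ U) (hg : ContDiffOn ℝ ∞ g U) (hgs : ∀ z ∈ U, ∀ a b, g z a b = g z b a)
    (hgc : ∀ z ∈ U, ∀ a v w, fderiv ℝ g z a v w = g z (Γ z a v) w + g z v (Γ z a w))
    (hS : ∀ z ∈ U, ∀ a b, localDefect Γ χ z a b = 0) {p : E × E} (hp : p.1 ∈ U) (X Y Z : E × E) :
    localExtDeriv (localOmega Γ χ g) p X Y Z = 0 := by
  have hm : MapsTo (Prod.fst : E × E → E) (U ×ˢ univ) U := fun p hp ↦ hp.1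
  have hVo : IsOpen (U ×ˢ (univ : Set E)) := hU.prod isOpen_univ
  set η : E × E → E × E →L[ℝ] ℝ := fun q ↦ Real.exp (χ q.1) •
    (g q.1 q.2).comp (ContinuousLinearMap.fst ℝ E E) with hη
  have hηs : ContDiffOn ℝ ∞ η (U ×ˢ univ) := by
    rw [contDiffOn_clm_apply]
    intro Y
    exact ((hχ.comp contDiffOn_fst hm).exp).mul
      (((hg.comp contDiffOn_fst hm).clm_apply contDiffOn_snd).clm_apply contDiffOn_const)
  have hpU : p ∈ U ×ˢ (univ : Set E) := ⟨hp, mem_univ _⟩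
  refine localExtDeriv_eq_zero_of_eventuallyEq (η := η)
    ((hηs.contDiffAt (hVo.mem_nhds hpU)).of_le ENat.LEInfty.out)
    (((contDiffOn_localOmega hΓ hχ hg).contDiffAt (hVo.mem_nhds hpU)).differentiableAt (by simp))
    ?_ X Y Z
  filter_upwards [hVo.mem_nhds hpU] with q hq A B
  have key : ∀ A B : E × E, fderiv ℝ η q A B = Real.exp (χ q.1) * (fderiv ℝ χ q.1 A.1 * g q.1 q.2 B.1
      + g q.1 (Γ q.1 A.1 q.2) B.1 + g q.1 q.2 (Γ q.1 A.1 B.1) + g q.1 A.2 B.1) := fun A B ↦ by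
    have hd : DifferentiableAt ℝ η q := (hηs.contDiffAt (hVo.mem_nhds hq)).differentiableAt (by simp)
    have hgd : DifferentiableAt ℝ g q.1 :=
      (hg.contDiffAt (hU.mem_nhds hq.1)).differentiableAt (by simp)
    have hχd : DifferentiableAt ℝ χ q.1 :=
      (hχ.contDiffAt (hU.mem_nhds hq.1)).differentiableAt (by simp)
    have h1 := hd.hasFDerivAt_clm_apply_const B
    have hf := hasFDerivAt_fst (𝕜 := ℝ) (p := q)
    have h2 := (hχd.hasFDerivAt.comp q hf).exp.mul (((hgd.hasFDerivAt.comp q hf).clm_apply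
      (hasFDerivAt_snd (𝕜 := ℝ) (p := q))).clm_apply (hasFDerivAt_const B.1 q))
    have h3 := DFunLike.congr_fun (h1.unique h2) A
    simp only [ContinuousLinearMap.flip_apply] at h3
    rw [h3]
    have h4 := hgc q.1 hq.1 A.1 q.2 B.1
    simp [h4]
    ring
  have hS' := congrArg (g q.1 q.2) (hS q.1 hq.1 A.1 B.1)
  simp only [localDefect, map_add, map_sub, map_smul, smul_eq_mul, map_zero] at hS'
  rw [key, key, localOmega_apply, hgs _ hq.1 A.1]
  simp only [map_add, add_apply]
  linear_combination (-Real.exp (χ q.1)) * hS'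

/-- Up to an exact form, ω is -e^χ g(v, S(dz, dz)) with S = `localDefect`. On one vertical and two
base coordinate vectors its exterior derivative only sees the derivative in v, so it recovers S. -/
theorem localExtDeriv_localOmega_vertical (hU : IsOpen U) (hΓ : ContDiffOn ℝ ∞ Γ U)
    (hχ : ContDiffOn ℝ ∞ χ U) (hg : ContDiffOn ℝ ∞ g U) (hgs : ∀ z ∈ U, ∀ a b, g z a b = g z b a)
    (hgc : ∀ z ∈ U, ∀ a v w, fderiv ℝ g z a v w = g z (Γ z a v) w + g z v (Γ z a w))
    {p : E × E} (hp : p.1 ∈ U) (a b c : E) :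
    localExtDeriv (localOmega Γ χ g) p (0, c) (a, 0) (b, 0)
      = -(Real.exp (χ p.1) * g p.1 c (localDefect Γ χ p.1 a b)) := by
  have hVo : IsOpen (U ×ˢ (univ : Set E)) := hU.prod isOpen_univ
  have hpU : p ∈ U ×ˢ (univ : Set E) := ⟨hp, mem_univ _⟩
  have hd : DifferentiableAt ℝ (localOmega Γ χ g) p :=
    ((contDiffOn_localOmega hΓ hχ hg).contDiffAt (hVo.mem_nhds hpU)).differentiableAt (by simp)
  have hgd : DifferentiableAt ℝ g p.1 :=
    (hg.contDiffAt (hU.mem_nhds hp)).differentiableAt (by simp)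
  have hχd : DifferentiableAt ℝ χ p.1 :=
    (hχ.contDiffAt (hU.mem_nhds hp)).differentiableAt (by simp)
  have hΓd : DifferentiableAt ℝ Γ p.1 :=
    (hΓ.contDiffAt (hU.mem_nhds hp)).differentiableAt (by simp)
  have hf := hasFDerivAt_fst (𝕜 := ℝ) (p := p)
  have hs := hasFDerivAt_snd (𝕜 := ℝ) (p := p)
  have hexp := (hχd.hasFDerivAt.comp p hf).exp
  have hgp : HasFDerivAt (fun q : E × E ↦ g q.1)
      ((fderiv ℝ g p.1).comp (ContinuousLinearMap.fst ℝ E E)) p :=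
    DifferentiableAt.hasFDerivAt_comp_fst (A := g) (p := p) hgd
  have hΓp : ∀ a, HasFDerivAt (fun q : E × E ↦ Γ q.1 a q.2) _ p := fun a ↦
    ((hΓd.hasFDerivAt_clm_apply_const a).comp p hf).clm_apply hs
  have e1 : fderiv ℝ (fun q ↦ localOmega Γ χ g q (a, 0) (b, 0)) p (0, c)
      = Real.exp (χ p.1) * (g p.1 (Γ p.1 a c) b - g p.1 a (Γ p.1 b c)) := by
    have h : HasFDerivAt (fun q : E × E ↦ localOmega Γ χ g q (a, 0) (b, 0)) _ p :=
      hexp.mul (((hgp.clm_apply ((hasFDerivAt_const (0 : E) p).add (hΓp a))).clm_apply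
        (hasFDerivAt_const b p)).sub ((hgp.clm_apply (hasFDerivAt_const a p)).clm_apply
        ((hasFDerivAt_const (0 : E) p).add (hΓp b))))
    rw [h.fderiv]
    simp
  have e2 : ∀ a b : E, fderiv ℝ (fun q ↦ localOmega Γ χ g q (0, c) (b, 0)) p (a, 0)
      = Real.exp (χ p.1) * (fderiv ℝ χ p.1 a * g p.1 c b + fderiv ℝ g p.1 a c b) := fun a b ↦ by
    have h0 : (fun q : E × E ↦ localOmega Γ χ g q (0, c) (b, 0))
        = fun q ↦ Real.exp (χ q.1) * g q.1 c b := by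
      funext q
      simp [localOmega_apply]
    have h : HasFDerivAt (fun q : E × E ↦ Real.exp (χ q.1) * g q.1 c b) _ p :=
      hexp.mul ((hgp.clm_apply (hasFDerivAt_const c p)).clm_apply (hasFDerivAt_const b p))
    rw [h0, h.fderiv]
    simp
    ring
  rw [localExtDeriv, fderiv_clm_apply_apply hd, fderiv_clm_apply_apply hd,
    fderiv_clm_apply_apply hd, e1, e2, e2, hgc _ hp, hgc _ hp, localDefect]
  simp only [map_add, map_sub, map_smul, smul_eq_mul]
  rw [hgs _ hp (Γ p.1 b c) a]
  ring

end

end LocalSymplectic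

/-! ### Vector fields, brackets and forms read in a chart. -/

section ExtendedCharts

variable {E : Type*} [NormedAddCommGroup E] [NormedSpace ℝ E]
  {H : Type*} [TopologicalSpace H] {I : ModelWithCorners ℝ E H}
  {N : Type*} [TopologicalSpace N] [ChartedSpace H N] {x₀ q : N}

theorem eventuallyEq_comp_extChartAt {F : Type*} (f : N → F)
    (hq : q ∈ (extChartAt I x₀).source) :
    f =ᶠ[𝓝 q] (f ∘ (extChartAt I x₀).symm) ∘ extChartAt I x₀ := by
  filter_upwards [(isOpen_extChartAt_source (I := I) x₀).mem_nhds hq] with y hy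
  exact (congrArg f ((extChartAt I x₀).left_inv hy)).symm

theorem eventually_symm_of_eventually (hq : q ∈ (extChartAt I x₀).source) {P : N → Prop}
    (h : ∀ᶠ y in 𝓝 q, P y) :
    ∀ᶠ z in 𝓝 (extChartAt I x₀ q), P ((extChartAt I x₀).symm z) := by
  have hc : ContinuousAt (extChartAt I x₀).symm (extChartAt I x₀ q) := continuousAt_extChartAt_symm' hq
  rw [ContinuousAt, (extChartAt I x₀).left_inv hq] at hc
  exact hc.eventually h

end ExtendedCharts

noncomputable section ChartRepresentatives

set_option synthInstance.maxHeartbeats 200000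

variable {E : Type*} [NormedAddCommGroup E] [NormedSpace ℝ E]
  {H : Type*} [TopologicalSpace H] (I : ModelWithCorners ℝ E H)
  {N : Type*} [TopologicalSpace N] [ChartedSpace H N] [IsManifold I ∞ N]

/-- The differential at `q` of the chart around `x₀`. -/
def chartDiff (x₀ q : N) : TangentSpace I q →L[ℝ] E :=
  (trivializationAt E (TangentSpace I) x₀).continuousLinearMapAt ℝ q

/-- The expression of a vector field in the chart around `x₀`. -/
def fieldRep (x₀ : N) (X : ∀ p : N, TangentSpace I p) (z : E) : E :=
  chartDiff I x₀ ((extChartAt I x₀).symm z) (X ((extChartAt I x₀).symm z))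

variable {I} {x₀ q : N}

theorem mem_baseSet_of_mem_source (hq : q ∈ (extChartAt I x₀).source) :
    q ∈ (trivializationAt E (TangentSpace I : N → Type _) x₀).baseSet := by
  rwa [TangentBundle.trivializationAt_baseSet, ← extChartAt_source I]

theorem chartDiff_eq_mfderiv (hq : q ∈ (extChartAt I x₀).source) :
    chartDiff I x₀ q = mfderiv I 𝓘(ℝ, E) (extChartAt I x₀) q :=
  TangentBundle.continuousLinearMapAt_trivializationAt (by rwa [← extChartAt_source I])

theorem chartDiff_apply (hq : q ∈ (extChartAt I x₀).source) (X : TangentSpace I q) :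
    chartDiff I x₀ q X = (trivializationAt E (TangentSpace I) x₀ ⟨q, X⟩).2 := by
  rw [chartDiff, Trivialization.continuousLinearMapAt_apply,
    Trivialization.linearMapAt_apply, if_pos (mem_baseSet_of_mem_source hq)]

theorem chartDiff_symm (hq : q ∈ (extChartAt I x₀).source) (a : E) :
    chartDiff I x₀ q ((trivializationAt E (TangentSpace I) x₀).symmL ℝ q a) = a :=
  (trivializationAt E (TangentSpace I) x₀).continuousLinearMapAt_symmL
    (mem_baseSet_of_mem_source hq) a

theorem symm_chartDiff (hq : q ∈ (extChartAt I x₀).source) (X : TangentSpace I q) :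
    (trivializationAt E (TangentSpace I) x₀).symmL ℝ q (chartDiff I x₀ q X) = X :=
  (trivializationAt E (TangentSpace I) x₀).symmL_continuousLinearMapAt
    (mem_baseSet_of_mem_source hq) X

theorem chartDiff_injective (hq : q ∈ (extChartAt I x₀).source) :
    Function.Injective (chartDiff I x₀ q) :=
  (Function.LeftInverse.injective (g := (trivializationAt E (TangentSpace I) x₀).symmL ℝ q)
    (symm_chartDiff hq))

theorem mvfderiv_eq_fderiv_chartDiff {F : Type*} [NormedAddCommGroup F] [NormedSpace ℝ F]
    {f : N → F} {f' : E → F} (hq : q ∈ (extChartAt I x₀).source)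
    (hf : DifferentiableAt ℝ f' (extChartAt I x₀ q)) (h : f =ᶠ[𝓝 q] f' ∘ extChartAt I x₀)
    (X : TangentSpace I q) :
    mvfderiv I f q X = fderiv ℝ f' (extChartAt I x₀ q) (chartDiff I x₀ q X) := by
  rw [chartDiff_eq_mfderiv hq]
  have h1 : mfderiv I 𝓘(ℝ, F) f q = mfderiv I 𝓘(ℝ, F) (f' ∘ extChartAt I x₀) q := h.mfderiv_eq
  have h2 := mfderiv_comp_apply q (I' := 𝓘(ℝ, E)) (I'' := 𝓘(ℝ, F))
    (hf.mdifferentiableAt) (mdifferentiableAt_extChartAt (by rwa [← extChartAt_source I])) X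
  rw [mfderiv_eq_fderiv] at h2
  change mfderiv I 𝓘(ℝ, F) f q X = _
  rw [h1]
  exact h2

theorem ContMDiff.contDiffOn_comp_extChartAt_symm {F : Type*}
    [NormedAddCommGroup F] [NormedSpace ℝ F] {f : N → F} (hf : ContMDiff I 𝓘(ℝ, F) ∞ f) :
    ContDiffOn ℝ ∞ (f ∘ (extChartAt I x₀).symm) (extChartAt I x₀).target := by
  rw [← contMDiffOn_iff_contDiffOn]
  exact hf.comp_contMDiffOn (contMDiffOn_extChartAt_symm x₀)

theorem contDiffOn_fieldRep {X : ∀ p : N, TangentSpace I p}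
    (hX : IsSmoothVF X) : ContDiffOn ℝ ∞ (fieldRep I x₀ X) (extChartAt I x₀).target := by
  have : IsManifold I (∞ + 1) N := inferInstanceAs (IsManifold I ∞ N)
  have : ContMDiffVectorBundle ∞ E (TangentSpace I : N → Type _) I :=
    TangentBundle.contMDiffVectorBundle
  rw [← contMDiffOn_iff_contDiffOn]
  intro z hz
  have hq := (extChartAt I x₀).map_target hz
  have h1 := ((trivializationAt E (TangentSpace I) x₀).contMDiffAt_section_iff
    (mem_baseSet_of_mem_source hq)).1 (hX ((extChartAt I x₀).symm z))
  have h2 := h1.comp_contMDiffWithinAt z (contMDiffOn_extChartAt_symm (n := ∞) x₀ z hz)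
  refine h2.congr (fun y hy ↦ ?_) ?_
  · exact chartDiff_apply ((extChartAt I x₀).map_target hy) _
  · exact chartDiff_apply hq _

theorem chartDiff_eq_fieldRep (hq : q ∈ (extChartAt I x₀).source) (X : ∀ p : N, TangentSpace I p) :
    chartDiff I x₀ q (X q) = fieldRep I x₀ X (extChartAt I x₀ q) := by
  rw [fieldRep, (extChartAt I x₀).left_inv hq]

variable [I.Boundaryless]

theorem differentiableAt_fieldRep {X : ∀ p : N, TangentSpace I p}
    (hq : q ∈ (extChartAt I x₀).source)
    (hX : MDifferentiableAt I I.tangent (fun p ↦ (⟨p, X p⟩ : TangentBundle I N)) q) :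
    DifferentiableAt ℝ (fieldRep I x₀ X) (extChartAt I x₀ q) := by
  have : IsManifold I (1 + 1) N :=
    IsManifold.of_le (n := ∞) (by rw [one_add_one_eq_two]; exact ENat.LEInfty.out)
  have : ContMDiffVectorBundle 1 E (TangentSpace I : N → Type _) I :=
    TangentBundle.contMDiffVectorBundle
  have h1 := ((trivializationAt E (TangentSpace I) x₀).mdifferentiableAt_section_iff I X
    (mem_baseSet_of_mem_source hq)).1 hX
  have hz := (extChartAt I x₀).map_source hq
  have hs : MDifferentiableAt 𝓘(ℝ, E) I (extChartAt I x₀).symm (extChartAt I x₀ q) :=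
    ((contMDiffOn_extChartAt_symm (n := 1) x₀ _ hz).contMDiffAt
      ((isOpen_extChartAt_target x₀).mem_nhds hz)).mdifferentiableAt (by simp)
  rw [← mdifferentiableAt_iff_differentiableAt]
  rw [← (extChartAt I x₀).left_inv hq] at h1
  refine (h1.comp _ hs).congr_of_eventuallyEq ?_
  filter_upwards [(isOpen_extChartAt_target x₀).mem_nhds hz] with y hy
  exact chartDiff_apply ((extChartAt I x₀).map_target hy) _

variable [CompleteSpace E]

/-- The bracket commutes with pullback along the inverse chart, and that pullback of a field is its
`fieldRep`. -/
theorem chartDiff_mlieBracket {X Y : ∀ p : N, TangentSpace I p}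
    (hq : q ∈ (extChartAt I x₀).source)
    (hX : MDifferentiableAt I I.tangent (fun p ↦ (⟨p, X p⟩ : TangentBundle I N)) q)
    (hY : MDifferentiableAt I I.tangent (fun p ↦ (⟨p, Y p⟩ : TangentBundle I N)) q) :
    chartDiff I x₀ q (VectorField.mlieBracket I X Y q)
      = VectorField.lieBracket ℝ (fieldRep I x₀ X) (fieldRep I x₀ Y) (extChartAt I x₀ q) := by
  have : IsManifold I 2 N := IsManifold.of_le (n := ∞) ENat.LEInfty.out
  have : IsManifold I (minSmoothness ℝ 2) N := by
    rwa [minSmoothness_of_isRCLikeNormedField]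
  have hz := (extChartAt I x₀).map_source hq
  have hinv : ∀ z ∈ (extChartAt I x₀).target, ∀ X : ∀ p : N, TangentSpace I p,
      VectorField.mpullback 𝓘(ℝ, E) I (extChartAt I x₀).symm X z = fieldRep I x₀ X z := by
    intro z hz X
    have h1 := mfderiv_extChartAt_comp_mfderivWithin_extChartAt_symm (I := I) hz
    have h2 := mfderivWithin_extChartAt_symm_comp_mfderiv_extChartAt (I := I) hz
    rw [I.range_eq_univ, mfderivWithin_univ] at h1 h2
    have h3 := ContinuousLinearMap.inverse_eq h2 h1
    have h4 := chartDiff_eq_mfderiv ((extChartAt I x₀).map_target hz)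
    rw [VectorField.mpullback_apply, h3, fieldRep, h4]
    rfl
  have hs : ContMDiffAt 𝓘(ℝ, E) I 2 (extChartAt I x₀).symm (extChartAt I x₀ q) :=
    (contMDiffOn_extChartAt_symm (n := 2) x₀ _ hz).contMDiffAt
      ((isOpen_extChartAt_target x₀).mem_nhds hz)
  have h := VectorField.mpullback_mlieBracket (I := 𝓘(ℝ, E)) (I' := I) (n := 2)
    (f := (extChartAt I x₀).symm) (V := X) (W := Y) (x₀ := extChartAt I x₀ q)
    (by rwa [(extChartAt I x₀).left_inv hq]) (by rwa [(extChartAt I x₀).left_inv hq]) hs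
    (by simp)
  rw [hinv _ hz, ← chartDiff_eq_fieldRep hq] at h
  have hlb : ∀ V W : E → E, VectorField.mlieBracket 𝓘(ℝ, E) V W = VectorField.lieBracket ℝ V W := by
    intro V W
    have := VectorField.mlieBracketWithin_eq_lieBracketWithin (V := V) (W := W) (s := univ)
      (𝕜 := ℝ)
    have h2 := VectorField.lieBracketWithin_univ (V := V) (W := W) (𝕜 := ℝ)
    have h3 := VectorField.mlieBracketWithin_univ (I := 𝓘(ℝ, E)) (V := V) (W := W)
    exact h3.symm.trans (this.trans h2)
  refine h.trans ((congrFun (hlb _ _) _).trans ?_)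
  refine Filter.EventuallyEq.lieBracket_vectorField_eq (𝕜 := ℝ) (E := E) ?_ ?_
  all_goals
    filter_upwards [(isOpen_extChartAt_target x₀).mem_nhds hz] with y hy
    exact hinv y hy _

end ChartRepresentatives

/-! ### Coordinate fields and the exterior derivative in a chart. -/

noncomputable section CoordinateFields

set_option synthInstance.maxHeartbeats 200000

variable {E : Type*} [NormedAddCommGroup E] [NormedSpace ℝ E]
  {H : Type*} [TopologicalSpace H] (I : ModelWithCorners ℝ E H)
  {N : Type*} [TopologicalSpace N] [ChartedSpace H N] [IsManifold I ∞ N]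

/-- The vector field on the chart domain around `x₀` with constant coordinates `a`. -/
def constField (x₀ : N) (a : E) (p : N) : TangentSpace I p :=
  (trivializationAt E (TangentSpace I) x₀).symmL ℝ p a

variable {I} {x₀ q : N}

theorem chartDiff_constField (hq : q ∈ (extChartAt I x₀).source) (a : E) :
    chartDiff I x₀ q (constField I x₀ a q) = a :=
  chartDiff_symm hq a

theorem constField_chartDiff (hq : q ∈ (extChartAt I x₀).source) (X : TangentSpace I q) :
    constField I x₀ (chartDiff I x₀ q X) q = X :=
  symm_chartDiff hq X

theorem fieldRep_constField {z : E} (hz : z ∈ (extChartAt I x₀).target) (a : E) :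
    fieldRep I x₀ (constField I x₀ a) z = a :=
  chartDiff_symm ((extChartAt I x₀).map_target hz) a

theorem contMDiffOn_constField (a : E) :
    ContMDiffOn I I.tangent ∞ (fun p ↦ (⟨p, constField I x₀ a p⟩ : TangentBundle I N))
      (extChartAt I x₀).source := by
  have : IsManifold I (∞ + 1) N := inferInstanceAs (IsManifold I ∞ N)
  have : ContMDiffVectorBundle ∞ E (TangentSpace I : N → Type _) I :=
    TangentBundle.contMDiffVectorBundle
  refine ((trivializationAt E (TangentSpace I) x₀).contMDiffOn_section_iff
    (isOpen_extChartAt_source x₀) (fun y hy ↦ mem_baseSet_of_mem_source hy)).2 ?_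
  refine (contMDiffOn_const (c := a)).congr fun y hy ↦ ?_
  rw [← chartDiff_apply hy, chartDiff_constField hy]

theorem mdifferentiableAt_constField (hq : q ∈ (extChartAt I x₀).source) (a : E) :
    MDifferentiableAt I I.tangent (fun p ↦ (⟨p, constField I x₀ a p⟩ : TangentBundle I N)) q :=
  ((contMDiffOn_constField a).contMDiffAt
    ((isOpen_extChartAt_source x₀).mem_nhds hq)).mdifferentiableAt (by simp)

/-- Around every point of a chart domain there are globally defined smooth vector fields whose
coordinates are constant, provided there are smooth functions with support in the chart domain
that equal `1` around that point. -/
theorem exists_isSmoothVF_eq_constField {f : N → ℝ} (hf : ContMDiff I 𝓘(ℝ) ∞ f)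
    (hs : tsupport f ⊆ (extChartAt I x₀).source) (h1 : f =ᶠ[𝓝 q] 1) (a : E) :
    ∃ X : ∀ p : N, TangentSpace I p, IsSmoothVF X ∧ ∀ᶠ y in 𝓝 q, X y = constField I x₀ a y := by
  refine ⟨f • constField I x₀ a, ?_, ?_⟩
  · exact ContMDiffOn.smul_section_of_tsupport hf.contMDiffOn (isOpen_extChartAt_source x₀) hs
      (contMDiffOn_constField a)
  · filter_upwards [h1] with y hy
    simp [hy]

variable [I.Boundaryless]

theorem eventuallyEq_fieldRep_const (hq : q ∈ (extChartAt I x₀).source) {a : E}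
    {X : ∀ p : N, TangentSpace I p} (hX : ∀ᶠ y in 𝓝 q, X y = constField I x₀ a y) :
    fieldRep I x₀ X =ᶠ[𝓝 (extChartAt I x₀ q)] fun _ ↦ a := by
  filter_upwards [eventually_symm_of_eventually hq hX,
    (isOpen_extChartAt_target x₀).mem_nhds ((extChartAt I x₀).map_source hq)] with z hz hz'
  rw [← fieldRep_constField hz' a, fieldRep, fieldRep, hz]

variable [CompleteSpace E]

/-- For fields with variable components the product rule produces derivatives of the components; by
antisymmetry these cancel against the bracket terms, and only the derivative of the form survives.
-/
theorem extDerivTwoForm_eq_localExtDeriv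
    {α : ∀ p : N, TangentSpace I p →ₗ[ℝ] TangentSpace I p →ₗ[ℝ] ℝ} {β : E → E →L[ℝ] E →L[ℝ] ℝ}
    (hq : q ∈ (extChartAt I x₀).source) (hβ : DifferentiableAt ℝ β (extChartAt I x₀ q))
    (hαβ : ∀ᶠ y in 𝓝 q, ∀ X Y, α y X Y
      = β (extChartAt I x₀ y) (chartDiff I x₀ y X) (chartDiff I x₀ y Y))
    (hanti : ∀ a b, β (extChartAt I x₀ q) a b = -β (extChartAt I x₀ q) b a)
    {X Y Z : ∀ p : N, TangentSpace I p}
    (hX : MDifferentiableAt I I.tangent (fun p ↦ (⟨p, X p⟩ : TangentBundle I N)) q)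
    (hY : MDifferentiableAt I I.tangent (fun p ↦ (⟨p, Y p⟩ : TangentBundle I N)) q)
    (hZ : MDifferentiableAt I I.tangent (fun p ↦ (⟨p, Z p⟩ : TangentBundle I N)) q) :
    extDerivTwoForm I α X Y Z q = localExtDeriv β (extChartAt I x₀ q)
      (chartDiff I x₀ q (X q)) (chartDiff I x₀ q (Y q)) (chartDiff I x₀ q (Z q)) := by
  have key : ∀ V W U : ∀ p : N, TangentSpace I p,
      MDifferentiableAt I I.tangent (fun p ↦ (⟨p, V p⟩ : TangentBundle I N)) q →
      MDifferentiableAt I I.tangent (fun p ↦ (⟨p, W p⟩ : TangentBundle I N)) q →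
      mvfderiv I (fun y ↦ α y (V y) (W y)) q (U q)
        = fderiv ℝ β (extChartAt I x₀ q) (chartDiff I x₀ q (U q)) (chartDiff I x₀ q (V q))
            (chartDiff I x₀ q (W q))
          + β (extChartAt I x₀ q) (fderiv ℝ (fieldRep I x₀ V) (extChartAt I x₀ q)
            (chartDiff I x₀ q (U q))) (chartDiff I x₀ q (W q))
          + β (extChartAt I x₀ q) (chartDiff I x₀ q (V q)) (fderiv ℝ (fieldRep I x₀ W)
            (extChartAt I x₀ q) (chartDiff I x₀ q (U q))) := by
    intro V W U hV hW
    have hV' := (differentiableAt_fieldRep (x₀ := x₀) hq hV).hasFDerivAt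
    have hW' := (differentiableAt_fieldRep (x₀ := x₀) hq hW).hasFDerivAt
    have hd := (hβ.hasFDerivAt.clm_apply hV').clm_apply hW'
    rw [mvfderiv_eq_fderiv_chartDiff hq hd.differentiableAt, hd.fderiv]
    · simp only [chartDiff_eq_fieldRep hq, add_apply, ContinuousLinearMap.comp_apply,
        ContinuousLinearMap.flip_apply]
      ring
    · filter_upwards [hαβ, (isOpen_extChartAt_source (I := I) x₀).mem_nhds hq] with y hy hy'
      rw [hy, chartDiff_eq_fieldRep hy', chartDiff_eq_fieldRep hy']
      rfl
  have hα := fun V W ↦ hαβ.self_of_nhds V W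
  rw [extDerivTwoForm, key Y Z X hY hZ, key X Z Y hX hZ, key X Y Z hX hY, hα, hα, hα,
    chartDiff_mlieBracket hq hX hY, chartDiff_mlieBracket hq hX hZ, chartDiff_mlieBracket hq hY hZ,
    localExtDeriv]
  simp only [VectorField.lieBracket, ← chartDiff_eq_fieldRep hq, map_sub, sub_apply]
  rw [hanti (chartDiff I x₀ q (Y q)) (fderiv ℝ (fieldRep I x₀ Z) _ _),
    hanti (chartDiff I x₀ q (X q)) (fderiv ℝ (fieldRep I x₀ Z) _ _),
    hanti (chartDiff I x₀ q (X q)) (fderiv ℝ (fieldRep I x₀ Y) _ _)]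
  ring

end CoordinateFields

/-- Second derivatives of Z cancel by symmetry, derivatives of X and Y cancel against the bracket,
and the terms with one derivative of Z cancel between the two orders. The rest is tensorial. -/
theorem curvature_eq_localCurvature {E : Type*} [NormedAddCommGroup E] [NormedSpace ℝ E]
    {Γ : E → E →L[ℝ] E →L[ℝ] E} {z : E} (hΓ : DifferentiableAt ℝ Γ z)
    {X Y Z : E → E} (hX : DifferentiableAt ℝ X z) (hY : DifferentiableAt ℝ Y z)
    (hZ : ContDiffAt ℝ 2 Z z) :
    (fderiv ℝ (fun w ↦ fderiv ℝ Z w (Y w) + Γ w (Y w) (Z w)) z (X z)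
        + Γ z (X z) (fderiv ℝ Z z (Y z) + Γ z (Y z) (Z z)))
      - (fderiv ℝ (fun w ↦ fderiv ℝ Z w (X w) + Γ w (X w) (Z w)) z (Y z)
        + Γ z (Y z) (fderiv ℝ Z z (X z) + Γ z (X z) (Z z)))
      - (fderiv ℝ Z z (VectorField.lieBracket ℝ X Y z)
        + Γ z (VectorField.lieBracket ℝ X Y z) (Z z))
      = localCurvature Γ z (X z) (Y z) (Z z) := by
  have hZd : DifferentiableAt ℝ (fderiv ℝ Z) z :=
    (hZ.fderiv_right (m := 1) (by norm_num)).differentiableAt (by norm_num)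
  have hZ1 := hZ.differentiableAt (by norm_num)
  have key : ∀ V : E → E, DifferentiableAt ℝ V z → ∀ u,
      fderiv ℝ (fun w ↦ fderiv ℝ Z w (V w) + Γ w (V w) (Z w)) z u
        = fderiv ℝ (fderiv ℝ Z) z u (V z) + fderiv ℝ Z z (fderiv ℝ V z u)
          + (fderiv ℝ Γ z u (V z) (Z z) + Γ z (fderiv ℝ V z u) (Z z)
            + Γ z (V z) (fderiv ℝ Z z u)) := by
    intro V hV u
    have h1 := hZd.hasFDerivAt.clm_apply hV.hasFDerivAt
    have h2 := (hΓ.hasFDerivAt.clm_apply hV.hasFDerivAt).clm_apply hZ1.hasFDerivAt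
    have h3 : HasFDerivAt (fun w ↦ fderiv ℝ Z w (V w) + Γ w (V w) (Z w)) _ z := h1.add h2
    rw [h3.fderiv]
    simp only [add_apply, ContinuousLinearMap.comp_apply, ContinuousLinearMap.flip_apply]
    abel
  have hs : fderiv ℝ (fderiv ℝ Z) z (X z) (Y z) = fderiv ℝ (fderiv ℝ Z) z (Y z) (X z) :=
    (hZ.isSymmSndFDerivAt (by simp)).eq _ _
  rw [key Y hY, key X hX, hs, VectorField.lieBracket, localCurvature]
  simp only [map_add, map_sub, sub_apply]
  abel

/-! ### Christoffel symbols, torsion and curvature in a chart. -/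

noncomputable section ConnectionForm

set_option synthInstance.maxHeartbeats 200000

variable {E : Type*} [NormedAddCommGroup E] [NormedSpace ℝ E]
  {H : Type*} [TopologicalSpace H] (I : ModelWithCorners ℝ E H)
  {N : Type*} [TopologicalSpace N] [ChartedSpace H N] [IsManifold I ∞ N]

/-- The flat connection on a chart domain whose parallel fields are those with constant
coordinates. -/
def chartConnection (x₀ : N) (σ : ∀ p : N, TangentSpace I p) (p : N) :
    TangentSpace I p →L[ℝ] TangentSpace I p :=
  ((trivializationAt E (TangentSpace I) x₀).symmL ℝ p).comp
    (mvfderiv I (fun y ↦ chartDiff I x₀ y (σ y)) p)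

variable {I} {x₀ q : N}

theorem mdifferentiableAt_chartDiff (hq : q ∈ (extChartAt I x₀).source)
    {σ : ∀ p : N, TangentSpace I p}
    (hσ : MDifferentiableAt I I.tangent (fun p ↦ (⟨p, σ p⟩ : TangentBundle I N)) q) :
    MDifferentiableAt I 𝓘(ℝ, E) (fun y ↦ chartDiff I x₀ y (σ y)) q := by
  have : IsManifold I (1 + 1) N :=
    IsManifold.of_le (n := ∞) (by rw [one_add_one_eq_two]; exact ENat.LEInfty.out)
  have : ContMDiffVectorBundle 1 E (TangentSpace I : N → Type _) I :=
    TangentBundle.contMDiffVectorBundle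
  refine (((trivializationAt E (TangentSpace I) x₀).mdifferentiableAt_section_iff I σ
    (mem_baseSet_of_mem_source hq)).1 hσ).congr_of_eventuallyEq ?_
  filter_upwards [(isOpen_extChartAt_source (I := I) x₀).mem_nhds hq] with y hy
  exact chartDiff_apply hy _

theorem chartDiff_chartConnection (hq : q ∈ (extChartAt I x₀).source)
    (σ : ∀ p : N, TangentSpace I p) (X : TangentSpace I q) :
    chartDiff I x₀ q (chartConnection I x₀ σ q X)
      = mvfderiv I (fun y ↦ chartDiff I x₀ y (σ y)) q X :=
  chartDiff_symm hq _

/-- This is what makes the difference of ∇ and the coordinate derivative a tensor, from which the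
Christoffel symbols are read off. -/
theorem isCovariantDerivativeOn_chartConnection (x₀ : N) :
    IsCovariantDerivativeOn E (chartConnection I x₀) (extChartAt I x₀).source where
  add {σ σ' x} hσ hσ' hx := by
    ext X
    refine chartDiff_injective hx ?_
    have h := mvfderiv_fun_add (mdifferentiableAt_chartDiff hx hσ)
      (mdifferentiableAt_chartDiff hx hσ')
    have h2 : (fun y ↦ chartDiff I x₀ y ((σ + σ') y))
        = fun y ↦ chartDiff I x₀ y (σ y) + chartDiff I x₀ y (σ' y) :=
      funext fun y ↦ map_add _ _ _
    rw [add_apply, map_add, chartDiff_chartConnection hx, chartDiff_chartConnection hx,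
      chartDiff_chartConnection hx, h2, h, add_apply]
  leibniz {σ g x} hσ hg hx := by
    ext X
    refine chartDiff_injective hx ?_
    have h := mvfderiv_fun_smul hg (mdifferentiableAt_chartDiff hx hσ)
    have h2 : (fun y ↦ chartDiff I x₀ y ((g • σ) y))
        = fun y ↦ g y • chartDiff I x₀ y (σ y) :=
      funext fun y ↦ map_smul _ _ _
    rw [add_apply, map_add, smul_apply, map_smul, chartDiff_chartConnection hx,
      chartDiff_chartConnection hx, h2, h, ContinuousLinearMap.smulRight_apply, map_smul]
    rfl

variable (cov : CovariantDerivative I E (TangentSpace I : N → Type _))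

theorem isSmoothVF_cov (hcov : cov.ContMDiffCovariantDerivative ∞)
    {σ X : ∀ p : N, TangentSpace I p} (hσ : IsSmoothVF σ) (hX : IsSmoothVF X) :
    IsSmoothVF (fun p ↦ cov σ p (X p)) := by
  have : IsManifold I (∞ + 1) N := inferInstanceAs (IsManifold I ∞ N)
  have : ContMDiffVectorBundle ∞ E (TangentSpace I : N → Type _) I :=
    TangentBundle.contMDiffVectorBundle
  have h := contMDiffOn_univ.1 (hcov.contMDiff.contMDiff (σ := σ) (contMDiffOn_univ.2 hσ))
  exact h.clm_bundle_apply (b := id) hX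

theorem cov_congr_of_eventuallyEq {σ τ : ∀ p : N, TangentSpace I p}
    (hσ : MDifferentiableAt I I.tangent (fun p ↦ (⟨p, σ p⟩ : TangentBundle I N)) q)
    (hτ : MDifferentiableAt I I.tangent (fun p ↦ (⟨p, τ p⟩ : TangentBundle I N)) q)
    (h : ∀ᶠ y in 𝓝 q, σ y = τ y) : cov σ q = cov τ q :=
  cov.isCovariantDerivativeOnUniv.congr_of_eventuallyEq hσ hτ univ_mem h

variable [FiniteDimensional ℝ E]

theorem exists_contMDiff_eventuallyEq_one [T2Space N] (hq : q ∈ (extChartAt I x₀).source) :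
    ∃ f : N → ℝ, ContMDiff I 𝓘(ℝ) ∞ f ∧ tsupport f ⊆ (extChartAt I x₀).source ∧ f =ᶠ[𝓝 q] 1 := by
  obtain ⟨f, -, hf⟩ := (SmoothBumpFunction.nhds_basis_tsupport (I := I) q).mem_iff.1
    ((isOpen_extChartAt_source (I := I) x₀).mem_nhds hq)
  exact ⟨f, f.contMDiff, hf, f.eventuallyEq_one⟩

theorem exists_isSmoothVF_eq_constField_of_t2 [T2Space N] (hq : q ∈ (extChartAt I x₀).source)
    (a : E) : ∃ X : ∀ p : N, TangentSpace I p, IsSmoothVF X ∧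
      ∀ᶠ y in 𝓝 q, X y = constField I x₀ a y := by
  obtain ⟨f, hf, hs, h1⟩ := exists_contMDiff_eventuallyEq_one hq
  exact exists_isSmoothVF_eq_constField hf hs h1 a

/-- The difference of a connection and the flat connection of a chart. -/
def chartDifference (x₀ q : N) :
    TangentSpace I q →L[ℝ] TangentSpace I q →L[ℝ] TangentSpace I q :=
  have : IsManifold I (1 + 1) N :=
    IsManifold.of_le (n := ∞) (by rw [one_add_one_eq_two]; exact ENat.LEInfty.out)
  have : ContMDiffVectorBundle 1 E (TangentSpace I : N → Type _) I :=
    TangentBundle.contMDiffVectorBundle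
  IsCovariantDerivativeOn.difference (cov.isCovariantDerivativeOn (s := (extChartAt I x₀).source))
    (isCovariantDerivativeOn_chartConnection x₀) q

theorem chartDifference_apply (hq : q ∈ (extChartAt I x₀).source) {σ : ∀ p : N, TangentSpace I p}
    (hσ : MDifferentiableAt I I.tangent (fun p ↦ (⟨p, σ p⟩ : TangentBundle I N)) q) :
    chartDifference cov x₀ q (σ q) = cov σ q - chartConnection I x₀ σ q :=
  have : IsManifold I (1 + 1) N :=
    IsManifold.of_le (n := ∞) (by rw [one_add_one_eq_two]; exact ENat.LEInfty.out)
  have : ContMDiffVectorBundle 1 E (TangentSpace I : N → Type _) I :=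
    TangentBundle.contMDiffVectorBundle
  IsCovariantDerivativeOn.difference_apply
    (cov.isCovariantDerivativeOn (s := (extChartAt I x₀).source))
    (isCovariantDerivativeOn_chartConnection x₀) hq hσ

/-- The connection form (the Christoffel symbols) in the chart around `x₀`. -/
def connForm (x₀ : N) (z : E) : E →L[ℝ] E →L[ℝ] E :=
  let y := (extChartAt I x₀).symm z
  let D : E →L[ℝ] E →L[ℝ] E := chartDifference cov x₀ y
  let d : E →L[ℝ] E := chartDiff I x₀ y
  let s : E →L[ℝ] E := (trivializationAt E (TangentSpace I) x₀).symmL ℝ y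
  (ContinuousLinearMap.compL ℝ E E E d).comp (D.bilinearComp s s).flip

/-- The direction of differentiation is the first argument of `connForm` and the differentiated
field the second, the reverse of `chartDifference`. -/
theorem connForm_apply (z a b : E) :
    connForm cov x₀ z a b = chartDiff I x₀ ((extChartAt I x₀).symm z)
      (chartDifference cov x₀ ((extChartAt I x₀).symm z)
        (constField I x₀ b ((extChartAt I x₀).symm z))
        (constField I x₀ a ((extChartAt I x₀).symm z))) := rfl

theorem connForm_chartDiff (hq : q ∈ (extChartAt I x₀).source) (X Y : TangentSpace I q) :
    connForm cov x₀ (extChartAt I x₀ q) (chartDiff I x₀ q X) (chartDiff I x₀ q Y)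
      = chartDiff I x₀ q (chartDifference cov x₀ q Y X) := by
  rw [connForm_apply, (extChartAt I x₀).left_inv hq, constField_chartDiff hq,
    constField_chartDiff hq]

/-- A connection in coordinates. -/
theorem chartDiff_cov_apply (hq : q ∈ (extChartAt I x₀).source) {σ : ∀ p : N, TangentSpace I p}
    (hσ : MDifferentiableAt I I.tangent (fun p ↦ (⟨p, σ p⟩ : TangentBundle I N)) q)
    (X : TangentSpace I q) :
    chartDiff I x₀ q (cov σ q X) = mvfderiv I (fun y ↦ chartDiff I x₀ y (σ y)) q X
      + connForm cov x₀ (extChartAt I x₀ q) (chartDiff I x₀ q X) (chartDiff I x₀ q (σ q)) := by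
  rw [connForm_chartDiff cov hq, chartDifference_apply cov hq hσ, sub_apply, map_sub,
    chartDiff_chartConnection hq]
  abel

variable [I.Boundaryless]

theorem chartDiff_cov_apply_eq_fderiv (hq : q ∈ (extChartAt I x₀).source)
    {σ : ∀ p : N, TangentSpace I p}
    (hσ : MDifferentiableAt I I.tangent (fun p ↦ (⟨p, σ p⟩ : TangentBundle I N)) q)
    (X : TangentSpace I q) :
    chartDiff I x₀ q (cov σ q X)
      = fderiv ℝ (fieldRep I x₀ σ) (extChartAt I x₀ q) (chartDiff I x₀ q X)
      + connForm cov x₀ (extChartAt I x₀ q) (chartDiff I x₀ q X) (chartDiff I x₀ q (σ q)) := by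
  rw [chartDiff_cov_apply cov hq hσ,
    mvfderiv_eq_fderiv_chartDiff hq (differentiableAt_fieldRep hq hσ)]
  filter_upwards [(isOpen_extChartAt_source (I := I) x₀).mem_nhds hq] with y hy
  exact chartDiff_eq_fieldRep hy σ

theorem chartDiff_cov_constField (hq : q ∈ (extChartAt I x₀).source) (a : E)
    (X : TangentSpace I q) :
    chartDiff I x₀ q (cov (constField I x₀ a) q X)
      = connForm cov x₀ (extChartAt I x₀ q) (chartDiff I x₀ q X) a := by
  rw [chartDiff_cov_apply_eq_fderiv cov hq (mdifferentiableAt_constField hq a),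
    (eventuallyEq_fieldRep_const hq (Eventually.of_forall fun y ↦ rfl)).fderiv_eq]
  simp [chartDiff_constField hq]

/-- The smoothness of ∇ is used on global smooth fields, so the coordinate fields are first cut off
by bump functions, which exist since the manifold is Hausdorff. Near the point, Γ(a)b is then the
coordinate expression of ∇_X Y. -/
theorem contDiffOn_connForm [T2Space N] (hcov : cov.ContMDiffCovariantDerivative ∞) :
    ContDiffOn ℝ ∞ (connForm cov x₀) (extChartAt I x₀).target := by
  rw [contDiffOn_clm_apply]
  intro a
  rw [contDiffOn_clm_apply]
  intro b z hz
  have hq := (extChartAt I x₀).map_target hz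
  obtain ⟨X, hX, hXa⟩ := exists_isSmoothVF_eq_constField_of_t2 hq a
  obtain ⟨Y, hY, hYb⟩ := exists_isSmoothVF_eq_constField_of_t2 hq b
  have ho := (isOpen_extChartAt_target (I := I) x₀).mem_nhds hz
  have h := (contDiffOn_fieldRep (x₀ := x₀) (isSmoothVF_cov cov hcov hY hX)).contDiffAt ho
  refine (h.congr_of_eventuallyEq ?_).contDiffWithinAt
  have hev := eventually_symm_of_eventually hq (hXa.and (eventually_eventually_nhds.2 hYb))
  rw [(extChartAt I x₀).right_inv hz] at hev
  filter_upwards [hev, ho] with w hw hw'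
  have hp := (extChartAt I x₀).map_target hw'
  have h2 := chartDiff_cov_constField cov hp b (X ((extChartAt I x₀).symm w))
  rw [← cov_congr_of_eventuallyEq cov ((hY.contMDiffAt).mdifferentiableAt (by simp))
    (mdifferentiableAt_constField hp b) hw.2, hw.1, chartDiff_constField hp,
    (extChartAt I x₀).right_inv hw', ← hw.1] at h2
  exact h2.symm

/-- Fields with constant coordinates commute, so only the antisymmetrized Christoffel symbols
remain. -/
theorem chartDiff_torsion (hq : q ∈ (extChartAt I x₀).source) (X Y : TangentSpace I q) :
    haveI : IsManifold I 2 N := IsManifold.of_le (n := ∞) ENat.LEInfty.out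
    chartDiff I x₀ q (cov.torsion q X Y)
      = connForm cov x₀ (extChartAt I x₀ q) (chartDiff I x₀ q X) (chartDiff I x₀ q Y)
        - connForm cov x₀ (extChartAt I x₀ q) (chartDiff I x₀ q Y) (chartDiff I x₀ q X) := by
  have : IsManifold I 2 N := IsManifold.of_le (n := ∞) ENat.LEInfty.out
  have hX := mdifferentiableAt_constField hq (chartDiff I x₀ q X)
  have hY := mdifferentiableAt_constField hq (chartDiff I x₀ q Y)
  have h := congrArg (chartDiff I x₀ q) (cov.torsion_apply hX hY)
  have he : ∀ a, fieldRep I x₀ (constField I x₀ a) =ᶠ[𝓝 (extChartAt I x₀ q)] fun _ ↦ a :=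
    fun a ↦ eventuallyEq_fieldRep_const hq (Eventually.of_forall fun y ↦ rfl)
  rw [map_sub, map_sub, chartDiff_cov_constField cov hq, chartDiff_cov_constField cov hq,
    chartDiff_mlieBracket hq hX hY, VectorField.lieBracket, (he _).fderiv_eq, (he _).fderiv_eq,
    constField_chartDiff hq, constField_chartDiff hq] at h
  simpa using h

/-- The curvature in coordinates. -/
theorem chartDiff_curvature [T2Space N] (hcov : cov.ContMDiffCovariantDerivative ∞)
    (hq : q ∈ (extChartAt I x₀).source) {X Y Z : ∀ p : N, TangentSpace I p}
    (hX : IsSmoothVF X) (hY : IsSmoothVF Y) (hZ : IsSmoothVF Z) :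
    chartDiff I x₀ q (cov (fun y ↦ cov Z y (Y y)) q (X q) - cov (fun y ↦ cov Z y (X y)) q (Y q)
      - cov Z q (VectorField.mlieBracket I X Y q))
      = localCurvature (connForm cov x₀) (extChartAt I x₀ q) (chartDiff I x₀ q (X q))
        (chartDiff I x₀ q (Y q)) (chartDiff I x₀ q (Z q)) := by
  have hz := (extChartAt I x₀).map_source hq
  have ho := (isOpen_extChartAt_target (I := I) x₀).mem_nhds hz
  have hm : ∀ {V : ∀ p : N, TangentSpace I p} {p : N}, IsSmoothVF V →
      MDifferentiableAt I I.tangent (fun p ↦ (⟨p, V p⟩ : TangentBundle I N)) p :=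
    fun hV ↦ hV.contMDiffAt.mdifferentiableAt (by simp)
  have hd : ∀ {V : ∀ p : N, TangentSpace I p}, IsSmoothVF V →
      ContDiffAt ℝ ∞ (fieldRep I x₀ V) (extChartAt I x₀ q) :=
    fun hV ↦ (contDiffOn_fieldRep hV).contDiffAt ho
  have hrep : ∀ {V : ∀ p : N, TangentSpace I p}, IsSmoothVF V →
      fieldRep I x₀ (fun y ↦ cov Z y (V y)) =ᶠ[𝓝 (extChartAt I x₀ q)] fun w ↦
        fderiv ℝ (fieldRep I x₀ Z) w (fieldRep I x₀ V w)
          + connForm cov x₀ w (fieldRep I x₀ V w) (fieldRep I x₀ Z w) := by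
    intro V hV
    filter_upwards [ho] with w hw
    have h := chartDiff_cov_apply_eq_fderiv cov ((extChartAt I x₀).map_target hw) (hm hZ)
      (V ((extChartAt I x₀).symm w))
    rwa [(extChartAt I x₀).right_inv hw] at h
  rw [map_sub, map_sub, chartDiff_cov_apply_eq_fderiv cov hq (hm (isSmoothVF_cov cov hcov hZ hY)),
    chartDiff_cov_apply_eq_fderiv cov hq (hm (isSmoothVF_cov cov hcov hZ hX)),
    chartDiff_cov_apply_eq_fderiv cov hq (hm hZ), chartDiff_cov_apply_eq_fderiv cov hq (hm hZ),
    chartDiff_cov_apply_eq_fderiv cov hq (hm hZ), chartDiff_mlieBracket hq (hm hX) (hm hY),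
    (hrep hY).fderiv_eq, (hrep hX).fderiv_eq, chartDiff_eq_fieldRep hq X,
    chartDiff_eq_fieldRep hq Y, chartDiff_eq_fieldRep hq Z]
  exact curvature_eq_localCurvature (((contDiffOn_connForm cov hcov).contDiffAt ho).differentiableAt (by simp))
    ((hd hX).differentiableAt (by simp)) ((hd hY).differentiableAt (by simp))
    ((hd hZ).of_le ENat.LEInfty.out)

end ConnectionForm

/-! ### Flatness, torsion and metric compatibility as identities in charts. -/

noncomputable section MetricRepresentative

set_option synthInstance.maxHeartbeats 200000

variable {m : ℕ} {M : Type*} [TopologicalSpace M] [ChartedSpace (EuclideanSpace ℝ (Fin m)) M]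
  [IsManifold (𝓡 m) ∞ M]

theorem isFlatConnection_iff_localCurvature [T2Space M]
    {cov : CovariantDerivative (𝓡 m) (EuclideanSpace ℝ (Fin m))
      (TangentSpace (𝓡 m) : M → Type _)} (hcov : cov.ContMDiffCovariantDerivative ∞) :
    IsFlatConnection cov ↔ ∀ x₀ : M, ∀ z ∈ (extChartAt (𝓡 m) x₀).target, ∀ a b c,
      localCurvature (connForm cov x₀) z a b c = 0 := by
  constructor
  · intro h x₀ z hz a b c
    have hq := (extChartAt (𝓡 m) x₀).map_target hz
    obtain ⟨X, hX, hXa⟩ := exists_isSmoothVF_eq_constField_of_t2 hq a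
    obtain ⟨Y, hY, hYb⟩ := exists_isSmoothVF_eq_constField_of_t2 hq b
    obtain ⟨Z, hZ, hZc⟩ := exists_isSmoothVF_eq_constField_of_t2 hq c
    have := chartDiff_curvature cov hcov hq hX hY hZ
    rw [h X Y Z hX hY hZ, map_zero, hXa.self_of_nhds, hYb.self_of_nhds, hZc.self_of_nhds,
      chartDiff_constField hq, chartDiff_constField hq, chartDiff_constField hq,
      (extChartAt (𝓡 m) x₀).right_inv hz] at this
    exact this.symm
  · intro h X Y Z hX hY hZ x
    have hx := mem_extChartAt_source (I := 𝓡 m) x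
    refine chartDiff_injective hx ?_
    rw [chartDiff_curvature cov hcov hx hX hY hZ, map_zero]
    exact h x _ ((extChartAt (𝓡 m) x).map_source hx) _ _ _

/-- The factor s serves both parts: s = 1 with χ = ψ for integrability, s = -1 with χ = φ₁ + φ₂ for
closedness. -/
theorem torsion_eq_iff {cov : CovariantDerivative (𝓡 m) (EuclideanSpace ℝ (Fin m))
      (TangentSpace (𝓡 m) : M → Type _)} {χ : M → ℝ} (hχ : ContMDiff (𝓡 m) 𝓘(ℝ) ∞ χ) {s : ℝ} :
    (∀ (x : M) (X Y : TangentSpace (𝓡 m) x), cov.torsion x X Y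
        = s • (mvfderiv (𝓡 m) χ x X • Y - mvfderiv (𝓡 m) χ x Y • X)) ↔
      ∀ x₀ : M, ∀ z ∈ (extChartAt (𝓡 m) x₀).target, ∀ a b,
        connForm cov x₀ z a b - connForm cov x₀ z b a
          = s • (fderiv ℝ (χ ∘ (extChartAt (𝓡 m) x₀).symm) z a • b
            - fderiv ℝ (χ ∘ (extChartAt (𝓡 m) x₀).symm) z b • a) := by
  have hd : ∀ {x₀ x : M}, x ∈ (extChartAt (𝓡 m) x₀).source → ∀ X : TangentSpace (𝓡 m) x,
      mvfderiv (𝓡 m) χ x X = fderiv ℝ (χ ∘ (extChartAt (𝓡 m) x₀).symm)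
        (extChartAt (𝓡 m) x₀ x) (chartDiff (𝓡 m) x₀ x X) := fun {x₀ x} hx X ↦
    mvfderiv_eq_fderiv_chartDiff hx ((hχ.contDiffOn_comp_extChartAt_symm.contDiffAt
      ((isOpen_extChartAt_target (I := 𝓡 m) x₀).mem_nhds
        ((extChartAt (𝓡 m) x₀).map_source hx))).differentiableAt (by simp))
      (eventuallyEq_comp_extChartAt χ hx) X
  constructor
  · intro h x₀ z hz a b
    have hq := (extChartAt (𝓡 m) x₀).map_target hz
    have h1 := chartDiff_torsion cov hq (constField (𝓡 m) x₀ a ((extChartAt (𝓡 m) x₀).symm z))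
      (constField (𝓡 m) x₀ b ((extChartAt (𝓡 m) x₀).symm z))
    rw [h, map_smul, map_sub, map_smul, map_smul, hd hq, hd hq, chartDiff_constField hq,
      chartDiff_constField hq, (extChartAt (𝓡 m) x₀).right_inv hz] at h1
    exact h1.symm
  · intro h x X Y
    have hx := mem_extChartAt_source (I := 𝓡 m) x
    refine chartDiff_injective hx ?_
    rw [chartDiff_torsion cov hx, h x _ ((extChartAt (𝓡 m) x).map_source hx), map_smul, map_sub,
      map_smul, map_smul, hd hx, hd hx]

variable [RiemannianBundle (fun x : M ↦ TangentSpace (𝓡 m) x)] {x₀ q : M}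

/-- The Riemannian metric in the chart around `x₀`. -/
def metricRep (x₀ : M) (z : EuclideanSpace ℝ (Fin m)) :
    EuclideanSpace ℝ (Fin m) →L[ℝ] EuclideanSpace ℝ (Fin m) →L[ℝ] ℝ :=
  (innerSL ℝ (E := TangentSpace (𝓡 m) ((extChartAt (𝓡 m) x₀).symm z))).bilinearComp
    ((trivializationAt (EuclideanSpace ℝ (Fin m)) (TangentSpace (𝓡 m)) x₀).symmL ℝ
      ((extChartAt (𝓡 m) x₀).symm z))
    ((trivializationAt (EuclideanSpace ℝ (Fin m)) (TangentSpace (𝓡 m)) x₀).symmL ℝ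
      ((extChartAt (𝓡 m) x₀).symm z))

theorem metricRep_apply (z a b : EuclideanSpace ℝ (Fin m)) : metricRep x₀ z a b
    = inner ℝ (constField (𝓡 m) x₀ a ((extChartAt (𝓡 m) x₀).symm z))
      (constField (𝓡 m) x₀ b ((extChartAt (𝓡 m) x₀).symm z)) := rfl

theorem metricRep_chartDiff (hq : q ∈ (extChartAt (𝓡 m) x₀).source) (X Y : TangentSpace (𝓡 m) q) :
    metricRep x₀ (extChartAt (𝓡 m) x₀ q) (chartDiff (𝓡 m) x₀ q X) (chartDiff (𝓡 m) x₀ q Y)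
      = inner ℝ X Y := by
  rw [metricRep_apply, (extChartAt (𝓡 m) x₀).left_inv hq, constField_chartDiff hq,
    constField_chartDiff hq]

theorem metricRep_symm (z a b : EuclideanSpace ℝ (Fin m)) :
    metricRep x₀ z a b = metricRep x₀ z b a := by
  rw [metricRep_apply, metricRep_apply, real_inner_comm]

theorem eq_zero_of_metricRep_self {z : EuclideanSpace ℝ (Fin m)}
    (hz : z ∈ (extChartAt (𝓡 m) x₀).target) {a : EuclideanSpace ℝ (Fin m)}
    (h : metricRep x₀ z a a = 0) : a = 0 := by
  rw [metricRep_apply, inner_self_eq_zero] at h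
  rw [← fieldRep_constField hz a, fieldRep, h, map_zero]

variable [IsContMDiffRiemannianBundle (𝓡 m) ∞ (EuclideanSpace ℝ (Fin m))
      (fun x : M ↦ TangentSpace (𝓡 m) x)]

theorem contDiffOn_metricRep : ContDiffOn ℝ ∞ (metricRep x₀) (extChartAt (𝓡 m) x₀).target := by
  rw [contDiffOn_clm_apply]
  intro a
  rw [contDiffOn_clm_apply]
  intro b
  rw [← contMDiffOn_iff_contDiffOn]
  have : IsManifold (𝓡 m) (∞ + 1) M := inferInstanceAs (IsManifold (𝓡 m) ∞ M)
  have h : ContMDiffOn (𝓡 m) 𝓘(ℝ) ∞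
      (fun y ↦ inner ℝ (constField (𝓡 m) x₀ a y) (constField (𝓡 m) x₀ b y))
      (extChartAt (𝓡 m) x₀).source :=
    ContMDiffOn.inner_bundle (E := (TangentSpace (𝓡 m) : M → Type _)) (b := id)
      (contMDiffOn_constField a) (contMDiffOn_constField b)
  exact h.comp (contMDiffOn_extChartAt_symm x₀) fun z hz ↦ (extChartAt (𝓡 m) x₀).map_target hz

/-- Metric compatibility is applied to the coordinate fields with constant coefficients v and w,
whose covariant derivatives are Γ(a)v and Γ(a)w. -/
theorem fderiv_metricRep {cov : CovariantDerivative (𝓡 m) (EuclideanSpace ℝ (Fin m))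
      (TangentSpace (𝓡 m) : M → Type _)} (hmetric : cov.IsMetricCompatible)
    {z : EuclideanSpace ℝ (Fin m)} (hz : z ∈ (extChartAt (𝓡 m) x₀).target)
    (a v w : EuclideanSpace ℝ (Fin m)) :
    fderiv ℝ (metricRep x₀) z a v w
      = metricRep x₀ z (connForm cov x₀ z a v) w + metricRep x₀ z v (connForm cov x₀ z a w) := by
  have hq := (extChartAt (𝓡 m) x₀).map_target hz
  have hd := (contDiffOn_metricRep.contDiffAt
    ((isOpen_extChartAt_target (I := 𝓡 m) x₀).mem_nhds hz)).differentiableAt (by simp)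
  have h := hmetric.mvfderiv_inner_eq (constField (𝓡 m) x₀ a)
    (mdifferentiableAt_constField hq v) (mdifferentiableAt_constField hq w)
  have hz' := (extChartAt (𝓡 m) x₀).right_inv hz
  have hd2 : DifferentiableAt ℝ (fun z ↦ metricRep x₀ z v w) z :=
    (hd.clm_apply (differentiableAt_const v)).clm_apply (differentiableAt_const w)
  rw [mvfderiv_eq_fderiv_chartDiff (x₀ := x₀) (f' := fun z ↦ metricRep x₀ z v w) hq (by rwa [hz'])]
    at h
  · rw [fderiv_clm_apply_apply hd]
    rw [chartDiff_constField hq, hz'] at h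
    refine h.trans ?_
    beta_reduce
    rw [← metricRep_chartDiff hq, ← metricRep_chartDiff hq, chartDiff_cov_constField cov hq,
      chartDiff_cov_constField cov hq, hz', chartDiff_constField hq, chartDiff_constField hq,
      chartDiff_constField hq]
  · filter_upwards [(isOpen_extChartAt_source (I := 𝓡 m) x₀).mem_nhds hq] with y hy
    change _ = metricRep x₀ (extChartAt (𝓡 m) x₀ y) v w
    rw [metricRep_apply, (extChartAt (𝓡 m) x₀).left_inv hy]

end MetricRepresentative

/-! ### Charts of the tangent bundle and the vertical projection in them. -/

noncomputable section TangentChart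

set_option synthInstance.maxHeartbeats 200000

theorem mvfderiv_clm_apply {E : Type*} [NormedAddCommGroup E] [NormedSpace ℝ E]
    {H : Type*} [TopologicalSpace H] {I : ModelWithCorners ℝ E H}
    {N : Type*} [TopologicalSpace N] [ChartedSpace H N]
    {F G : Type*} [NormedAddCommGroup F] [NormedSpace ℝ F] [NormedAddCommGroup G] [NormedSpace ℝ G]
    {A : N → F →L[ℝ] G} {f : N → F} {x : N} (hA : MDifferentiableAt I 𝓘(ℝ, F →L[ℝ] G) A x)
    (hf : MDifferentiableAt I 𝓘(ℝ, F) f x) (X : TangentSpace I x) :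
    mvfderiv I (fun y ↦ A y (f y)) x X = mvfderiv I A x X (f x) + A x (mvfderiv I f x X) := by
  have h1 : HasFDerivWithinAt (A ∘ (extChartAt I x).symm) (mvfderiv I A x) (range I)
    (extChartAt I x x) := hA.hasMFDerivAt.2
  have h2 : HasFDerivWithinAt (f ∘ (extChartAt I x).symm) (mvfderiv I f x) (range I)
    (extChartAt I x x) := hf.hasMFDerivAt.2
  have h3 := h1.clm_apply h2
  have h4 : HasMFDerivAt I 𝓘(ℝ, G) (fun y ↦ A y (f y)) x _ :=
    ⟨hA.continuousAt.clm_apply hf.continuousAt, h3⟩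
  have h5 := DFunLike.congr_fun h4.mfderiv X
  refine h5.trans ?_
  change A ((extChartAt I x).symm (extChartAt I x x)) (mvfderiv I f x X)
    + mvfderiv I A x X (f ((extChartAt I x).symm (extChartAt I x x))) = _
  rw [extChartAt_to_inv, add_comm]

theorem mvfderiv_comp_apply_of_normedSpace {E E' : Type*} [NormedAddCommGroup E] [NormedSpace ℝ E]
    [NormedAddCommGroup E'] [NormedSpace ℝ E']
    {H H' : Type*} [TopologicalSpace H] [TopologicalSpace H'] {I : ModelWithCorners ℝ E H}
    {I' : ModelWithCorners ℝ E' H'}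
    {N N' : Type*} [TopologicalSpace N] [ChartedSpace H N] [TopologicalSpace N'] [ChartedSpace H' N']
    {F : Type*} [NormedAddCommGroup F] [NormedSpace ℝ F] {g : N → F} {f : N' → N} (x : N')
    (hg : MDifferentiableAt I 𝓘(ℝ, F) g (f x)) (hf : MDifferentiableAt I' I f x)
    (X : TangentSpace I' x) :
    mvfderiv I' (g ∘ f) x X = mvfderiv I g (f x) (mfderiv I' I f x X) :=
  mfderiv_comp_apply x hg hf X

variable {m : ℕ} {M : Type*} [TopologicalSpace M] [ChartedSpace (EuclideanSpace ℝ (Fin m)) M]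
  [IsManifold (𝓡 m) ∞ M] {u₀ q : TangentBundle (𝓡 m) M}

theorem extChartAt_tangent_source : (extChartAt (𝓡 m).tangent u₀).source
    = TotalSpace.proj ⁻¹' (extChartAt (𝓡 m) u₀.proj).source := by
  ext p
  rw [extChartAt_source, TangentBundle.mem_chart_source_iff, mem_preimage, extChartAt_source]

theorem extChartAt_tangent_apply (hq : q ∈ (extChartAt (𝓡 m).tangent u₀).source) :
    extChartAt (𝓡 m).tangent u₀ q = (extChartAt (𝓡 m) u₀.proj q.proj,
      (trivializationAt (EuclideanSpace ℝ (Fin m)) (TangentSpace (𝓡 m)) u₀.proj q).2) := by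
  rw [extChartAt_tangent_source] at hq
  rw [FiberBundle.extChartAt]
  refine Prod.ext ?_ rfl
  change extChartAt (𝓡 m) u₀.proj
    (trivializationAt (EuclideanSpace ℝ (Fin m)) (TangentSpace (𝓡 m)) u₀.proj q).1 = _
  rw [Trivialization.coe_fst']
  exact mem_baseSet_of_mem_source hq

/-- A chart of TM contains whole fibres, so every vector v is the fibre coordinate of some point
over z. This lets one chart of TM test the curvature on all vectors. -/
theorem extChartAt_tangent_target : (extChartAt (𝓡 m).tangent u₀).target
    = (extChartAt (𝓡 m) u₀.proj).target ×ˢ univ := by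
  rw [FiberBundle.extChartAt_target]
  congr 1
  refine inter_eq_left.2 fun z hz ↦ ?_
  exact mem_baseSet_of_mem_source ((extChartAt (𝓡 m) u₀.proj).map_target hz)

theorem chartDiff_tangent_fst (hq : q ∈ (extChartAt (𝓡 m).tangent u₀).source)
    (X : TangentSpace (𝓡 m).tangent q) :
    (chartDiff (𝓡 m).tangent u₀ q X).1 = chartDiff (𝓡 m) u₀.proj q.proj (dProj q X) := by
  have hq' := hq
  rw [extChartAt_tangent_source] at hq'
  have h1 := mvfderiv_eq_fderiv_chartDiff (I := (𝓡 m).tangent)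
    (f := fun p : TangentBundle (𝓡 m) M ↦ extChartAt (𝓡 m) u₀.proj p.proj)
    (f' := Prod.fst) hq differentiableAt_fst (by
      filter_upwards [(isOpen_extChartAt_source (I := (𝓡 m).tangent) u₀).mem_nhds hq] with p hp
      rw [Function.comp_apply, extChartAt_tangent_apply hp]) X
  rw [fderiv_fst] at h1
  refine h1.symm.trans ?_
  rw [chartDiff_eq_mfderiv hq']
  exact mvfderiv_comp_apply_of_normedSpace (I := 𝓡 m) (g := extChartAt (𝓡 m) u₀.proj)
    (f := fun p : TangentBundle (𝓡 m) M ↦ p.proj) q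
    (mdifferentiableAt_extChartAt (by rwa [← extChartAt_source (𝓡 m)])) (mdifferentiableAt_proj _) X

theorem chartDiff_tangent_snd (hq : q ∈ (extChartAt (𝓡 m).tangent u₀).source)
    (X : TangentSpace (𝓡 m).tangent q) :
    (chartDiff (𝓡 m).tangent u₀ q X).2 = mvfderiv (𝓡 m).tangent (fun p : TangentBundle (𝓡 m) M ↦
      (trivializationAt (EuclideanSpace ℝ (Fin m)) (TangentSpace (𝓡 m)) u₀.proj p).2) q X := by
  have h1 := mvfderiv_eq_fderiv_chartDiff (I := (𝓡 m).tangent)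
    (f := fun p : TangentBundle (𝓡 m) M ↦
      (trivializationAt (EuclideanSpace ℝ (Fin m)) (TangentSpace (𝓡 m)) u₀.proj p).2)
    (f' := Prod.snd) hq differentiableAt_snd (by
      filter_upwards [(isOpen_extChartAt_source (I := (𝓡 m).tangent) u₀).mem_nhds hq] with p hp
      rw [Function.comp_apply, extChartAt_tangent_apply hp]) X
  rw [fderiv_snd] at h1
  exact h1.symm

theorem mdifferentiableAt_fibreCoord {x₀ : M} (hq : q.proj ∈ (extChartAt (𝓡 m) x₀).source) :
    MDifferentiableAt (𝓡 m).tangent 𝓘(ℝ, EuclideanSpace ℝ (Fin m))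
      (fun p : TangentBundle (𝓡 m) M ↦
        (trivializationAt (EuclideanSpace ℝ (Fin m)) (TangentSpace (𝓡 m)) x₀ p).2) q := by
  have hmd := Bundle.Trivialization.mdifferentiable (I := 𝓡 m)
    (TangentSpace (𝓡 m) : M → Type _)
    (trivializationAt (EuclideanSpace ℝ (Fin m)) (TangentSpace (𝓡 m) : M → Type _) x₀)
  refine mdifferentiableAt_snd.comp q (hmd.mdifferentiableAt ?_)
  rw [Trivialization.mem_source]
  exact mem_baseSet_of_mem_source hq

/-- `vertProj` at q is built from the chart at π q, whereas here it is read in a fixed chart. The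
fibre coordinates are related by the transition K, and d(Kw) = (dK)w + K dw. The term (dK)w is also
the one that appears when ∇ of a field constant in one chart is computed in the other, so the two
expressions agree. -/
theorem chartDiff_vertProj (cov : CovariantDerivative (𝓡 m) (EuclideanSpace ℝ (Fin m))
      (TangentSpace (𝓡 m) : M → Type _)) (hq : q ∈ (extChartAt (𝓡 m).tangent u₀).source)
    (X : TangentSpace (𝓡 m).tangent q) :
    chartDiff (𝓡 m) u₀.proj q.proj (vertProj cov q X)
      = localVert (connForm cov u₀.proj) (extChartAt (𝓡 m).tangent u₀ q)
        (chartDiff (𝓡 m).tangent u₀ q X) := by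
  have hq' := hq
  rw [extChartAt_tangent_source, mem_preimage] at hq'
  have hqq := mem_extChartAt_source (I := 𝓡 m) q.proj
  set e := trivializationAt (EuclideanSpace ℝ (Fin m)) (TangentSpace (𝓡 m) : M → Type _) q.proj
    with he
  set e' := trivializationAt (EuclideanSpace ℝ (Fin m)) (TangentSpace (𝓡 m) : M → Type _) u₀.proj
    with he'
  set K : M → EuclideanSpace ℝ (Fin m) →L[ℝ] EuclideanSpace ℝ (Fin m) :=
    fun y ↦ (e.coordChangeL ℝ e' y : EuclideanSpace ℝ (Fin m) →L[ℝ] EuclideanSpace ℝ (Fin m))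
    with hK
  have hKm : MDifferentiableAt (𝓡 m) 𝓘(ℝ, EuclideanSpace ℝ (Fin m) →L[ℝ] EuclideanSpace ℝ (Fin m))
      K q.proj :=
    ((contMDiffOn_coordChangeL (n := 1) (IB := 𝓡 m) e e').contMDiffAt
      ((e.open_baseSet.inter e'.open_baseSet).mem_nhds
        ⟨mem_baseSet_of_mem_source hqq, mem_baseSet_of_mem_source hq'⟩)).mdifferentiableAt (by simp)
  have hK1 : ∀ y ∈ e.baseSet ∩ e'.baseSet, ∀ w,
      K y w = chartDiff (𝓡 m) u₀.proj y (e.symmL ℝ y w) := by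
    intro y hy w
    rw [chartDiff_apply (by rw [extChartAt_source]; exact hy.2)]
    rw [e.symmL_apply hy.1]
    exact e.coordChangeL_apply (R := ℝ) e' hy w
  have hev : ∀ᶠ y in 𝓝 q.proj, y ∈ e.baseSet ∩ e'.baseSet :=
    (e.open_baseSet.inter e'.open_baseSet).mem_nhds
      ⟨mem_baseSet_of_mem_source hqq, mem_baseSet_of_mem_source hq'⟩
  set w : EuclideanSpace ℝ (Fin m) := (e q).2 with hw
  have hmk : ∀ p : TangentBundle (𝓡 m) M, p.proj ∈ e.baseSet → e.symmL ℝ p.proj (e p).2 = p.2 :=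
    fun p hp ↦ (e.symmL_apply hp _).trans (e.symm_apply_apply_mk hp p.2)
  have h1 := chartDiff_cov_apply cov hq' (mdifferentiableAt_constField hqq w) (dProj q X)
  have hpX : MDifferentiableAt (𝓡 m).tangent (𝓡 m) (fun p : TangentBundle (𝓡 m) M ↦ p.proj) q :=
    mdifferentiableAt_proj _
  have h2 : mvfderiv (𝓡 m)
      (fun y ↦ chartDiff (𝓡 m) u₀.proj y (constField (𝓡 m) q.proj w y)) q.proj
      = mvfderiv (𝓡 m) (fun y ↦ K y w) q.proj := by
    have : (fun y ↦ chartDiff (𝓡 m) u₀.proj y (constField (𝓡 m) q.proj w y))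
        =ᶠ[𝓝 q.proj] fun y ↦ K y w := by
      filter_upwards [hev] with y hy
      exact (hK1 y hy w).symm
    exact this.mfderiv_eq
  have h3 := mvfderiv_clm_apply hKm
    (mdifferentiableAt_const (c := w) : MDifferentiableAt (𝓡 m) 𝓘(ℝ, _) (fun _ : M ↦ w) q.proj)
    (dProj q X)
  rw [mvfderiv_const, zero_apply, map_zero, add_zero] at h3
  have h4 := mvfderiv_clm_apply (hKm.comp q hpX) (mdifferentiableAt_fibreCoord hqq) X
  have h5 : mvfderiv (𝓡 m).tangent (K ∘ fun p : TangentBundle (𝓡 m) M ↦ p.proj) q X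
      = mvfderiv (𝓡 m) K q.proj (dProj q X) :=
    mvfderiv_comp_apply_of_normedSpace (I := 𝓡 m) (g := K) (f := fun p : TangentBundle (𝓡 m) M ↦ p.proj)
      q hKm hpX X
  have h6 : mvfderiv (𝓡 m).tangent (fun p : TangentBundle (𝓡 m) M ↦ (e' p).2) q
      = mvfderiv (𝓡 m).tangent (fun p : TangentBundle (𝓡 m) M ↦
        (K ∘ fun p : TangentBundle (𝓡 m) M ↦ p.proj) p (e p).2) q := by
    -- The change of fibre coordinates, valid over the overlap of the two charts.
    have : (fun p : TangentBundle (𝓡 m) M ↦ (e' p).2) =ᶠ[𝓝 q] fun p ↦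
        (K ∘ fun p : TangentBundle (𝓡 m) M ↦ p.proj) p (e p).2 := by
      filter_upwards [hpX.continuousAt.eventually hev] with p hp
      rw [Function.comp_apply, hK1 _ hp, hmk p hp.1,
        chartDiff_apply (by rw [extChartAt_source]; exact hp.2)]
    exact this.mfderiv_eq
  have hcc : ∀ᶠ y in 𝓝 q.proj, constCoeffField q y = constField (𝓡 m) q.proj w y := by
    filter_upwards [hev] with y hy
    exact (e.symmL_apply hy.1 _).symm
  have h7 : cov (constCoeffField q) q.proj = cov (constField (𝓡 m) q.proj w) q.proj := by
    refine cov_congr_of_eventuallyEq cov ((mdifferentiableAt_constField hqq w).congr_of_eventuallyEq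
      ?_) (mdifferentiableAt_constField hqq w) hcc
    filter_upwards [hcc] with y hy
    rw [hy]
  have h8 : constField (𝓡 m) q.proj w q.proj = q.2 := hmk q (mem_baseSet_of_mem_source hqq)
  rw [localVert_apply, extChartAt_tangent_apply hq, chartDiff_tangent_fst hq,
    chartDiff_tangent_snd hq, ← he', h6, h4, h5, vertProj, add_apply, map_add,
    ContinuousLinearMap.comp_apply, ContinuousLinearMap.comp_apply, h7, h1, h2, h3, h8,
    chartDiff_apply hq' q.2]
  have h9 := (hK1 _ hev.self_of_nhds (dFibreCoord q X)).symm
  have h10 : ∀ x k a b : EuclideanSpace ℝ (Fin m), x = k → x + (a + b) = a + k + b := by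
    rintro x k a b rfl
    abel
  exact h10 _ _ _ _ h9

/-- Chart domains of TM are preimages of chart domains of M, so a bump function on M pulled back
along π cuts off the coordinate field. Its support is not compact in the fibre directions, but only
its lying in the chart domain matters. -/
theorem exists_isSmoothVF_tangentBundle_eq_constField [T2Space M] {x₀ : M} {q : TangentBundle (𝓡 m) M}
    (hq : q ∈ (extChartAt (𝓡 m).tangent (⟨x₀, 0⟩ : TangentBundle (𝓡 m) M)).source)
    (a : EuclideanSpace ℝ (Fin m) × EuclideanSpace ℝ (Fin m)) :
    ∃ X : ∀ u : TangentBundle (𝓡 m) M, TangentSpace (𝓡 m).tangent u, IsSmoothVF X ∧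
      X q = constField (𝓡 m).tangent (⟨x₀, 0⟩ : TangentBundle (𝓡 m) M) a q := by
  have hq' := hq
  rw [extChartAt_tangent_source, mem_preimage] at hq'
  obtain ⟨f, hf, hs, h1⟩ := exists_contMDiff_eventuallyEq_one hq'
  have hp : ContMDiff (𝓡 m).tangent (𝓡 m) ∞ (fun u : TangentBundle (𝓡 m) M ↦ u.proj) :=
    contMDiff_proj _
  have hs' : tsupport (f ∘ fun u : TangentBundle (𝓡 m) M ↦ u.proj)
      ⊆ (extChartAt (𝓡 m).tangent (⟨x₀, 0⟩ : TangentBundle (𝓡 m) M)).source := by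
    rw [extChartAt_tangent_source]
    have h2 : tsupport (f ∘ fun u : TangentBundle (𝓡 m) M ↦ u.proj)
        ⊆ (fun u : TangentBundle (𝓡 m) M ↦ u.proj) ⁻¹' tsupport f :=
      closure_minimal (fun u hu ↦ subset_tsupport f hu)
        ((isClosed_tsupport f).preimage hp.continuous)
    exact h2.trans (preimage_mono hs)
  obtain ⟨X, hX, hX'⟩ := exists_isSmoothVF_eq_constField (q := q) (hf.comp hp) hs'
    (hp.continuous.continuousAt.eventually h1) a
  exact ⟨X, hX, hX'.self_of_nhds⟩

end TangentChart

/-! ### I^G and ω^G in the charts of the tangent bundle. -/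

noncomputable section SasakiCoordinates

set_option synthInstance.maxHeartbeats 200000

variable {m : ℕ} {M : Type*} [TopologicalSpace M] [ChartedSpace (EuclideanSpace ℝ (Fin m)) M]
  [IsManifold (𝓡 m) ∞ M] {u₀ q : TangentBundle (𝓡 m) M}
  (cov : CovariantDerivative (𝓡 m) (EuclideanSpace ℝ (Fin m)) (TangentSpace (𝓡 m) : M → Type _))

theorem splitting_apply (u : TangentBundle (𝓡 m) M) (X : TangentSpace (𝓡 m).tangent u) :
    splitting cov u X = (dProj u X, vertProj cov u X) := rfl

theorem dProj_splitting_symm (u : TangentBundle (𝓡 m) M)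
    (p : TangentSpace (𝓡 m) u.proj × TangentSpace (𝓡 m) u.proj) :
    dProj u ((splitting cov u).symm p) = p.1 :=
  congrArg Prod.fst ((splitting cov u).apply_symm_apply p)

theorem vertProj_splitting_symm (u : TangentBundle (𝓡 m) M)
    (p : TangentSpace (𝓡 m) u.proj × TangentSpace (𝓡 m) u.proj) :
    vertProj cov u ((splitting cov u).symm p) = p.2 :=
  congrArg Prod.snd ((splitting cov u).apply_symm_apply p)

theorem acsG_eq (φ₁ φ₂ : M → ℝ) (u : TangentBundle (𝓡 m) M) (X : TangentSpace (𝓡 m).tangent u) :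
    acsG cov φ₁ φ₂ u X
      = Real.exp (φ₂ u.proj - φ₁ u.proj) • (splitting cov u).symm (vertProj cov u X, 0)
        - Real.exp (-(φ₂ u.proj - φ₁ u.proj)) • (splitting cov u).symm (0, dProj u X) := rfl

theorem dProj_acsG (φ₁ φ₂ : M → ℝ) (u : TangentBundle (𝓡 m) M)
    (X : TangentSpace (𝓡 m).tangent u) :
    dProj u (acsG cov φ₁ φ₂ u X) = Real.exp (φ₂ u.proj - φ₁ u.proj) • vertProj cov u X := by
  rw [acsG_eq, map_sub, map_smul, map_smul, dProj_splitting_symm, dProj_splitting_symm, smul_zero,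
    sub_zero]

theorem vertProj_acsG (φ₁ φ₂ : M → ℝ) (u : TangentBundle (𝓡 m) M)
    (X : TangentSpace (𝓡 m).tangent u) :
    vertProj cov u (acsG cov φ₁ φ₂ u X) = -(Real.exp (-(φ₂ u.proj - φ₁ u.proj)) • dProj u X) := by
  rw [acsG_eq, map_sub, map_smul, map_smul, vertProj_splitting_symm, vertProj_splitting_symm,
    smul_zero, zero_sub]

/-- A vector is determined by its base and vertical parts; I^G exchanges these up to the factors e^ψ
and -e^{-ψ}, and the fibre coordinate is recovered by subtracting Γ. -/
theorem chartDiff_acsG (φ₁ φ₂ : M → ℝ) (hq : q ∈ (extChartAt (𝓡 m).tangent u₀).source)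
    (X : TangentSpace (𝓡 m).tangent q) :
    chartDiff (𝓡 m).tangent u₀ q (acsG cov φ₁ φ₂ q X)
      = localACS (connForm cov u₀.proj) ((φ₂ - φ₁) ∘ (extChartAt (𝓡 m) u₀.proj).symm)
        (extChartAt (𝓡 m).tangent u₀ q) (chartDiff (𝓡 m).tangent u₀ q X) := by
  have hq' := hq
  rw [extChartAt_tangent_source, mem_preimage] at hq'
  have h1 := chartDiff_tangent_fst hq (acsG cov φ₁ φ₂ q X)
  have h2 := chartDiff_vertProj cov hq (acsG cov φ₁ φ₂ q X)
  rw [dProj_acsG, map_smul, chartDiff_vertProj cov hq, localVert_apply] at h1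
  rw [vertProj_acsG, map_neg, map_smul, ← chartDiff_tangent_fst hq, localVert_apply, h1] at h2
  have h3 : ((φ₂ - φ₁) ∘ (extChartAt (𝓡 m) u₀.proj).symm) (extChartAt (𝓡 m).tangent u₀ q).1
      = φ₂ q.proj - φ₁ q.proj := by
    rw [extChartAt_tangent_apply hq, Function.comp_apply, (extChartAt (𝓡 m) u₀.proj).left_inv hq']
    rfl
  rw [localACS, h3]
  refine Prod.ext h1 ?_
  have h4 : ∀ a b c : EuclideanSpace ℝ (Fin m), a + b = -c → a = -b - c := fun a b c h ↦ by
    linear_combination (norm := module) h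
  exact h4 _ _ _ h2.symm

variable [RiemannianBundle (fun x : M ↦ TangentSpace (𝓡 m) x)] {f₁ f₂ φ₁ φ₂ : M → ℝ}

/-- The weights are chosen so that both terms carry the same factor: f₁e^ψ = f₂e^{-ψ} = e^{φ₁+φ₂}.
-/
theorem omegaG_apply (hf₁ : ∀ x, f₁ x = Real.exp (2 * φ₁ x)) (hf₂ : ∀ x, f₂ x = Real.exp (2 * φ₂ x))
    (u : TangentBundle (𝓡 m) M) (X Y : TangentSpace (𝓡 m).tangent u) :
    omegaG cov f₁ f₂ φ₁ φ₂ u X Y = Real.exp (φ₂ u.proj + φ₁ u.proj) *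
      (inner ℝ (vertProj cov u X) (dProj u Y) - inner ℝ (dProj u X) (vertProj cov u Y)) := by
  have h : omegaG cov f₁ f₂ φ₁ φ₂ u X Y
      = f₁ u.proj * inner ℝ (dProj u (acsG cov φ₁ φ₂ u X)) (dProj u Y)
        + f₂ u.proj * inner ℝ (vertProj cov u (acsG cov φ₁ φ₂ u X)) (vertProj cov u Y) := rfl
  rw [h, dProj_acsG, vertProj_acsG, hf₁, hf₂, real_inner_smul_left, inner_neg_left,
    real_inner_smul_left, ← mul_assoc, ← Real.exp_add, mul_neg, ← mul_assoc, ← Real.exp_add,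
    mul_sub, ← sub_eq_add_neg]
  ring_nf

theorem omegaG_eq_localOmega (hf₁ : ∀ x, f₁ x = Real.exp (2 * φ₁ x))
    (hf₂ : ∀ x, f₂ x = Real.exp (2 * φ₂ x)) (hq : q ∈ (extChartAt (𝓡 m).tangent u₀).source)
    (X Y : TangentSpace (𝓡 m).tangent q) :
    omegaG cov f₁ f₂ φ₁ φ₂ q X Y = localOmega (connForm cov u₀.proj)
      ((φ₂ + φ₁) ∘ (extChartAt (𝓡 m) u₀.proj).symm) (metricRep u₀.proj)
      (extChartAt (𝓡 m).tangent u₀ q) (chartDiff (𝓡 m).tangent u₀ q X)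
      (chartDiff (𝓡 m).tangent u₀ q Y) := by
  have hq' := hq
  rw [extChartAt_tangent_source, mem_preimage] at hq'
  rw [omegaG_apply cov hf₁ hf₂, localOmega_apply, ← localVert_apply, ← localVert_apply,
    ← chartDiff_vertProj cov hq, ← chartDiff_vertProj cov hq, chartDiff_tangent_fst hq,
    chartDiff_tangent_fst hq, extChartAt_tangent_apply hq, metricRep_chartDiff hq',
    metricRep_chartDiff hq', Function.comp_apply, (extChartAt (𝓡 m) u₀.proj).left_inv hq']
  rfl

theorem omegaG_self (hf₁ : ∀ x, f₁ x = Real.exp (2 * φ₁ x))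
    (hf₂ : ∀ x, f₂ x = Real.exp (2 * φ₂ x)) (u : TangentBundle (𝓡 m) M)
    (X : TangentSpace (𝓡 m).tangent u) : omegaG cov f₁ f₂ φ₁ φ₂ u X X = 0 := by
  rw [omegaG_apply cov hf₁ hf₂, real_inner_comm, sub_self, mul_zero]

theorem eq_zero_of_omegaG (hf₁ : ∀ x, f₁ x = Real.exp (2 * φ₁ x))
    (hf₂ : ∀ x, f₂ x = Real.exp (2 * φ₂ x)) (u : TangentBundle (𝓡 m) M)
    (X : TangentSpace (𝓡 m).tangent u) (h : ∀ Y, omegaG cov f₁ f₂ φ₁ φ₂ u X Y = 0) : X = 0 := by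
  -- For this Y the value of the form is e^{φ₁+φ₂} times the sum of the squared norms of the
  -- vertical and base parts of X.
  have h1 := h ((splitting cov u).symm (vertProj cov u X, -dProj u X))
  rw [omegaG_apply cov hf₁ hf₂, dProj_splitting_symm, vertProj_splitting_symm, inner_neg_right,
    sub_neg_eq_add, mul_eq_zero, or_iff_right (Real.exp_ne_zero _)] at h1
  have h2 : (0 : ℝ) ≤ inner ℝ (vertProj cov u X) (vertProj cov u X) := real_inner_self_nonneg
  have h3 : (0 : ℝ) ≤ inner ℝ (dProj u X) (dProj u X) := real_inner_self_nonneg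
  have h4 : vertProj cov u X = 0 := inner_self_eq_zero.1 (by linarith : _ = (0 : ℝ))
  have h5 : dProj u X = 0 := inner_self_eq_zero.1 (by linarith : _ = (0 : ℝ))
  refine (splitting cov u).injective ?_
  rw [splitting_apply, h4, h5, map_zero]
  rfl

end SasakiCoordinates

/-! ### Integrability tested in charts. -/

noncomputable section Integrability

set_option synthInstance.maxHeartbeats 200000

variable {E : Type*} [NormedAddCommGroup E] [NormedSpace ℝ E]
  {H : Type*} [TopologicalSpace H] {I : ModelWithCorners ℝ E H} [I.Boundaryless]
  {N : Type*} [TopologicalSpace N] [ChartedSpace H N] [IsManifold I ∞ N]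
  {J : ∀ p : N, TangentSpace I p →ₗ[ℝ] TangentSpace I p} {x₀ : N} {n : ℕ}

/-- The extended chart of a manifold without boundary as an open partial homeomorphism. -/
def openExtChartAt (I : ModelWithCorners ℝ E H) [I.Boundaryless] (x₀ : N) :
    OpenPartialHomeomorph N E where
  toPartialEquiv := extChartAt I x₀
  open_source := isOpen_extChartAt_source x₀
  open_target := isOpen_extChartAt_target x₀
  continuousOn_toFun := continuousOn_extChartAt x₀
  continuousOn_invFun := continuousOn_extChartAt_symm x₀

/-- An almost complex structure is integrable if around every point its expression `J'` in a chart
admits holomorphic coordinates. -/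
theorem isIntegrableACS_of_forall_chart
    (h : ∀ x₀ : N, ∃ J' : E → E → E,
      (∀ q ∈ (extChartAt I x₀).source, ∀ X, chartDiff I x₀ q (J q X)
        = J' (extChartAt I x₀ q) (chartDiff I x₀ q X)) ∧
      ∃ Ψ : OpenPartialHomeomorph E (Fin n → ℂ), extChartAt I x₀ x₀ ∈ Ψ.source ∧
        ContDiffOn ℝ ∞ Ψ Ψ.source ∧ ContDiffOn ℝ ∞ Ψ.symm Ψ.target ∧
        ∀ z ∈ Ψ.source, ∀ X, fderiv ℝ Ψ z (J' z X) = Complex.I • fderiv ℝ Ψ z X) :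
    IsIntegrableACS I n J := by
  intro x₀
  obtain ⟨J', hJ', Ψ, hx, hΨ, hΨ', hJ⟩ := h x₀
  refine ⟨(openExtChartAt I x₀).trans Ψ, ?_, ?_, ?_, ?_⟩
  · rw [OpenPartialHomeomorph.trans_source]
    exact ⟨mem_extChartAt_source x₀, hx⟩
  · refine (contMDiffOn_iff_contDiffOn.2 hΨ).comp ((contMDiffOn_extChartAt (x := x₀)).mono ?_) ?_
    · intro q hq
      rw [← extChartAt_source I]
      exact hq.1
    · exact fun q hq ↦ hq.2
  · refine (contMDiffOn_extChartAt_symm x₀).comp ((contMDiffOn_iff_contDiffOn.2 hΨ').mono ?_) ?_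
    · exact fun w hw ↦ hw.1
    · exact fun w hw ↦ hw.2
  · intro q hq X
    have hq1 : q ∈ (extChartAt I x₀).source := hq.1
    have hq2 : extChartAt I x₀ q ∈ Ψ.source := hq.2
    have hd := (hΨ.contDiffAt (Ψ.open_source.mem_nhds hq2)).differentiableAt (by simp)
    have key : ∀ Y, mvfderiv I ((openExtChartAt I x₀).trans Ψ) q Y
        = fderiv ℝ Ψ (extChartAt I x₀ q) (chartDiff I x₀ q Y) :=
      fun Y ↦ mvfderiv_eq_fderiv_chartDiff hq1 hd (Eventually.of_forall fun y ↦ rfl) Y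
    rw [key, key, hJ' q hq1, hJ _ hq2]

/-- The expression in a chart of the holomorphic coordinates of an integrable almost complex
structure. -/
theorem IsIntegrableACS.exists_holomorphic (hJ : IsIntegrableACS I n J) {J' : E → E → E}
    (hJ' : ∀ q ∈ (extChartAt I x₀).source, ∀ X, chartDiff I x₀ q (J q X)
        = J' (extChartAt I x₀ q) (chartDiff I x₀ q X)) {z : E}
    (hz : z ∈ (extChartAt I x₀).target) :
    ∃ F : E → Fin n → ℂ, ContDiffAt ℝ ∞ F z ∧ Function.Injective (fderiv ℝ F z) ∧
      ∀ᶠ w in 𝓝 z, ∀ X, fderiv ℝ F w (J' w X) = Complex.I • fderiv ℝ F w X := by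
  obtain ⟨Φ, hq, hΦ, hΦ', hI⟩ := hJ ((extChartAt I x₀).symm z)
  have hev : ∀ᶠ w in 𝓝 z, w ∈ (extChartAt I x₀).target ∧ (extChartAt I x₀).symm w ∈ Φ.source :=
    Filter.Eventually.and ((isOpen_extChartAt_target x₀).mem_nhds hz)
      ((continuousOn_extChartAt_symm x₀).continuousAt ((isOpen_extChartAt_target x₀).mem_nhds hz)
        (Φ.open_source.mem_nhds hq))
  set F : E → Fin n → ℂ := Φ ∘ (extChartAt I x₀).symm with hF
  have hFs : ∀ w ∈ (extChartAt I x₀).target, (extChartAt I x₀).symm w ∈ Φ.source →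
      ContDiffAt ℝ ∞ F w := by
    intro w hw hw'
    rw [← contMDiffAt_iff_contDiffAt]
    exact (hΦ.contMDiffAt (Φ.open_source.mem_nhds hw')).comp w
      ((contMDiffOn_extChartAt_symm x₀).contMDiffAt ((isOpen_extChartAt_target x₀).mem_nhds hw))
  have key : ∀ w ∈ (extChartAt I x₀).target, (extChartAt I x₀).symm w ∈ Φ.source →
      ∀ X : TangentSpace I ((extChartAt I x₀).symm w), mvfderiv I Φ ((extChartAt I x₀).symm w) X
        = fderiv ℝ F w (chartDiff I x₀ ((extChartAt I x₀).symm w) X) := by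
    intro w hw hw' X
    have hs := (extChartAt I x₀).map_target hw
    have hr := (extChartAt I x₀).right_inv hw
    have := mvfderiv_eq_fderiv_chartDiff (f := Φ) (f' := F) hs
      (by rw [hr]; exact (hFs w hw hw').differentiableAt (by simp))
      (eventuallyEq_comp_extChartAt Φ hs) X
    rwa [hr] at this
  refine ⟨F, hFs z hz hq, ?_, ?_⟩
  · rw [injective_iff_map_eq_zero]
    intro X hX
    have hs := (extChartAt I x₀).map_target hz
    have hΦd : Φ.MDifferentiable I 𝓘(ℝ, Fin n → ℂ) :=
      ⟨hΦ.mdifferentiableOn (by simp), hΦ'.mdifferentiableOn (by simp)⟩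
    have h1 := key z hz hq (constField I x₀ X _)
    rw [chartDiff_constField hs, hX] at h1
    have h2 : constField I x₀ X ((extChartAt I x₀).symm z) = 0 :=
      hΦd.mfderiv_injective hq (h1.trans (map_zero _).symm)
    rw [← chartDiff_constField hs X, h2, map_zero]
  · filter_upwards [hev] with w hw X
    have hs := (extChartAt I x₀).map_target hw.1
    have h1 := hI _ hw.2 (constField I x₀ X _)
    rw [key w hw.1 hw.2, key w hw.1 hw.2, hJ' _ hs, chartDiff_constField hs,
      (extChartAt I x₀).right_inv hw.1] at h1
    exact h1

end Integrability

/-! ### Integrability of I^G. -/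

noncomputable section SasakiIntegrability

set_option synthInstance.maxHeartbeats 200000

variable {m : ℕ} {M : Type*} [TopologicalSpace M] [T2Space M]
  [ChartedSpace (EuclideanSpace ℝ (Fin m)) M] [IsManifold (𝓡 m) ∞ M]
  {cov : CovariantDerivative (𝓡 m) (EuclideanSpace ℝ (Fin m)) (TangentSpace (𝓡 m) : M → Type _)}

theorem isIntegrableACS_acsG_iff (hcov : cov.ContMDiffCovariantDerivative ∞) {φ₁ φ₂ : M → ℝ}
    (hφ₁ : ContMDiff (𝓡 m) 𝓘(ℝ) ∞ φ₁) (hφ₂ : ContMDiff (𝓡 m) 𝓘(ℝ) ∞ φ₂) :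
    IsIntegrableACS (𝓡 m).tangent m (acsG cov φ₁ φ₂) ↔
      IsFlatConnection cov ∧ ∀ (x : M) (X Y : TangentSpace (𝓡 m) x),
        cov.torsion x X Y
          = mvfderiv (𝓡 m) (φ₂ - φ₁) x X • Y - mvfderiv (𝓡 m) (φ₂ - φ₁) x Y • X := by
  have hψ : ContMDiff (𝓡 m) 𝓘(ℝ) ∞ (φ₂ - φ₁) := hφ₂.sub hφ₁
  have ht := torsion_eq_iff (cov := cov) hψ (s := 1)
  simp only [one_smul] at ht
  rw [isFlatConnection_iff_localCurvature hcov, ht]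
  have hΓ := fun x₀ : M ↦ contDiffOn_connForm (x₀ := x₀) cov hcov
  have hψ' := fun x₀ : M ↦ hψ.contDiffOn_comp_extChartAt_symm (x₀ := x₀)
  constructor
  · intro h
    have key : ∀ x₀ : M, ∀ z ∈ (extChartAt (𝓡 m) x₀).target, ∀ v : EuclideanSpace ℝ (Fin m),
        ∀ a b, localCurvature (connForm cov x₀) z a b v = 0
          ∧ connForm cov x₀ z a b - connForm cov x₀ z b a
            = fderiv ℝ ((φ₂ - φ₁) ∘ (extChartAt (𝓡 m) x₀).symm) z a • b
              - fderiv ℝ ((φ₂ - φ₁) ∘ (extChartAt (𝓡 m) x₀).symm) z b • a := by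
      intro x₀ z hz v
      have hp : (z, v) ∈ (extChartAt (𝓡 m).tangent (⟨x₀, 0⟩ : TangentBundle (𝓡 m) M)).target := by
        rw [extChartAt_tangent_target]
        exact ⟨hz, mem_univ _⟩
      obtain ⟨F, hF, hi, hI⟩ := h.exists_holomorphic
        (fun q hq X ↦ chartDiff_acsG cov φ₁ φ₂ hq X) hp
      have ho := (isOpen_extChartAt_target (I := 𝓡 m) x₀).mem_nhds hz
      exact localCurvature_eq_zero_of_holomorphic (p := (z, v))
        (((hΓ x₀).contDiffAt ho).differentiableAt (by simp))
        (((hψ' x₀).contDiffAt ho).differentiableAt (by simp)) (hF.of_le ENat.LEInfty.out) hI hi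
    -- The curvature needs every fibre point v = c; the torsion condition does not involve v, so v =
    -- 0 suffices.
    exact ⟨fun x₀ z hz a b c ↦ (key x₀ z hz c a b).1, fun x₀ z hz a b ↦ (key x₀ z hz 0 a b).2⟩
  · rintro ⟨hR, hT⟩
    refine isIntegrableACS_of_forall_chart fun u ↦ ⟨_, fun q hq X ↦ chartDiff_acsG cov φ₁ φ₂ hq X, ?_⟩
    have hu : (extChartAt (𝓡 m).tangent u u).1 ∈ (extChartAt (𝓡 m) u.proj).target := by
      rw [extChartAt_tangent_apply (mem_extChartAt_source u)]
      exact mem_extChartAt_target u.proj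
    obtain ⟨Φ, h1, -, h3, h4, h5⟩ := exists_holomorphic_coordinates
      (isOpen_extChartAt_target (I := 𝓡 m) u.proj) (hΓ u.proj) (hψ' u.proj) (hR u.proj) (hT u.proj) hu
    exact ⟨Φ, h1, h3, h4, h5⟩

end SasakiIntegrability

/-! ### Functions constant on components, and the equation dχ ∧ 1 = 0. -/

noncomputable section ComponentwiseConstant

set_option synthInstance.maxHeartbeats 200000

variable {m : ℕ} {M : Type*} [TopologicalSpace M]
  [ChartedSpace (EuclideanSpace ℝ (Fin m)) M]

theorem IsConstOnComponents.comp_iff {N : Type*} [TopologicalSpace N] {f : N → ℝ} {h : ℝ → ℝ}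
    (hh : Function.Injective h) :
    IsConstOnComponents (fun x ↦ h (f x)) ↔ IsConstOnComponents f :=
  forall_congr' fun _ ↦ forall₂_congr fun _ _ ↦ hh.eq_iff

theorem IsConstOnComponents.isLocallyConstant {N : Type*} [TopologicalSpace N]
    [LocallyConnectedSpace N] {f : N → ℝ} (hf : IsConstOnComponents f) : IsLocallyConstant f := by
  rw [IsLocallyConstant.iff_eventually_eq]
  exact fun x ↦ mem_of_superset (isOpen_connectedComponent.mem_nhds mem_connectedComponent)
    fun y hy ↦ hf x y hy

theorem isConstOnComponents_iff_mvfderiv_eq_zero [IsManifold (𝓡 m) ∞ M] {f : M → ℝ}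
    (hf : ContMDiff (𝓡 m) 𝓘(ℝ) ∞ f) :
    IsConstOnComponents f ↔ ∀ x, mvfderiv (𝓡 m) f x = 0 := by
  have : LocallyConnectedSpace M :=
    ChartedSpace.locallyConnectedSpace (EuclideanSpace ℝ (Fin m)) M
  constructor
  · intro h x
    have h1 := (IsLocallyConstant.iff_eventually_eq f).1 h.isLocallyConstant x
    have h2 : mvfderiv (𝓡 m) f x = mvfderiv (𝓡 m) (fun _ ↦ f x) x :=
      Filter.EventuallyEq.mfderiv_eq (h1 : f =ᶠ[𝓝 x] fun _ ↦ f x)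
    rw [h2, mvfderiv_const]
  · intro h
    have hloc : IsLocallyConstant f := by
      rw [IsLocallyConstant.iff_eventually_eq]
      intro x
      have hs := mem_extChartAt_source (I := 𝓡 m) x
      have hg := hf.contDiffOn_comp_extChartAt_symm (x₀ := x)
      have hd : ∀ z ∈ (extChartAt (𝓡 m) x).target,
          fderiv ℝ (f ∘ (extChartAt (𝓡 m) x).symm) z = 0 := by
        intro z hz
        have hq := (extChartAt (𝓡 m) x).map_target hz
        have hr := (extChartAt (𝓡 m) x).right_inv hz
        ext a
        have h1 := mvfderiv_eq_fderiv_chartDiff (f := f) (f' := f ∘ (extChartAt (𝓡 m) x).symm) hq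
          (by
            rw [hr]
            exact (hg.contDiffAt ((isOpen_extChartAt_target (I := 𝓡 m) x).mem_nhds
              hz)).differentiableAt (by simp))
          (eventuallyEq_comp_extChartAt f hq) (constField (𝓡 m) x a _)
        rw [h, hr, chartDiff_constField hq] at h1
        exact h1.symm
      obtain ⟨r, hr, hb⟩ := Metric.isOpen_iff.1 (isOpen_extChartAt_target (I := 𝓡 m) x) _
        (mem_extChartAt_target x)
      have hc : ∀ᶠ y in 𝓝 x, extChartAt (𝓡 m) x y ∈ Metric.ball (extChartAt (𝓡 m) x x) r :=
        (continuousAt_extChartAt x).eventually (Metric.ball_mem_nhds _ hr)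
      filter_upwards [hc, (isOpen_extChartAt_source (I := 𝓡 m) x).mem_nhds hs] with y hy hy'
      have h2 := Metric.isOpen_ball.is_const_of_fderiv_eq_zero (𝕜 := ℝ)
        (convex_ball (extChartAt (𝓡 m) x x) r).isPreconnected
        ((hg.differentiableOn (by simp)).mono hb) (fun z hz ↦ hd z (hb hz)) hy
        (Metric.mem_ball_self hr)
      rwa [Function.comp_apply, Function.comp_apply, (extChartAt (𝓡 m) x).left_inv hy',
        (extChartAt (𝓡 m) x).left_inv hs] at h2
    exact fun x y hy ↦ hloc.apply_eq_of_isPreconnected isPreconnected_connectedComponent hy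
      mem_connectedComponent

/-- If l(X) ≠ 0, the equation makes every Y a multiple of X, so the space has dimension at most 1.
-/
theorem wedge_id_eq_zero_iff {V : Type*} [AddCommGroup V] [Module ℝ V]
    (hV : 2 ≤ Module.finrank ℝ V) (l : V →ₗ[ℝ] ℝ) :
    (∀ X Y, l X • Y - l Y • X = 0) ↔ l = 0 := by
  refine ⟨fun h ↦ ?_, fun h ↦ by simp [h]⟩
  by_contra hl
  obtain ⟨X, hX⟩ : ∃ X, l X ≠ 0 := by
    by_contra! h'
    exact hl (LinearMap.ext h')
  have : Module.finrank ℝ V ≤ 1 := by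
    refine finrank_le_one X fun Y ↦ ⟨(l X)⁻¹ * l Y, ?_⟩
    rw [mul_smul, ← sub_eq_zero.1 (h X Y), smul_smul, inv_mul_cancel₀ hX, one_smul]
  omega

theorem forall_wedge_id_eq_zero_iff [IsManifold (𝓡 m) ∞ M] (hm : 2 ≤ m) {f : M → ℝ}
    (hf : ContMDiff (𝓡 m) 𝓘(ℝ) ∞ f) :
    (∀ (x : M) (X Y : TangentSpace (𝓡 m) x),
      mvfderiv (𝓡 m) f x X • Y - mvfderiv (𝓡 m) f x Y • X = 0) ↔ IsConstOnComponents f := by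
  rw [isConstOnComponents_iff_mvfderiv_eq_zero hf]
  refine forall_congr' fun x ↦ ?_
  have hfin : 2 ≤ Module.finrank ℝ (TangentSpace (𝓡 m) x) := by
    change 2 ≤ Module.finrank ℝ (EuclideanSpace ℝ (Fin m))
    rwa [finrank_euclideanSpace_fin]
  rw [← ContinuousLinearMap.coe_inj, ContinuousLinearMap.toLinearMap_zero]
  exact wedge_id_eq_zero_iff hfin (mvfderiv (𝓡 m) f x : TangentSpace (𝓡 m) x →ₗ[ℝ] ℝ)

end ComponentwiseConstant

/-! ### Closedness of ω^G. -/

noncomputable section SasakiSymplectic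

set_option synthInstance.maxHeartbeats 200000

variable {m : ℕ} {M : Type*} [TopologicalSpace M] [T2Space M]
  [ChartedSpace (EuclideanSpace ℝ (Fin m)) M] [IsManifold (𝓡 m) ∞ M]
  [RiemannianBundle (fun x : M ↦ TangentSpace (𝓡 m) x)]
  [IsContMDiffRiemannianBundle (𝓡 m) ∞ (EuclideanSpace ℝ (Fin m))
      (fun x : M ↦ TangentSpace (𝓡 m) x)]
  {cov : CovariantDerivative (𝓡 m) (EuclideanSpace ℝ (Fin m)) (TangentSpace (𝓡 m) : M → Type _)}
  {f₁ f₂ φ₁ φ₂ : M → ℝ}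

theorem contDiffOn_localOmega_connForm (hcov : cov.ContMDiffCovariantDerivative ∞)
    (hφ₁ : ContMDiff (𝓡 m) 𝓘(ℝ) ∞ φ₁) (hφ₂ : ContMDiff (𝓡 m) 𝓘(ℝ) ∞ φ₂)
    (u : TangentBundle (𝓡 m) M) :
    ContDiffOn ℝ ∞ (localOmega (connForm cov u.proj)
      ((φ₂ + φ₁) ∘ (extChartAt (𝓡 m) u.proj).symm) (metricRep u.proj))
      (extChartAt (𝓡 m).tangent u).target := by
  rw [extChartAt_tangent_target]
  exact contDiffOn_localOmega (contDiffOn_connForm cov hcov)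
    ((hφ₂.add hφ₁).contDiffOn_comp_extChartAt_symm) contDiffOn_metricRep

theorem contMDiff_omegaG (hcov : cov.ContMDiffCovariantDerivative ∞)
    (hφ₁ : ContMDiff (𝓡 m) 𝓘(ℝ) ∞ φ₁) (hφ₂ : ContMDiff (𝓡 m) 𝓘(ℝ) ∞ φ₂)
    (hf₁ : ∀ x, f₁ x = Real.exp (2 * φ₁ x)) (hf₂ : ∀ x, f₂ x = Real.exp (2 * φ₂ x))
    {X Y : ∀ u : TangentBundle (𝓡 m) M, TangentSpace (𝓡 m).tangent u}
    (hX : IsSmoothVF X) (hY : IsSmoothVF Y) :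
    ContMDiff (𝓡 m).tangent 𝓘(ℝ) ∞ (fun u ↦ omegaG cov f₁ f₂ φ₁ φ₂ u (X u) (Y u)) := by
  intro u
  have ho := (isOpen_extChartAt_target (I := (𝓡 m).tangent) u).mem_nhds (mem_extChartAt_target u)
  have h1 := (((contDiffOn_localOmega_connForm hcov hφ₁ hφ₂ u).contDiffAt ho).clm_apply
    ((contDiffOn_fieldRep hX).contDiffAt ho)).clm_apply ((contDiffOn_fieldRep hY).contDiffAt ho)
  refine (h1.contMDiffAt.comp u (contMDiffAt_extChartAt (n := ∞))).congr_of_eventuallyEq ?_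
  filter_upwards [(isOpen_extChartAt_source (I := (𝓡 m).tangent) u).mem_nhds
    (mem_extChartAt_source u)] with q hq
  rw [omegaG_eq_localOmega cov hf₁ hf₂ hq, chartDiff_eq_fieldRep hq, chartDiff_eq_fieldRep hq]
  rfl

theorem extDerivTwoForm_omegaG (hcov : cov.ContMDiffCovariantDerivative ∞)
    (hφ₁ : ContMDiff (𝓡 m) 𝓘(ℝ) ∞ φ₁) (hφ₂ : ContMDiff (𝓡 m) 𝓘(ℝ) ∞ φ₂)
    (hf₁ : ∀ x, f₁ x = Real.exp (2 * φ₁ x)) (hf₂ : ∀ x, f₂ x = Real.exp (2 * φ₂ x))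
    {X Y Z : ∀ u : TangentBundle (𝓡 m) M, TangentSpace (𝓡 m).tangent u}
    (hX : IsSmoothVF X) (hY : IsSmoothVF Y) (hZ : IsSmoothVF Z) {u q : TangentBundle (𝓡 m) M}
    (hq : q ∈ (extChartAt (𝓡 m).tangent u).source) :
    extDerivTwoForm (𝓡 m).tangent (omegaG cov f₁ f₂ φ₁ φ₂) X Y Z q
      = localExtDeriv (localOmega (connForm cov u.proj)
          ((φ₂ + φ₁) ∘ (extChartAt (𝓡 m) u.proj).symm) (metricRep u.proj))
        (extChartAt (𝓡 m).tangent u q) (chartDiff (𝓡 m).tangent u q (X q))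
        (chartDiff (𝓡 m).tangent u q (Y q)) (chartDiff (𝓡 m).tangent u q (Z q)) := by
  have ho := (isOpen_extChartAt_target (I := (𝓡 m).tangent) u).mem_nhds
    ((extChartAt (𝓡 m).tangent u).map_source hq)
  refine extDerivTwoForm_eq_localExtDeriv hq
    (((contDiffOn_localOmega_connForm hcov hφ₁ hφ₂ u).contDiffAt ho).differentiableAt (by simp))
    ?_ ?_ (hX.contMDiffAt.mdifferentiableAt (by simp)) (hY.contMDiffAt.mdifferentiableAt (by simp))
    (hZ.contMDiffAt.mdifferentiableAt (by simp))
  · filter_upwards [(isOpen_extChartAt_source (I := (𝓡 m).tangent) u).mem_nhds hq] with p hp X Y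
    exact omegaG_eq_localOmega cov hf₁ hf₂ hp X Y
  · intro a b
    rw [localOmega_apply, localOmega_apply, metricRep_symm _ _ b.1, metricRep_symm _ a.1]
    ring

theorem isClosedTwoForm_omegaG_iff (hcov : cov.ContMDiffCovariantDerivative ∞)
    (hmetric : cov.IsMetricCompatible)
    (hφ₁ : ContMDiff (𝓡 m) 𝓘(ℝ) ∞ φ₁) (hφ₂ : ContMDiff (𝓡 m) 𝓘(ℝ) ∞ φ₂)
    (hf₁ : ∀ x, f₁ x = Real.exp (2 * φ₁ x)) (hf₂ : ∀ x, f₂ x = Real.exp (2 * φ₂ x)) :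
    IsClosedTwoForm (𝓡 m).tangent (omegaG cov f₁ f₂ φ₁ φ₂) ↔
      ∀ (x : M) (X Y : TangentSpace (𝓡 m) x), cov.torsion x X Y
        = -(mvfderiv (𝓡 m) (φ₂ + φ₁) x X • Y - mvfderiv (𝓡 m) (φ₂ + φ₁) x Y • X) := by
  have hχ : ContMDiff (𝓡 m) 𝓘(ℝ) ∞ (φ₂ + φ₁) := hφ₂.add hφ₁
  have ht := torsion_eq_iff (cov := cov) hχ (s := -1)
  simp only [neg_one_smul] at ht
  have hdef : ∀ {x₀ : M} {z a b : EuclideanSpace ℝ (Fin m)},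
      connForm cov x₀ z a b - connForm cov x₀ z b a
        = -(fderiv ℝ ((φ₂ + φ₁) ∘ (extChartAt (𝓡 m) x₀).symm) z a • b
          - fderiv ℝ ((φ₂ + φ₁) ∘ (extChartAt (𝓡 m) x₀).symm) z b • a) ↔
      localDefect (connForm cov x₀) ((φ₂ + φ₁) ∘ (extChartAt (𝓡 m) x₀).symm) z a b = 0 :=
    eq_neg_iff_add_eq_zero
  simp only [hdef] at ht
  rw [ht]
  constructor
  · intro h x₀ z hz a b
    set u : TangentBundle (𝓡 m) M := ⟨x₀, 0⟩ with hu
    have hp : (z, (0 : EuclideanSpace ℝ (Fin m))) ∈ (extChartAt (𝓡 m).tangent u).target := by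
      rw [extChartAt_tangent_target]
      exact ⟨hz, mem_univ _⟩
    have hq := (extChartAt (𝓡 m).tangent u).map_target hp
    -- The vertical test vector is the defect S(a,b) itself, so that dω^G evaluates to -e^χ g(c, c)
    -- and positivity of the metric gives c = 0.
    set c := localDefect (connForm cov x₀) ((φ₂ + φ₁) ∘ (extChartAt (𝓡 m) x₀).symm) z a b with hc
    obtain ⟨X, hX, hXq⟩ := exists_isSmoothVF_tangentBundle_eq_constField hq (0, c)
    obtain ⟨Y, hY, hYq⟩ := exists_isSmoothVF_tangentBundle_eq_constField hq (a, 0)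
    obtain ⟨Z, hZ, hZq⟩ := exists_isSmoothVF_tangentBundle_eq_constField hq (b, 0)
    have h1 := h X Y Z hX hY hZ ((extChartAt (𝓡 m).tangent u).symm (z, 0))
    rw [extDerivTwoForm_omegaG hcov hφ₁ hφ₂ hf₁ hf₂ hX hY hZ hq, hXq, hYq, hZq,
      chartDiff_constField hq, chartDiff_constField hq, chartDiff_constField hq,
      (extChartAt (𝓡 m).tangent u).right_inv hp,
      localExtDeriv_localOmega_vertical (isOpen_extChartAt_target (I := 𝓡 m) x₀)
        (contDiffOn_connForm cov hcov) hχ.contDiffOn_comp_extChartAt_symm contDiffOn_metricRep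
        (fun z _ ↦ metricRep_symm z) (fun z hz ↦ fderiv_metricRep hmetric hz) hz, neg_eq_zero,
      mul_eq_zero, or_iff_right (Real.exp_ne_zero _)] at h1
    exact eq_zero_of_metricRep_self hz h1
  · intro h X Y Z hX hY hZ u
    have hq := mem_extChartAt_source (I := (𝓡 m).tangent) u
    rw [extDerivTwoForm_omegaG hcov hφ₁ hφ₂ hf₁ hf₂ hX hY hZ hq]
    refine localExtDeriv_localOmega_eq_zero (isOpen_extChartAt_target (I := 𝓡 m) u.proj)
      (contDiffOn_connForm cov hcov) hχ.contDiffOn_comp_extChartAt_symm contDiffOn_metricRep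
      (fun z _ ↦ metricRep_symm z) (fun z hz ↦ fderiv_metricRep hmetric hz) (h u.proj) ?_ _ _ _
    rw [extChartAt_tangent_apply hq]
    exact mem_extChartAt_target u.proj

end SasakiSymplectic

/-! ### The theorem. -/

set_option synthInstance.maxHeartbeats 200000 in
theorem theorem1p2 {m : ℕ} {M : Type*} [TopologicalSpace M] [T2Space M]
    [ChartedSpace (EuclideanSpace ℝ (Fin m)) M] [IsManifold (𝓡 m) ∞ M]
    [RiemannianBundle (fun x : M ↦ TangentSpace (𝓡 m) x)]
    [IsContMDiffRiemannianBundle (𝓡 m) ∞ (EuclideanSpace ℝ (Fin m))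
      (fun x : M ↦ TangentSpace (𝓡 m) x)]
    (cov : CovariantDerivative (𝓡 m) (EuclideanSpace ℝ (Fin m))
      (TangentSpace (𝓡 m) : M → Type _))
    (hcov : cov.ContMDiffCovariantDerivative ∞) (hmetric : cov.IsMetricCompatible)
    (f₁ f₂ φ₁ φ₂ : M → ℝ)
    (hφ₁ : ContMDiff (𝓡 m) 𝓘(ℝ) ∞ φ₁) (hφ₂ : ContMDiff (𝓡 m) 𝓘(ℝ) ∞ φ₂)
    (hf₁ : ∀ x, f₁ x = Real.exp (2 * φ₁ x)) (hf₂ : ∀ x, f₂ x = Real.exp (2 * φ₂ x)) :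
    -- (i)
    (IsIntegrableACS (𝓡 m).tangent m (acsG cov φ₁ φ₂) ↔
      IsFlatConnection cov ∧ ∀ (x : M) (X Y : TangentSpace (𝓡 m) x),
        cov.torsion x X Y = mvfderiv (𝓡 m) (φ₂ - φ₁) x X • Y - mvfderiv (𝓡 m) (φ₂ - φ₁) x Y • X) ∧
    (2 ≤ m → cov.torsion = 0 →
      (IsIntegrableACS (𝓡 m).tangent m (acsG cov φ₁ φ₂) ↔
        IsFlatConnection cov ∧ IsConstOnComponents (fun x ↦ f₂ x / f₁ x))) ∧
    -- (ii)
    (IsSymplecticForm (𝓡 m).tangent (omegaG cov f₁ f₂ φ₁ φ₂) ↔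
      ∀ (x : M) (X Y : TangentSpace (𝓡 m) x),
        cov.torsion x X Y =
          -(mvfderiv (𝓡 m) (φ₂ + φ₁) x X • Y - mvfderiv (𝓡 m) (φ₂ + φ₁) x Y • X)) ∧
    (2 ≤ m → cov.torsion = 0 →
      (IsClosedTwoForm (𝓡 m).tangent (omegaG cov f₁ f₂ φ₁ φ₂) ↔
        IsConstOnComponents (fun x ↦ f₂ x * f₁ x))) := by

  have hint := isIntegrableACS_acsG_iff hcov hφ₁ hφ₂
  have hclosed := isClosedTwoForm_omegaG_iff hcov hmetric hφ₁ hφ₂ hf₁ hf₂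
  refine ⟨hint, fun hm hT ↦ ?_, ⟨fun h ↦ hclosed.1 h.closed, fun h ↦ ⟨?_, ?_, ?_, hclosed.2 h⟩⟩,
    fun hm hT ↦ ?_⟩
  · rw [hint, hT]
    -- The quotient is e^{2ψ}, an injective function of ψ, so it is constant on components exactly
    -- when ψ is.
    have h1 : (fun x ↦ f₂ x / f₁ x) = fun x ↦ Real.exp (2 * (φ₂ - φ₁) x) := funext fun x ↦ by
      rw [hf₁, hf₂, ← Real.exp_sub, Pi.sub_apply, mul_sub]
    rw [h1, IsConstOnComponents.comp_iff (h := fun t ↦ Real.exp (2 * t)) fun s t h ↦ by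
      simpa using h, ← forall_wedge_id_eq_zero_iff (f := φ₂ - φ₁) hm (hφ₂.sub hφ₁)]
    exact and_congr_right fun _ ↦ forall₃_congr fun _ _ _ ↦ eq_comm
  · exact fun X Y hX hY ↦ contMDiff_omegaG hcov hφ₁ hφ₂ hf₁ hf₂ hX hY
  · exact omegaG_self cov hf₁ hf₂
  · exact eq_zero_of_omegaG cov hf₁ hf₂
  · rw [hclosed, hT]
    -- Likewise the product is e^{2(φ₁+φ₂)}.
    have h1 : (fun x ↦ f₂ x * f₁ x) = fun x ↦ Real.exp (2 * (φ₂ + φ₁) x) := funext fun x ↦ by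
      rw [hf₁, hf₂, ← Real.exp_add, Pi.add_apply, mul_add]
    rw [h1, IsConstOnComponents.comp_iff (h := fun t ↦ Real.exp (2 * t)) fun s t h ↦ by
      simpa using h, ← forall_wedge_id_eq_zero_iff (f := φ₂ + φ₁) hm (hφ₂.add hφ₁)]
    exact forall₃_congr fun _ _ _ ↦ eq_comm.trans neg_eq_zero
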